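/- Let $F\colon M^4\to\mathbb R^n$ be a smooth immersed $4$-dimensional submanifold. For $x\in M$ identify $T_xM$ with its image in $\mathbb R^n$, let $\mathrm{II}_x$ be the second fundamental form, and let $|\mathrm{II}_x|$ be the space of bilinear forms $\nu\cdot\mathrm{II}_x$ for $\nu$ normal to $M$ at $x$; in an orthonormal basis $(e_1,\dots,e_4)$ of $T_xM$ it is a space of symmetric $4\times4$ matrices. Suppose that: 1. $M$ is austere: for every normal direction $\nu$ the eigenvalues of $\nu\cdot\mathrm{II}_x$, with multiplicity, are symmetric about $0$. 2. $M$ is ruled by $2$-planes tangent to a smooth field $E$ of tangent $2$-planes: through each point $x$ of $M$ passes a disc of the affine plane $x+E_x$ that lies in $M$ and along which $E$ is constantly equal to $E_x$. 3. $M$ is of Type B and $E$ is an eigenspace of $\mathsf R$: at each $x$ there is an orthonormal basis of $T_xM$ in which every matrix of $|\mathrm{II}_x|$ has the form $$\begin{pmatrix} m&0&b_1&b_2\\0&m&b_3&b_4\\b_1&b_3&-m&0\\b_2&b_4&0&-m\end{pmatrix},$$ and $E_x$ is an eigenspace of the reflection $\mathsf R$ of $T_xM$ with matrix $\mathrm{diag}(1,1,-1,-1)$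 in that basis. 4. $\delta=\dim|\mathrm{II}_x|=2$ for every $x$. 5. At each $x$, for an orthonormal basis of $T_xM$ with $E_x=\mathrm{span}(e_1,e_2)$, let $\mathcal B$ be the space of upper right $2\times 2$ blocks of the matrices of $|\mathrm{II}_x|$; the quadratic form $\det|_{\mathcal B}$ has rank $2$ (this does not depend on the basis). Then at every $x\in M$ there are an orthonormal basis $(e_1,\dots,e_4)$ of $T_xM$ with $E_x=\mathrm{span}(e_1,e_2)$ and real numbers $p,q$ such that $|\mathrm{II}_x|$ is spanned by $$S^5=\begin{pmatrix}0&0&1&0\\0&0&0&p\\1&0&0&0\\0&p&0&0\end{pmatrix},\qquad S^6=\begin{pmatrix}0&0&0&1\\0&0&q&0\\0&q&0&0\\1&0&0&0\end{pmatrix},$$ and for every such basis and every such $p,q$ one has $pq=1$. In other words, the only $4$-folds of this kind are those with $pq\equiv1$. -/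

import Mathlib

open scoped Manifold ContDiff

noncomputable section

namespace Austere

/-- Euclidean space `ℝⁿ`. -/
abbrev Euc (n : ℕ) : Type := EuclideanSpace ℝ (Fin n)

section Immersions

variable {n : ℕ} {M : Type*} [TopologicalSpace M] [ChartedSpace (Euc 4) M]

/-- The differential of `F` at `x`, as a linear map from the tangent space of `M` to `ℝⁿ`. -/
def differential (F : M → Euc n) (x : M) : TangentSpace (𝓡 4) x →ₗ[ℝ] Euc n :=
  (mfderiv (𝓡 4) (𝓡 n) F x).toLinearMap

/-- The tangent space of the immersed `4`-fold `F : M → ℝⁿ` at `x`, as a linear subspace of `ℝⁿ`. -/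
def tangentPlane (F : M → Euc n) (x : M) : Submodule ℝ (Euc n) :=
  LinearMap.range (differential F x)

/-- `F : M → ℝⁿ` is a smooth immersion. -/
def IsSmoothImmersion (F : M → Euc n) : Prop :=
  ContMDiff (𝓡 4) (𝓡 n) ∞ F ∧ ∀ x, Function.Injective (differential F x)

/-- The component of the second derivative of `f` at `u` orthogonal to the subspace `T`. -/
def normalHessian (f : Euc 4 → Euc n) (u : Euc 4) (T : Submodule ℝ (Euc n)) :
    Euc 4 →ₗ[ℝ] Euc 4 →ₗ[ℝ] Euc n :=
  LinearMap.mk₂ ℝ (fun v w => Tᗮ.starProjection (fderiv ℝ (fderiv ℝ f) u v w))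
    (fun _ _ _ => by rw [map_add, add_apply, map_add])
    (fun _ _ _ => by rw [map_smul, smul_apply, map_smul])
    (fun _ _ _ => by rw [map_add, map_add])
    (fun _ _ _ => by rw [map_smul, map_smul])

/-- The second fundamental form `II(v, w) = (D_v w)^⊥` at `x`: the normal component of the second
derivative of `F` in the preferred chart at `x`.  Mathlib identifies `TangentSpace (𝓡 4) x` with
`ℝ⁴` through the same chart. -/
def secondFundamentalForm (F : M → Euc n) (x : M) :
    TangentSpace (𝓡 4) x →ₗ[ℝ] TangentSpace (𝓡 4) x →ₗ[ℝ] Euc n :=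
  normalHessian (F ∘ (extChartAt (𝓡 4) x).symm) (extChartAt (𝓡 4) x x) (tangentPlane F x)

/-- Contraction `ν ↦ ν · II` of the second fundamental form with a vector of `ℝⁿ`. -/
def contractII (F : M → Euc n) (x : M) :
    Euc n →ₗ[ℝ] LinearMap.BilinForm ℝ (TangentSpace (𝓡 4) x) where
  toFun ν := (secondFundamentalForm F x).compr₂ (innerₛₗ ℝ ν)
  map_add' a b := by ext; simp
  map_smul' c a := by ext; simp

/-- The space `|II_x|` of quadratic forms on the tangent space, spanned by the second fundamental
form in the various normal directions. -/
def spaceII (F : M → Euc n) (x : M) :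
    Submodule ℝ (LinearMap.BilinForm ℝ (TangentSpace (𝓡 4) x)) :=
  (tangentPlane F x)ᗮ.map (contractII F x)

/-- The normal rank `δ = dim |II_x|`. -/
def normalRank (F : M → Euc n) (x : M) : ℕ :=
  Module.finrank ℝ (spaceII F x)

/-- `e₁, …, e₄` is an orthonormal basis of the tangent space at `x`, for the induced metric. -/
def IsOrthonormalFrame (F : M → Euc n) (x : M) (e : Fin 4 → TangentSpace (𝓡 4) x) : Prop :=
  Orthonormal ℝ fun i => differential F x (e i)

/-- `|II_x|` as a space of `4 × 4` matrices, with respect to the frame `e`. -/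
def matricesII (F : M → Euc n) (x : M) (e : Fin 4 → TangentSpace (𝓡 4) x) :
    Submodule ℝ (Matrix (Fin 4) (Fin 4) ℝ) :=
  (spaceII F x).map (LinearMap.toMatrix₂Aux ℝ e e)

/-- The immersed `4`-fold is austere: in every normal direction the eigenvalues of the second
fundamental form, counted with multiplicity, are symmetrically arranged around zero. -/
def IsAustere (F : M → Euc n) : Prop :=
  ∀ x e, IsOrthonormalFrame F x e → ∀ S ∈ matricesII F x e,
    S.charpoly.roots.map (fun t => -t) = S.charpoly.roots

/-- `E` is a smooth field of tangent `2`-planes. -/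
def IsPlaneField (F : M → Euc n) (E : M → Submodule ℝ (Euc n)) : Prop :=
  ∀ x, E x ≤ tangentPlane F x ∧ Module.finrank ℝ (E x) = 2 ∧
    ∃ U : Set M, IsOpen U ∧ x ∈ U ∧ ∃ v₁ v₂ : M → Euc n,
      ContMDiffOn (𝓡 4) (𝓡 n) ∞ v₁ U ∧ ContMDiffOn (𝓡 4) (𝓡 n) ∞ v₂ U ∧
      ∀ y ∈ U, E y = Submodule.span ℝ {v₁ y, v₂ y}

/-- The immersed `4`-fold is ruled by planes tangent to `E`: near every point `x`, a disc of the
affine plane `F x + E x` lies in the `4`-fold, and `E` is tangent to it all along. -/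
def IsRuledBy (F : M → Euc n) (E : M → Submodule ℝ (Euc n)) : Prop :=
  ∀ x, ∃ r > 0, ∃ c : E x → M, c 0 = x ∧
    ContMDiffOn 𝓘(ℝ, E x) (𝓡 4) ∞ c (Metric.ball 0 r) ∧
    ∀ w ∈ Metric.ball (0 : E x) r, F (c w) = F x + w ∧ E (c w) = E x

end Immersions

/-- The maximal austere subspace `𝒬_B` of Type B. -/
def QB : Set (Matrix (Fin 4) (Fin 4) ℝ) :=
  {S | ∃ m b₁ b₂ b₃ b₄ : ℝ, S =
    !![m, 0, b₁, b₂;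
       0, m, b₃, b₄;
       b₁, b₃, -m, 0;
       b₂, b₄, 0, -m]}

/-- The matrix `S⁵` of the normal form, with parameter `p`. -/
def S5 (p : ℝ) : Matrix (Fin 4) (Fin 4) ℝ :=
  !![0, 0, 1, 0;
     0, 0, 0, p;
     1, 0, 0, 0;
     0, p, 0, 0]

/-- The matrix `S⁶` of the normal form, with parameter `q`. -/
def S6 (q : ℝ) : Matrix (Fin 4) (Fin 4) ℝ :=
  !![0, 0, 0, 1;
     0, 0, q, 0;
     0, q, 0, 0;
     1, 0, 0, 0]

/-- The determinant of `2 × 2` matrices, as a quadratic form. -/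
def detForm : QuadraticForm ℝ (Matrix (Fin 2) (Fin 2) ℝ) :=
  QuadraticMap.linMulLin (Matrix.entryLinearMap ℝ ℝ 0 0) (Matrix.entryLinearMap ℝ ℝ 1 1) -
    QuadraticMap.linMulLin (Matrix.entryLinearMap ℝ ℝ 0 1) (Matrix.entryLinearMap ℝ ℝ 1 0)

theorem detForm_apply (A : Matrix (Fin 2) (Fin 2) ℝ) : detForm A = A.det := by
  simp [detForm, Matrix.det_fin_two]

/-- The rank of the quadratic form `det` restricted to a space `𝓑` of `2 × 2` matrices. -/
def detRank (𝓑 : Submodule ℝ (Matrix (Fin 2) (Fin 2) ℝ)) : ℕ :=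
  Module.finrank ℝ (LinearMap.range (QuadraticMap.polarBilin (detForm.comp 𝓑.subtype)))

section TypeB

variable {n : ℕ} {M : Type*} [TopologicalSpace M] [ChartedSpace (Euc 4) M]

/-- `M` is of Type B at `x`, and `E x` is an eigenspace of the reflection `R` which is `+1` on
`e₁, e₂` and `-1` on `e₃, e₄` for an orthonormal basis `e` putting `|II_x|` inside `𝒬_B`. -/
def IsTypeBWithEigenspace (F : M → Euc n) (E : M → Submodule ℝ (Euc n)) (x : M) : Prop :=
  ∃ e : Fin 4 → TangentSpace (𝓡 4) x, IsOrthonormalFrame F x e ∧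
    (∀ S ∈ matricesII F x e, S ∈ QB) ∧
    ∃ R : Module.End ℝ (TangentSpace (𝓡 4) x),
      (∀ i, R (e i) = (![1, 1, -1, -1] : Fin 4 → ℝ) i • e i) ∧
      ∃ μ : ℝ, E x = (Module.End.eigenspace R μ).map (differential F x)

/-- An orthonormal basis of the tangent space whose first two vectors span `E x`. -/
def IsAdaptedFrame (F : M → Euc n) (E : M → Submodule ℝ (Euc n)) (x : M)
    (e : Fin 4 → TangentSpace (𝓡 4) x) : Prop :=
  IsOrthonormalFrame F x e ∧
    E x = Submodule.span ℝ {differential F x (e 0), differential F x (e 1)}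

/-- The space `𝓑` of upper right `2 × 2` blocks of the matrices in `|II_x|`. -/
def blockSpace (F : M → Euc n) (x : M) (e : Fin 4 → TangentSpace (𝓡 4) x) :
    Submodule ℝ (Matrix (Fin 2) (Fin 2) ℝ) :=
  (spaceII F x).map (LinearMap.toMatrix₂Aux ℝ ![e 0, e 1] ![e 2, e 3])

/-- The form `det` has rank `2` on `𝓑`; the rank does not depend on the adapted frame. -/
def HasDetRankTwo (F : M → Euc n) (E : M → Submodule ℝ (Euc n)) (x : M) : Prop :=
  ∃ e : Fin 4 → TangentSpace (𝓡 4) x, IsAdaptedFrame F E x e ∧ detRank (blockSpace F x e) = 2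

/-- `e` is an adapted frame in which `|II_x|` is spanned by `S⁵` and `S⁶`, with parameters
`p` and `q`. -/
def IsNormalFrame (F : M → Euc n) (E : M → Submodule ℝ (Euc n)) (x : M)
    (e : Fin 4 → TangentSpace (𝓡 4) x) (p q : ℝ) : Prop :=
  IsAdaptedFrame F E x e ∧ matricesII F x e = Submodule.span ℝ {S5 p, S6 q}

end TypeB

end Austere

end

set_option linter.unusedSectionVars false

/-! Let `P` be the orthogonal projection of ℝⁿ onto the ruling, a₁, a₂ an orthonormal pair of
tangent vectors orthogonal to the ruling ("horizontal"), and d_ci the derivative of `P` in the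
direction a_c applied to the i-th basis vector of the ruling. The d_ci are orthogonal to the ruling,
and their normal parts are the values of II on a_c and the i-th basis vector. Since the ruling is
asymptotic, m = 0 in the Type B form, so the horizontal planes are asymptotic as well and II reduces
to its off-diagonal block. The normal form of that block is linear algebra of planes of 2 × 2
matrices (`exists_rotMap_eq_span`); it says that d₁₂ = q d₂₁ and d₂₂ = p d₁₁ modulo a₁, a₂, and
nondegeneracy of det gives p, q ≠ 0.

Put W = D₁D₂ᵀ - D₂D₁ᵀ (`wedgeOp`). Antisymmetrising the second derivatives of horizontal fields
gives a Codazzi relation for W on horizontal vectors (`RuledPatch.codazzi`). Along a leaf `P` is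
constant, and at the point displaced by (t₁, t₂) the horizontal plane is spanned by a_c + t₁ d_c1 +
t₂ d_c2, with the same derivatives of `P` (`RuledPatch.exists_transport`). The Codazzi relation
therefore holds for all small t, and comparing coefficients of t yields formulas for W a_c and W
d_ci with one common 2 × 2 matrix R and a scalar ρ.

The rest is algebra. Write d₁₂ = q d₂₁ + x a₁ + y a₂ and d₂₂ = p d₁₁ + x' a₁ + y' a₂. If xy' ≠ yx',
the four d_ci are independent, and the formulas force every coefficient of a₁ in them to vanish,
which is absurd (`det_eq_zero`). Hence xy' = yx', and some vector is orthogonal to all d_ci but not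
to both a₁ and a₂; pairing with it gives det R = 0. As W is skew, Rg is skew, where g is the Gram
matrix of the d_ci summed over i; a skew 2 × 2 matrix of determinant zero vanishes. This gives ‖W‖²
= -2ρ² for the Hilbert–Schmidt norm, so W = 0. For normal vectors ν₅, ν₆ representing S⁵, S⁶ this
reads 0 = ⟨Wν₅, ν₆⟩ = pq - 1 (`mul_eq_one_of_curvature`). -/

namespace Austere

/-! ### Algebra of the derivatives of the ruling at one point. -/

section FlatRulingAlgebra

variable {V : Type*} [NormedAddCommGroup V] [InnerProductSpace ℝ V]

local notation "⟪" x ", " y "⟫" => inner ℝ x y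

/-- The operator `D₁ D₂ᵀ - D₂ D₁ᵀ` for `D_c : ℝ² → V` with `D_c e_i = d_ci`. -/
def wedgeOp (d₁₁ d₁₂ d₂₁ d₂₂ z : V) : V :=
  ⟪d₂₁, z⟫ • d₁₁ + ⟪d₂₂, z⟫ • d₁₂ - ⟪d₁₁, z⟫ • d₂₁ - ⟪d₁₂, z⟫ • d₂₂

theorem wedgeOp_add (d₁₁ d₁₂ d₂₁ d₂₂ x y : V) :
    wedgeOp d₁₁ d₁₂ d₂₁ d₂₂ (x + y) = wedgeOp d₁₁ d₁₂ d₂₁ d₂₂ x + wedgeOp d₁₁ d₁₂ d₂₁ d₂₂ y := by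
  simp only [wedgeOp, inner_add_right]; module

theorem wedgeOp_smul (d₁₁ d₁₂ d₂₁ d₂₂ : V) (c : ℝ) (x : V) :
    wedgeOp d₁₁ d₁₂ d₂₁ d₂₂ (c • x) = c • wedgeOp d₁₁ d₁₂ d₂₁ d₂₂ x := by
  simp only [wedgeOp, inner_smul_right]; module

theorem inner_wedgeOp_left (d₁₁ d₁₂ d₂₁ d₂₂ x y : V) :
    ⟪wedgeOp d₁₁ d₁₂ d₂₁ d₂₂ x, y⟫ =
      ⟪d₂₁, x⟫ * ⟪d₁₁, y⟫ + ⟪d₂₂, x⟫ * ⟪d₁₂, y⟫ - ⟪d₁₁, x⟫ * ⟪d₂₁, y⟫ - ⟪d₁₂, x⟫ * ⟪d₂₂, y⟫ := by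
  simp only [wedgeOp, inner_add_left, inner_sub_left, real_inner_smul_left]

/-- The square of the Hilbert–Schmidt norm of `wedgeOp`. -/
theorem sum_norm_sq_wedgeOp {ι : Type*} [Fintype ι] (b : OrthonormalBasis ι ℝ V)
    (d₁₁ d₁₂ d₂₁ d₂₂ : V) :
    ∑ k, ‖wedgeOp d₁₁ d₁₂ d₂₁ d₂₂ (b k)‖ ^ 2 =
      2 * (⟪wedgeOp d₁₁ d₁₂ d₂₁ d₂₂ d₂₁, d₁₁⟫ + ⟪wedgeOp d₁₁ d₁₂ d₂₁ d₂₂ d₂₂, d₁₂⟫) := by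
  -- Parseval turns the sum over the basis of each quadratic monomial into an inner product.
  have key : ∀ x y : V, ∑ k, ⟪x, b k⟫ * ⟪y, b k⟫ = ⟪x, y⟫ := fun x y => by
    rw [← b.sum_inner_mul_inner x y]
    exact Finset.sum_congr rfl fun k _ => by rw [real_inner_comm y]
  have expand : ∀ k, ‖wedgeOp d₁₁ d₁₂ d₂₁ d₂₂ (b k)‖ ^ 2 =
      ⟪d₂₁, b k⟫ * ⟪d₂₁, b k⟫ * ⟪d₁₁, d₁₁⟫ + ⟪d₂₂, b k⟫ * ⟪d₂₂, b k⟫ * ⟪d₁₂, d₁₂⟫ +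
      ⟪d₁₁, b k⟫ * ⟪d₁₁, b k⟫ * ⟪d₂₁, d₂₁⟫ + ⟪d₁₂, b k⟫ * ⟪d₁₂, b k⟫ * ⟪d₂₂, d₂₂⟫ +
      2 * (⟪d₂₁, b k⟫ * ⟪d₂₂, b k⟫ * ⟪d₁₁, d₁₂⟫) - 2 * (⟪d₂₁, b k⟫ * ⟪d₁₁, b k⟫ * ⟪d₁₁, d₂₁⟫) -
      2 * (⟪d₂₁, b k⟫ * ⟪d₁₂, b k⟫ * ⟪d₁₁, d₂₂⟫) - 2 * (⟪d₂₂, b k⟫ * ⟪d₁₁, b k⟫ * ⟪d₁₂, d₂₁⟫) -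
      2 * (⟪d₂₂, b k⟫ * ⟪d₁₂, b k⟫ * ⟪d₁₂, d₂₂⟫) +
      2 * (⟪d₁₁, b k⟫ * ⟪d₁₂, b k⟫ * ⟪d₂₁, d₂₂⟫) := fun k => by
    rw [← real_inner_self_eq_norm_sq, inner_wedgeOp_left]
    simp only [wedgeOp, inner_add_right, inner_sub_right, real_inner_smul_right]
    rw [real_inner_comm d₁₁ d₁₂, real_inner_comm d₂₁ d₁₁, real_inner_comm d₂₂ d₁₁,
      real_inner_comm d₂₁ d₁₂, real_inner_comm d₂₂ d₁₂, real_inner_comm d₂₁ d₂₂]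
    ring
  simp only [expand, Finset.sum_add_distrib, Finset.sum_sub_distrib, ← Finset.mul_sum,
    ← Finset.sum_mul, key, inner_wedgeOp_left]
  rw [real_inner_comm d₁₁ d₁₂, real_inner_comm d₂₁ d₁₁, real_inner_comm d₂₂ d₁₁,
      real_inner_comm d₂₁ d₁₂, real_inner_comm d₂₂ d₁₂, real_inner_comm d₂₁ d₂₂]
  ring

/-- If an affine function of `t` lies in the span of two affine functions of `t` which are in
general position, then its coefficients in the latter do not depend on `t`. -/
theorem eq_of_affine_mem_span {a₁ a₂ b₁ b₂ X Y : V} {r₁ r₂ ε : ℝ} (hε : ε ≠ 0)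
    (hind : ∀ x₁ x₂ y₁ y₂ : ℝ, x₁ • a₁ + x₂ • a₂ + y₁ • b₁ + y₂ • b₂ = 0 →
      x₁ = 0 ∧ x₂ = 0 ∧ y₁ = 0 ∧ y₂ = 0)
    (hX : X = r₁ • a₁ + r₂ • a₂)
    (h : ∀ t : ℝ, t = ε ∨ t = ε / 2 → ∃ s₁ s₂ : ℝ,
      X + t • Y = s₁ • (a₁ + t • b₁) + s₂ • (a₂ + t • b₂)) :
    Y = r₁ • b₁ + r₂ • b₂ := by
  obtain ⟨s₁, s₂, hs⟩ := h ε (Or.inl rfl)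
  obtain ⟨s₁', s₂', hs'⟩ := h (ε / 2) (Or.inr rfl)
  -- With X known, `Y` is eliminated between t = ε and t = ε/2 through εY = 2 · (ε/2)Y; independence
  -- then equates the coefficients at both parameters and at 0.
  have h0 : ((s₁ - r₁) - 2 * (s₁' - r₁)) • a₁ + ((s₂ - r₂) - 2 * (s₂' - r₂)) • a₂ +
      (ε * (s₁ - s₁')) • b₁ + (ε * (s₂ - s₂')) • b₂ = 0 := by
    have e1 : ε • Y = s₁ • (a₁ + ε • b₁) + s₂ • (a₂ + ε • b₂) - (r₁ • a₁ + r₂ • a₂) := by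
      rw [← hs, hX]; abel
    have e2 : (ε / 2) • Y = s₁' • (a₁ + (ε / 2) • b₁) + s₂' • (a₂ + (ε / 2) • b₂)
        - (r₁ • a₁ + r₂ • a₂) := by
      rw [← hs', hX]; abel
    have e3 : ε • Y - (2 : ℝ) • ((ε / 2) • Y) = 0 := by module
    rw [e1, e2] at e3
    rw [← e3]; module
  obtain ⟨h1, h2, h3, h4⟩ := hind _ _ _ _ h0
  have h3' : s₁ = s₁' := by
    rcases mul_eq_zero.1 h3 with h | h
    · exact absurd h hε
    · linarith
  have h4' : s₂ = s₂' := by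
    rcases mul_eq_zero.1 h4 with h | h
    · exact absurd h hε
    · linarith
  have hr1 : s₁ = r₁ := by linarith
  have hr2 : s₂ = r₂ := by linarith
  rw [hX, hr1, hr2] at hs
  have : ε • Y = ε • (r₁ • b₁ + r₂ • b₂) := by
    have : ε • Y = (r₁ • a₁ + r₂ • a₂ + ε • Y) - (r₁ • a₁ + r₂ • a₂) := by abel
    rw [this, hs]; module
  exact smul_right_injective V hε this

/-- Eliminating σ, α' and β' - α leaves (uv - s²) β = 0, so positivity of the Gram determinant kills
β and then α'. This linear system appears twice in `det_eq_zero`, once for each index i of d_ci. -/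
theorem gram_system {u v s α α' β β' σ : ℝ} (hu : 0 < u) (hg : 0 < u * v - s * s)
    (hσ : σ = u * β + s * β' - (s * α + v * α'))
    (h₁ : s * α + v * α' - σ - s * α - -u * β = 0)
    (h₃ : s * β + v * β' - v * α - -s * β = 0)
    (h₄ : -(u * β + s * β') - σ - v * α' - -s * β' = 0) : α' = 0 := by
  have hv : 0 < v := by nlinarith [mul_self_nonneg s]
  have e : (u * v - s * s) * β = 0 := by
    linear_combination v / 4 * (h₁ - h₄) - v / 2 * hσ - s / 2 * h₃ - v / 4 * (h₁ + h₄)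
  have hβ : β = 0 := by simpa [hg.ne'] using e
  have : v * α' = 0 := by rw [hβ] at h₁ h₄; linarith
  simpa [hv.ne'] using this

/-- The configuration of vectors attached to a point of a ruled `4`-fold with the normal form of
type `S⁵, S⁶`: an orthonormal pair `a₁, a₂` of tangent vectors orthogonal to the ruling, the
derivatives `d_ci` of the ruling, and two normal vectors `ν₅, ν₆`. -/
structure NormalConfiguration (a₁ a₂ d₁₁ d₁₂ d₂₁ d₂₂ ν₅ ν₆ : V) (p q x y x' y' : ℝ) : Prop where
  aa₁ : ⟪a₁, a₁⟫ = 1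
  aa₂ : ⟪a₂, a₂⟫ = 1
  aa₁₂ : ⟪a₁, a₂⟫ = 0
  ν₅a₁ : ⟪ν₅, a₁⟫ = 0
  ν₅a₂ : ⟪ν₅, a₂⟫ = 0
  ν₆a₁ : ⟪ν₆, a₁⟫ = 0
  ν₆a₂ : ⟪ν₆, a₂⟫ = 0
  ν₅d₁₁ : ⟪ν₅, d₁₁⟫ = 1
  ν₅d₂₁ : ⟪ν₅, d₂₁⟫ = 0
  ν₆d₁₁ : ⟪ν₆, d₁₁⟫ = 0
  ν₆d₂₁ : ⟪ν₆, d₂₁⟫ = 1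
  hd₁₂ : d₁₂ = q • d₂₁ + x • a₁ + y • a₂
  hd₂₂ : d₂₂ = p • d₁₁ + x' • a₁ + y' • a₂
  hp : p ≠ 0
  hq : q ≠ 0

namespace NormalConfiguration

variable {a₁ a₂ d₁₁ d₁₂ d₂₁ d₂₂ ν₅ ν₆ : V} {p q x y x' y' : ℝ}

theorem ν₅d₁₂ (h : NormalConfiguration a₁ a₂ d₁₁ d₁₂ d₂₁ d₂₂ ν₅ ν₆ p q x y x' y') :
    ⟪ν₅, d₁₂⟫ = 0 := by
  rw [h.hd₁₂]; simp [inner_add_right, inner_smul_right, h.ν₅d₂₁, h.ν₅a₁, h.ν₅a₂]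

theorem ν₅d₂₂ (h : NormalConfiguration a₁ a₂ d₁₁ d₁₂ d₂₁ d₂₂ ν₅ ν₆ p q x y x' y') :
    ⟪ν₅, d₂₂⟫ = p := by
  rw [h.hd₂₂]; simp [inner_add_right, inner_smul_right, h.ν₅d₁₁, h.ν₅a₁, h.ν₅a₂]

theorem ν₆d₁₂ (h : NormalConfiguration a₁ a₂ d₁₁ d₁₂ d₂₁ d₂₂ ν₅ ν₆ p q x y x' y') :
    ⟪ν₆, d₁₂⟫ = q := by
  rw [h.hd₁₂]; simp [inner_add_right, inner_smul_right, h.ν₆d₂₁, h.ν₆a₁, h.ν₆a₂]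

theorem ν₆d₂₂ (h : NormalConfiguration a₁ a₂ d₁₁ d₁₂ d₂₁ d₂₂ ν₅ ν₆ p q x y x' y') :
    ⟪ν₆, d₂₂⟫ = 0 := by
  rw [h.hd₂₂]; simp [inner_add_right, inner_smul_right, h.ν₆d₁₁, h.ν₆a₁, h.ν₆a₂]

theorem indep_a (h : NormalConfiguration a₁ a₂ d₁₁ d₁₂ d₂₁ d₂₂ ν₅ ν₆ p q x y x' y')
    {x₁ x₂ : ℝ} (h0 : x₁ • a₁ + x₂ • a₂ = 0) : x₁ = 0 ∧ x₂ = 0 := by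
  have h1 := congrArg (fun z => ⟪a₁, z⟫) h0
  have h2 := congrArg (fun z => ⟪a₂, z⟫) h0
  simp only [inner_add_right, inner_smul_right, h.aa₁, h.aa₂, h.aa₁₂, inner_zero_right,
    real_inner_comm a₁ a₂] at h1 h2
  constructor <;> linarith

/-- The normals ν₅, ν₆ kill a₁, a₂ and are dual to d₁₁, d₂₁. This lemma and `indep_snd`, where p, q
≠ 0 enters, are the general position required by `eq_of_affine_mem_span` along the two axes of the
leaf. -/
theorem indep_fst (h : NormalConfiguration a₁ a₂ d₁₁ d₁₂ d₂₁ d₂₂ ν₅ ν₆ p q x y x' y')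
    (x₁ x₂ y₁ y₂ : ℝ) (h0 : x₁ • a₁ + x₂ • a₂ + y₁ • d₁₁ + y₂ • d₂₁ = 0) :
    x₁ = 0 ∧ x₂ = 0 ∧ y₁ = 0 ∧ y₂ = 0 := by
  have h5 := congrArg (fun z => ⟪ν₅, z⟫) h0
  have h6 := congrArg (fun z => ⟪ν₆, z⟫) h0
  simp only [inner_add_right, inner_smul_right, h.ν₅a₁, h.ν₅a₂, h.ν₅d₁₁, h.ν₅d₂₁, h.ν₆a₁, h.ν₆a₂,
    h.ν₆d₁₁, h.ν₆d₂₁, inner_zero_right, mul_zero, mul_one, zero_add, add_zero] at h5 h6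
  rw [h5, h6, zero_smul, zero_smul, add_zero, add_zero] at h0
  exact ⟨(h.indep_a h0).1, (h.indep_a h0).2, h5, h6⟩

theorem indep_snd (h : NormalConfiguration a₁ a₂ d₁₁ d₁₂ d₂₁ d₂₂ ν₅ ν₆ p q x y x' y')
    (x₁ x₂ y₁ y₂ : ℝ) (h0 : x₁ • a₁ + x₂ • a₂ + y₁ • d₁₂ + y₂ • d₂₂ = 0) :
    x₁ = 0 ∧ x₂ = 0 ∧ y₁ = 0 ∧ y₂ = 0 := by
  have h5 := congrArg (fun z => ⟪ν₅, z⟫) h0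
  have h6 := congrArg (fun z => ⟪ν₆, z⟫) h0
  simp only [inner_add_right, inner_smul_right, h.ν₅a₁, h.ν₅a₂, h.ν₅d₁₂, h.ν₅d₂₂, h.ν₆a₁, h.ν₆a₂,
    h.ν₆d₁₂, h.ν₆d₂₂, inner_zero_right, mul_zero, zero_add, add_zero] at h5 h6
  have h5' : y₂ = 0 := by simpa [h.hp] using h5
  have h6' : y₁ = 0 := by simpa [h.hq] using h6
  rw [h5', h6', zero_smul, zero_smul, add_zero, add_zero] at h0
  exact ⟨(h.indep_a h0).1, (h.indep_a h0).2, h6', h5'⟩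

/-- The derivatives of the ruling are not linearly independent if they come with operators `R`
as in the curvature identities. -/
theorem det_eq_zero (h : NormalConfiguration a₁ a₂ d₁₁ d₁₂ d₂₁ d₂₂ ν₅ ν₆ p q x y x' y')
    {R₁₁ R₁₂ R₂₁ R₂₂ ρ σ₁ σ₂ : ℝ} (hρ : ρ = ⟪d₁₂, d₂₁⟫ - ⟪d₂₂, d₁₁⟫)
    (hσ₁ : σ₁ = ⟪d₁₁, a₂⟫ - ⟪d₂₁, a₁⟫) (hσ₂ : σ₂ = ⟪d₁₂, a₂⟫ - ⟪d₂₂, a₁⟫)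
    (ha₁ : wedgeOp d₁₁ d₁₂ d₂₁ d₂₂ a₁ = σ₁ • d₁₁ + σ₂ • d₁₂ + R₁₁ • a₁ + R₁₂ • a₂)
    (ha₂ : wedgeOp d₁₁ d₁₂ d₂₁ d₂₂ a₂ = σ₁ • d₂₁ + σ₂ • d₂₂ + R₂₁ • a₁ + R₂₂ • a₂)
    (h₁₁ : wedgeOp d₁₁ d₁₂ d₂₁ d₂₂ d₁₁ = ρ • d₁₂ + R₁₁ • d₁₁ + R₁₂ • d₂₁)
    (h₁₂ : wedgeOp d₁₁ d₁₂ d₂₁ d₂₂ d₁₂ = -ρ • d₁₁ + R₁₁ • d₁₂ + R₁₂ • d₂₂)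
    (h₂₁ : wedgeOp d₁₁ d₁₂ d₂₁ d₂₂ d₂₁ = ρ • d₂₂ + R₂₁ • d₁₁ + R₂₂ • d₂₁)
    (h₂₂ : wedgeOp d₁₁ d₁₂ d₂₁ d₂₂ d₂₂ = -ρ • d₂₁ + R₂₁ • d₁₂ + R₂₂ • d₂₂) :
    x * y' - y * x' = 0 := by
  by_contra hΔ
  have hind : ∀ y₁ y₂ y₃ y₄ : ℝ, y₁ • d₁₁ + y₂ • d₁₂ + y₃ • d₂₁ + y₄ • d₂₂ = 0 →
      y₁ = 0 ∧ y₂ = 0 ∧ y₃ = 0 ∧ y₄ = 0 := by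
    intro y₁ y₂ y₃ y₄ h0
    have h0' : (y₂ * x + y₄ * x') • a₁ + (y₂ * y + y₄ * y') • a₂ + (y₁ + y₄ * p) • d₁₁ +
        (y₃ + y₂ * q) • d₂₁ = 0 := by
      rw [← h0, h.hd₁₂, h.hd₂₂]; module
    obtain ⟨e1, e2, e3, e4⟩ := h.indep_fst _ _ _ _ h0'
    have hy2 : y₂ = 0 := by
      have : y₂ * (x * y' - y * x') = 0 := by linear_combination y' * e1 - x' * e2
      simpa [hΔ] using this
    have hy4 : y₄ = 0 := by
      have : y₄ * (x * y' - y * x') = 0 := by linear_combination x * e2 - y * e1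
      simpa [hΔ] using this
    subst hy2 hy4
    refine ⟨by linarith, rfl, by linarith, rfl⟩
  obtain ⟨α₁, α₂, α₃, α₄, hα⟩ : ∃ α₁ α₂ α₃ α₄ : ℝ,
      a₁ = α₁ • d₁₁ + α₂ • d₁₂ + α₃ • d₂₁ + α₄ • d₂₂ := by
    -- Cramer's rule for x a₁ + y a₂ = d₁₂ - q d₂₁ and x' a₁ + y' a₂ = d₂₂ - p d₁₁.
    refine ⟨(x * y' - y * x')⁻¹ * (y * p), (x * y' - y * x')⁻¹ * y',
      (x * y' - y * x')⁻¹ * (-(y' * q)), (x * y' - y * x')⁻¹ * (-y), ?_⟩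
    apply smul_right_injective V hΔ
    simp only [smul_add, smul_smul, mul_inv_cancel_left₀ hΔ]
    rw [h.hd₁₂, h.hd₂₂]; module
  obtain ⟨β₁, β₂, β₃, β₄, hβ⟩ : ∃ β₁ β₂ β₃ β₄ : ℝ,
      a₂ = β₁ • d₁₁ + β₂ • d₁₂ + β₃ • d₂₁ + β₄ • d₂₂ := by
    refine ⟨(x * y' - y * x')⁻¹ * (-(x * p)), (x * y' - y * x')⁻¹ * (-x'),
      (x * y' - y * x')⁻¹ * (x' * q), (x * y' - y * x')⁻¹ * x, ?_⟩
    apply smul_right_injective V hΔ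
    simp only [smul_add, smul_smul, mul_inv_cancel_left₀ hΔ]
    rw [h.hd₁₂, h.hd₂₂]; module
  -- By independence the coefficients in the four formulas for `wedgeOp` on d_ci can be compared.
  -- They determine the Gram matrix: ⟨d_ci, d_c'j⟩ vanishes for i ≠ j and does not depend on i = j,
  -- and R is expressed by u, v, s.
  have i₁₁ := hind (⟪d₂₁, d₁₁⟫ - R₁₁) (⟪d₂₂, d₁₁⟫ - ρ) (-⟪d₁₁, d₁₁⟫ - R₁₂) (-⟪d₁₂, d₁₁⟫)
    (by rw [← sub_eq_zero] at h₁₁; rw [← h₁₁, wedgeOp]; module)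
  have i₁₂ := hind (⟪d₂₁, d₁₂⟫ + ρ) (⟪d₂₂, d₁₂⟫ - R₁₁) (-⟪d₁₁, d₁₂⟫) (-⟪d₁₂, d₁₂⟫ - R₁₂)
    (by rw [← sub_eq_zero] at h₁₂; rw [← h₁₂, wedgeOp]; module)
  have i₂₁ := hind (⟪d₂₁, d₂₁⟫ - R₂₁) (⟪d₂₂, d₂₁⟫) (-⟪d₁₁, d₂₁⟫ - R₂₂) (-⟪d₁₂, d₂₁⟫ - ρ)
    (by rw [← sub_eq_zero] at h₂₁; rw [← h₂₁, wedgeOp]; module)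
  have i₂₂ := hind (⟪d₂₁, d₂₂⟫) (⟪d₂₂, d₂₂⟫ - R₂₁) (-⟪d₁₁, d₂₂⟫ + ρ) (-⟪d₁₂, d₂₂⟫ - R₂₂)
    (by rw [← sub_eq_zero] at h₂₂; rw [← h₂₂, wedgeOp]; module)
  obtain ⟨p1, p2, p3, p4⟩ := i₁₁
  obtain ⟨p5, p6, p7, p8⟩ := i₁₂
  obtain ⟨p9, p10, p11, p12⟩ := i₂₁
  obtain ⟨p13, p14, p15, p16⟩ := i₂₂
  -- The coefficients give ⟨d₂₂, d₁₁⟩ = ρ and ⟨d₁₂, d₂₁⟩ = -ρ, so the definition of ρ reads ρ = -2ρ.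
  have hρ0 : ρ = 0 := by linarith
  set u := ⟪d₁₁, d₁₁⟫ with hu
  set v := ⟪d₂₁, d₂₁⟫ with hv
  set s := ⟪d₁₁, d₂₁⟫ with hs
  have c1 : ⟪d₂₁, d₁₁⟫ = s := real_inner_comm _ _
  have c2 : ⟪d₁₂, d₁₁⟫ = 0 := by linarith
  have c3 : ⟪d₁₁, d₁₂⟫ = 0 := by linarith
  have c4 : ⟪d₂₂, d₁₁⟫ = 0 := by linarith
  have c5 : ⟪d₁₁, d₂₂⟫ = 0 := by linarith
  have c6 : ⟪d₂₁, d₁₂⟫ = 0 := by linarith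
  have c7 : ⟪d₁₂, d₂₁⟫ = 0 := by linarith
  have c8 : ⟪d₂₂, d₂₁⟫ = 0 := by linarith
  have c9 : ⟪d₂₁, d₂₂⟫ = 0 := by linarith
  have c10 : ⟪d₁₂, d₁₂⟫ = u := by linarith
  have c11 : ⟪d₂₂, d₂₂⟫ = v := by linarith
  have c12 : ⟪d₂₂, d₁₂⟫ = s := by linarith
  have c13 : ⟪d₁₂, d₂₂⟫ = s := by rw [← c12]; exact real_inner_comm _ _
  have r1 : R₁₁ = s := by linarith
  have r2 : R₁₂ = -u := by linarith
  have r3 : R₂₁ = v := by linarith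
  have r4 : R₂₂ = -s := by linarith
  have m1 : ⟪d₁₁, a₁⟫ = u * α₁ + s * α₃ := by
    rw [hα]; simp only [inner_add_right, inner_smul_right, ← hu, ← hs, c3, c5]; ring
  have m2 : ⟪d₁₂, a₁⟫ = u * α₂ + s * α₄ := by
    rw [hα]; simp only [inner_add_right, inner_smul_right, c2, c10, c7, c13]; ring
  have m3 : ⟪d₂₁, a₁⟫ = s * α₁ + v * α₃ := by
    rw [hα]; simp only [inner_add_right, inner_smul_right, c1, c6, ← hv, c9]; ring
  have m4 : ⟪d₂₂, a₁⟫ = s * α₂ + v * α₄ := by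
    rw [hα]; simp only [inner_add_right, inner_smul_right, c4, c12, c8, c11]; ring
  have n1 : ⟪d₁₁, a₂⟫ = u * β₁ + s * β₃ := by
    rw [hβ]; simp only [inner_add_right, inner_smul_right, ← hu, ← hs, c3, c5]; ring
  have n2 : ⟪d₁₂, a₂⟫ = u * β₂ + s * β₄ := by
    rw [hβ]; simp only [inner_add_right, inner_smul_right, c2, c10, c7, c13]; ring
  have n3 : ⟪d₂₁, a₂⟫ = s * β₁ + v * β₃ := by
    rw [hβ]; simp only [inner_add_right, inner_smul_right, c1, c6, ← hv, c9]; ring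
  have n4 : ⟪d₂₂, a₂⟫ = s * β₂ + v * β₄ := by
    rw [hβ]; simp only [inner_add_right, inner_smul_right, c4, c12, c8, c11]; ring
  have j₁ := hind (⟪d₂₁, a₁⟫ - σ₁ - R₁₁ * α₁ - R₁₂ * β₁) (⟪d₂₂, a₁⟫ - σ₂ - R₁₁ * α₂ - R₁₂ * β₂)
    (-⟪d₁₁, a₁⟫ - R₁₁ * α₃ - R₁₂ * β₃) (-⟪d₁₂, a₁⟫ - R₁₁ * α₄ - R₁₂ * β₄) (by
      rw [wedgeOp] at ha₁
      have : R₁₁ • a₁ + R₁₂ • a₂ = R₁₁ • (α₁ • d₁₁ + α₂ • d₁₂ + α₃ • d₂₁ + α₄ • d₂₂) +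
        R₁₂ • (β₁ • d₁₁ + β₂ • d₁₂ + β₃ • d₂₁ + β₄ • d₂₂) := by rw [← hα, ← hβ]
      rw [add_assoc _ (R₁₁ • a₁), this, ← sub_eq_zero] at ha₁
      rw [← ha₁]; module)
  have j₂ := hind (⟪d₂₁, a₂⟫ - R₂₁ * α₁ - R₂₂ * β₁) (⟪d₂₂, a₂⟫ - R₂₁ * α₂ - R₂₂ * β₂)
    (-⟪d₁₁, a₂⟫ - σ₁ - R₂₁ * α₃ - R₂₂ * β₃) (-⟪d₁₂, a₂⟫ - σ₂ - R₂₁ * α₄ - R₂₂ * β₄) (by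
      rw [wedgeOp] at ha₂
      have : R₂₁ • a₁ + R₂₂ • a₂ = R₂₁ • (α₁ • d₁₁ + α₂ • d₁₂ + α₃ • d₂₁ + α₄ • d₂₂) +
        R₂₂ • (β₁ • d₁₁ + β₂ • d₁₂ + β₃ • d₂₁ + β₄ • d₂₂) := by rw [← hα, ← hβ]
      rw [add_assoc _ (R₂₁ • a₁), this, ← sub_eq_zero] at ha₂
      rw [← ha₂]; module)
  obtain ⟨k1, k2, -, -⟩ := j₁
  obtain ⟨k5, k6, k7, k8⟩ := j₂
  rw [n1, m3] at hσ₁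
  rw [n2, m4] at hσ₂
  rw [m3, r1, r2] at k1
  rw [m4, r1, r2] at k2
  rw [n3, r3, r4] at k5
  rw [n4, r3, r4] at k6
  rw [n1, r3, r4] at k7
  rw [n2, r3, r4] at k8
  have hupos : 0 < u := by
    rw [hu, real_inner_self_eq_norm_sq]
    have : d₁₁ ≠ 0 := by rintro rfl; simpa using h.ν₅d₁₁
    positivity
  have hgram : 0 < u * v - s * s := by
    -- The component of d₂₁ orthogonal to d₁₁ is nonzero, and u times its squared norm is the Gram
    -- determinant.
    set w : V := d₂₁ - (s / u) • d₁₁ with hw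
    have hw0 : w ≠ 0 := by
      intro h0
      have := hind (-(s / u)) 0 1 0 (by rw [← h0, hw]; module)
      linarith [this.2.2.1]
    have : ⟪w, w⟫ = v - s * s / u := by
      rw [hw]
      simp only [inner_sub_left, inner_sub_right, real_inner_smul_left, real_inner_smul_right,
        c1, ← hu, ← hv, ← hs]
      field_simp; ring
    have hpos : 0 < ⟪w, w⟫ := real_inner_self_pos.2 hw0
    rw [this] at hpos
    have := mul_pos hupos hpos
    rwa [mul_sub, mul_div_cancel₀ _ hupos.ne'] at this
  have z1 : α₃ = 0 := gram_system hupos hgram hσ₁ k1 k5 k7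
  have z2 : α₄ = 0 := gram_system hupos hgram hσ₂ k2 k6 k8
  -- Now a₁ is a combination of d₁₁ and d₁₂, on which ν₅ and ν₆ take the values (1, 0) and (0, q);
  -- both kill a₁, so a₁ = 0, although it is a unit vector.
  have f5 := h.ν₅a₁
  have f6 := h.ν₆a₁
  rw [hα, z1, z2] at f5 f6
  simp only [inner_add_right, inner_smul_right, h.ν₅d₁₁, h.ν₅d₁₂, h.ν₆d₁₁, h.ν₆d₁₂] at f5 f6
  have g1 : α₁ = 0 := by linarith
  have g2 : α₂ = 0 := by
    have : α₂ * q = 0 := by linarith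
    simpa [h.hq] using this
  have := h.aa₁
  rw [hα, z1, z2, g1, g2] at this
  simp at this

/-- The algebraic core: the curvature identities force `p q = 1`. -/
theorem mul_eq_one_of_curvature [FiniteDimensional ℝ V]
    (h : NormalConfiguration a₁ a₂ d₁₁ d₁₂ d₂₁ d₂₂ ν₅ ν₆ p q x y x' y')
    {R₁₁ R₁₂ R₂₁ R₂₂ ρ σ₁ σ₂ : ℝ} (hρ : ρ = ⟪d₁₂, d₂₁⟫ - ⟪d₂₂, d₁₁⟫)
    (hσ₁ : σ₁ = ⟪d₁₁, a₂⟫ - ⟪d₂₁, a₁⟫) (hσ₂ : σ₂ = ⟪d₁₂, a₂⟫ - ⟪d₂₂, a₁⟫)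
    (ha₁ : wedgeOp d₁₁ d₁₂ d₂₁ d₂₂ a₁ = σ₁ • d₁₁ + σ₂ • d₁₂ + R₁₁ • a₁ + R₁₂ • a₂)
    (ha₂ : wedgeOp d₁₁ d₁₂ d₂₁ d₂₂ a₂ = σ₁ • d₂₁ + σ₂ • d₂₂ + R₂₁ • a₁ + R₂₂ • a₂)
    (h₁₁ : wedgeOp d₁₁ d₁₂ d₂₁ d₂₂ d₁₁ = ρ • d₁₂ + R₁₁ • d₁₁ + R₁₂ • d₂₁)
    (h₁₂ : wedgeOp d₁₁ d₁₂ d₂₁ d₂₂ d₁₂ = -ρ • d₁₁ + R₁₁ • d₁₂ + R₁₂ • d₂₂)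
    (h₂₁ : wedgeOp d₁₁ d₁₂ d₂₁ d₂₂ d₂₁ = ρ • d₂₂ + R₂₁ • d₁₁ + R₂₂ • d₂₁)
    (h₂₂ : wedgeOp d₁₁ d₁₂ d₂₁ d₂₂ d₂₂ = -ρ • d₂₁ + R₂₁ • d₁₂ + R₂₂ • d₂₂) :
    p * q = 1 := by
  have hΔ := h.det_eq_zero hρ hσ₁ hσ₂ ha₁ ha₂ h₁₁ h₁₂ h₂₁ h₂₂
  -- A kernel vector of the singular matrix with rows (x, y) and (x', y').
  obtain ⟨α, β, hαβ, hα, hα'⟩ : ∃ α β : ℝ, (α ≠ 0 ∨ β ≠ 0) ∧ α * x + β * y = 0 ∧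
      α * x' + β * y' = 0 := by
    by_cases hxy : x = 0 ∧ y = 0
    · by_cases hxy' : x' = 0 ∧ y' = 0
      · exact ⟨1, 0, Or.inl one_ne_zero, by simp [hxy.1], by simp [hxy'.1]⟩
      · refine ⟨y', -x', ?_, by simp [hxy.1, hxy.2], by ring⟩
        by_contra! hc
        exact hxy' ⟨by linarith [hc.2], hc.1⟩
    · refine ⟨y, -x, ?_, by ring, by linarith⟩
      by_contra! hc
      exact hxy ⟨by linarith [hc.2], hc.1⟩
  set z₀ : V := α • a₁ + β • a₂ with hz₀
  -- The normal correction makes z orthogonal to d₁₁ and d₂₁ without changing its products with a₁,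
  -- a₂; the choice of α, β then makes it orthogonal to d₁₂ and d₂₂.
  set z : V := z₀ - ⟪z₀, d₁₁⟫ • ν₅ - ⟪z₀, d₂₁⟫ • ν₆ with hz
  have za₁ : ⟪z, a₁⟫ = α := by
    rw [hz, hz₀]
    simp only [inner_sub_left, inner_add_left, real_inner_smul_left, h.ν₅a₁, h.ν₆a₁, h.aa₁,
      real_inner_comm a₁ a₂, h.aa₁₂]
    ring
  have za₂ : ⟪z, a₂⟫ = β := by
    rw [hz, hz₀]
    simp only [inner_sub_left, inner_add_left, real_inner_smul_left, h.ν₅a₂, h.ν₆a₂, h.aa₂,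
      h.aa₁₂]
    ring
  have zd₁₁ : ⟪z, d₁₁⟫ = 0 := by
    rw [hz]
    simp only [inner_sub_left, real_inner_smul_left, h.ν₅d₁₁, h.ν₆d₁₁]
    ring
  have zd₂₁ : ⟪z, d₂₁⟫ = 0 := by
    rw [hz]
    simp only [inner_sub_left, real_inner_smul_left, h.ν₅d₂₁, h.ν₆d₂₁]
    ring
  have zd₁₂ : ⟪z, d₁₂⟫ = 0 := by
    rw [h.hd₁₂]
    simp only [inner_add_right, real_inner_smul_right, zd₂₁, za₁, za₂]
    linarith
  have zd₂₂ : ⟪z, d₂₂⟫ = 0 := by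
    rw [h.hd₂₂]
    simp only [inner_add_right, real_inner_smul_right, zd₁₁, za₁, za₂]
    linarith
  have R1 : R₁₁ * α + R₁₂ * β = 0 := by
    have := congrArg (fun v => ⟪z, v⟫) ha₁
    simp only [wedgeOp, inner_add_right, inner_sub_right, real_inner_smul_right, zd₁₁, zd₁₂, zd₂₁,
      zd₂₂, za₁, za₂] at this
    linarith
  have R2 : R₂₁ * α + R₂₂ * β = 0 := by
    have := congrArg (fun v => ⟪z, v⟫) ha₂
    simp only [wedgeOp, inner_add_right, inner_sub_right, real_inner_smul_right, zd₁₁, zd₁₂, zd₂₁,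
      zd₂₂, za₁, za₂] at this
    linarith
  set g₁₁ := ⟪d₁₁, d₁₁⟫ + ⟪d₁₂, d₁₂⟫ with hg₁₁
  set g₁₂ := ⟪d₁₁, d₂₁⟫ + ⟪d₁₂, d₂₂⟫ with hg₁₂
  set g₂₂ := ⟪d₂₁, d₂₁⟫ + ⟪d₂₂, d₂₂⟫ with hg₂₂
  have skew : ∀ v w : V, ⟪wedgeOp d₁₁ d₁₂ d₂₁ d₂₂ v, w⟫ = -⟪wedgeOp d₁₁ d₁₂ d₂₁ d₂₂ w, v⟫ := by
    intro v w; simp only [inner_wedgeOp_left]; ring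
  have cm : ∀ v w : V, ⟪v, w⟫ = ⟪w, v⟫ := fun v w => real_inner_comm _ _
  -- Skewness of `wedgeOp`, summed over i, makes the diagonal of Rg vanish: the ρ-terms cancel
  -- between i = 1 and i = 2.
  have S1 : R₁₁ * g₁₁ + R₁₂ * g₁₂ = 0 := by
    have e1 := skew d₁₁ d₁₁
    have e2 := skew d₁₂ d₁₂
    rw [h₁₁] at e1
    rw [h₁₂] at e2
    simp only [inner_add_left, real_inner_smul_left] at e1 e2
    rw [hg₁₁, hg₁₂, cm d₁₁ d₂₁, cm d₁₂ d₂₂]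
    linear_combination (e1 + e2) / 2 - ρ * cm d₁₂ d₁₁
  have S2 : R₂₁ * g₁₂ + R₂₂ * g₂₂ = 0 := by
    have e1 := skew d₂₁ d₂₁
    have e2 := skew d₂₂ d₂₂
    rw [h₂₁] at e1
    rw [h₂₂] at e2
    simp only [inner_add_left, real_inner_smul_left] at e1 e2
    rw [hg₂₂, hg₁₂]
    linear_combination (e1 + e2) / 2 - ρ * cm d₂₂ d₂₁
  have K : ⟪wedgeOp d₁₁ d₁₂ d₂₁ d₂₂ d₂₁, d₁₁⟫ + ⟪wedgeOp d₁₁ d₁₂ d₂₁ d₂₂ d₂₂, d₁₂⟫ =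
      R₂₁ * g₁₁ + R₂₂ * g₁₂ - ρ ^ 2 := by
    rw [h₂₁, h₂₂]
    simp only [inner_add_left, real_inner_smul_left]
    rw [hg₁₁, hg₁₂, cm d₁₁ d₂₁, cm d₁₂ d₂₂]
    have : ρ ^ 2 = ρ * (⟪d₂₁, d₁₂⟫ - ⟪d₂₂, d₁₁⟫) := by rw [cm d₂₁ d₁₂, ← hρ]; ring
    linarith
  have K' : ⟪wedgeOp d₁₁ d₁₂ d₂₁ d₂₂ d₁₁, d₂₁⟫ + ⟪wedgeOp d₁₁ d₁₂ d₂₁ d₂₂ d₁₂, d₂₂⟫ =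
      R₁₁ * g₁₂ + R₁₂ * g₂₂ + ρ ^ 2 := by
    rw [h₁₁, h₁₂]
    simp only [inner_add_left, real_inner_smul_left]
    rw [hg₂₂, hg₁₂]
    have : ρ ^ 2 = ρ * (⟪d₁₂, d₂₁⟫ - ⟪d₁₁, d₂₂⟫) := by rw [cm d₁₁ d₂₂, ← hρ]; ring
    linarith
  rw [skew d₁₁, skew d₁₂] at K'
  -- Rg is skew with off-diagonal entry κ up to sign, so κ² = det R · det g, and R has the kernel
  -- vector (α, β).
  have hκ : R₂₁ * g₁₁ + R₂₂ * g₁₂ = 0 := by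
    set κ := R₂₁ * g₁₁ + R₂₂ * g₁₂ with hκ
    have hκ' : R₁₁ * g₁₂ + R₁₂ * g₂₂ = -κ := by linarith
    have hdet : R₁₁ * R₂₂ - R₁₂ * R₂₁ = 0 := by
      rcases hαβ with hne | hne
      · have : α * (R₁₁ * R₂₂ - R₁₂ * R₂₁) = 0 := by linear_combination R₂₂ * R1 - R₁₂ * R2
        simpa [hne] using this
      · have : β * (R₁₁ * R₂₂ - R₁₂ * R₂₁) = 0 := by linear_combination R₁₁ * R2 - R₂₁ * R1
        simpa [hne] using this
    have : κ ^ 2 = 0 := by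
      linear_combination (g₁₁ * g₂₂ - g₁₂ ^ 2) * hdet + κ * hκ + (R₂₁ * g₁₁ + R₂₂ * g₁₂) * hκ' -
        (R₂₁ * g₁₂ + R₂₂ * g₂₂) * S1
    simpa using this
  have hsum := sum_norm_sq_wedgeOp (stdOrthonormalBasis ℝ V) d₁₁ d₁₂ d₂₁ d₂₂
  rw [K, hκ] at hsum
  have hzero : ∀ k, wedgeOp d₁₁ d₁₂ d₂₁ d₂₂ (stdOrthonormalBasis ℝ V k) = 0 := by
    intro k
    have hle := Finset.single_le_sum (f := fun k =>
      ‖wedgeOp d₁₁ d₁₂ d₂₁ d₂₂ (stdOrthonormalBasis ℝ V k)‖ ^ 2)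
      (fun i _ => sq_nonneg _) (Finset.mem_univ k)
    have : ‖wedgeOp d₁₁ d₁₂ d₂₁ d₂₂ (stdOrthonormalBasis ℝ V k)‖ ^ 2 ≤ 0 := by
      refine hle.trans ?_
      rw [hsum]; nlinarith [sq_nonneg ρ]
    have : ‖wedgeOp d₁₁ d₁₂ d₂₁ d₂₂ (stdOrthonormalBasis ℝ V k)‖ = 0 :=
      pow_eq_zero_iff (two_ne_zero) |>.1 (le_antisymm this (sq_nonneg _))
    simpa using this
  -- The left side expands to pq - 1.
  have hν : ⟪wedgeOp d₁₁ d₁₂ d₂₁ d₂₂ ν₅, ν₆⟫ = 0 := by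
    rw [skew, neg_eq_zero, real_inner_comm, ← (stdOrthonormalBasis ℝ V).sum_inner_mul_inner]
    refine Finset.sum_eq_zero fun k _ => ?_
    rw [real_inner_comm (wedgeOp d₁₁ d₁₂ d₂₁ d₂₂ ν₆), skew, hzero, inner_zero_left, neg_zero,
      mul_zero]
  rw [inner_wedgeOp_left, cm d₁₁, cm d₂₁, cm d₁₂, cm d₂₂, cm d₁₁, cm d₂₁, cm d₁₂, cm d₂₂, h.ν₅d₁₁,
    h.ν₅d₂₁, h.ν₅d₁₂, h.ν₅d₂₂, h.ν₆d₁₁, h.ν₆d₂₁, h.ν₆d₁₂, h.ν₆d₂₂] at hν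
  linarith

/-- If the Codazzi relation holds along a neighbourhood of a point in the leaf of the ruling,
then `p q = 1`. -/
theorem mul_eq_one [FiniteDimensional ℝ V]
    (h : NormalConfiguration a₁ a₂ d₁₁ d₁₂ d₂₁ d₂₂ ν₅ ν₆ p q x y x' y') {δ : ℝ} (hδ : 0 < δ)
    (H : ∀ t₁ t₂ : ℝ, |t₁| < δ → |t₂| < δ → ∀ α β : V, α = a₁ + t₁ • d₁₁ + t₂ • d₁₂ →
      β = a₂ + t₁ • d₂₁ + t₂ • d₂₂ →
      (∃ s₁ s₂ : ℝ, wedgeOp d₁₁ d₁₂ d₂₁ d₂₂ α - (⟪d₁₁, β⟫ - ⟪d₂₁, α⟫) • d₁₁ -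
        (⟪d₁₂, β⟫ - ⟪d₂₂, α⟫) • d₁₂ = s₁ • α + s₂ • β) ∧
      ∃ s₁ s₂ : ℝ, wedgeOp d₁₁ d₁₂ d₂₁ d₂₂ β - (⟪d₁₁, β⟫ - ⟪d₂₁, α⟫) • d₂₁ -
        (⟪d₁₂, β⟫ - ⟪d₂₂, α⟫) • d₂₂ = s₁ • α + s₂ • β) :
    p * q = 1 := by
  have cm : ∀ v w : V, ⟪v, w⟫ = ⟪w, v⟫ := fun v w => real_inner_comm _ _
  -- The matrix R is read off at the centre of the leaf; moving along the two axes shows that the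
  -- same coefficients govern the terms linear in t.
  obtain ⟨⟨R₁₁, R₁₂, hR₁⟩, ⟨R₂₁, R₂₂, hR₂⟩⟩ := H 0 0 (by simpa) (by simpa) a₁ a₂ (by simp) (by simp)
  have hε : δ / 2 ≠ 0 := by positivity
  have habs : ∀ t : ℝ, t = δ / 2 ∨ t = δ / 2 / 2 → |t| < δ := by
    rintro t (rfl | rfl) <;> rw [abs_of_pos (by positivity)] <;> linarith
  -- The t-coefficient has no d₁₁ correction, because ⟨d₁₁, d₂₁⟩ - ⟨d₂₁, d₁₁⟩ = 0. The same
  -- cancellation occurs in the other three cases.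
  have e₁₁ := eq_of_affine_mem_span hε h.indep_fst hR₁
    (Y := wedgeOp d₁₁ d₁₂ d₂₁ d₂₂ d₁₁ - (⟪d₁₂, d₂₁⟫ - ⟪d₂₂, d₁₁⟫) • d₁₂) (fun t ht => by
      obtain ⟨⟨s₁, s₂, hs⟩, -⟩ := H t 0 (habs t ht) (by simpa) (a₁ + t • d₁₁) (a₂ + t • d₂₁)
        (by simp) (by simp)
      refine ⟨s₁, s₂, ?_⟩
      rw [← hs, wedgeOp_add, wedgeOp_smul]
      simp only [inner_add_right, real_inner_smul_right, cm d₂₁ d₁₁]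
      module)
  have e₁₂ := eq_of_affine_mem_span hε h.indep_snd hR₁
    (Y := wedgeOp d₁₁ d₁₂ d₂₁ d₂₂ d₁₂ - (⟪d₁₁, d₂₂⟫ - ⟪d₂₁, d₁₂⟫) • d₁₁) (fun t ht => by
      obtain ⟨⟨s₁, s₂, hs⟩, -⟩ := H 0 t (by simpa) (habs t ht) (a₁ + t • d₁₂) (a₂ + t • d₂₂)
        (by simp) (by simp)
      refine ⟨s₁, s₂, ?_⟩
      rw [← hs, wedgeOp_add, wedgeOp_smul]
      simp only [inner_add_right, real_inner_smul_right, cm d₂₂ d₁₂]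
      module)
  have e₂₁ := eq_of_affine_mem_span hε h.indep_fst hR₂
    (Y := wedgeOp d₁₁ d₁₂ d₂₁ d₂₂ d₂₁ - (⟪d₁₂, d₂₁⟫ - ⟪d₂₂, d₁₁⟫) • d₂₂) (fun t ht => by
      obtain ⟨-, s₁, s₂, hs⟩ := H t 0 (habs t ht) (by simpa) (a₁ + t • d₁₁) (a₂ + t • d₂₁)
        (by simp) (by simp)
      refine ⟨s₁, s₂, ?_⟩
      rw [← hs, wedgeOp_add, wedgeOp_smul]
      simp only [inner_add_right, real_inner_smul_right, cm d₂₁ d₁₁]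
      module)
  have e₂₂ := eq_of_affine_mem_span hε h.indep_snd hR₂
    (Y := wedgeOp d₁₁ d₁₂ d₂₁ d₂₂ d₂₂ - (⟪d₁₁, d₂₂⟫ - ⟪d₂₁, d₁₂⟫) • d₂₁) (fun t ht => by
      obtain ⟨-, s₁, s₂, hs⟩ := H 0 t (by simpa) (habs t ht) (a₁ + t • d₁₂) (a₂ + t • d₂₂)
        (by simp) (by simp)
      refine ⟨s₁, s₂, ?_⟩
      rw [← hs, wedgeOp_add, wedgeOp_smul]
      simp only [inner_add_right, real_inner_smul_right, cm d₂₂ d₁₂]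
      module)
  have hneg : ⟪d₁₁, d₂₂⟫ - ⟪d₂₁, d₁₂⟫ = -(⟪d₁₂, d₂₁⟫ - ⟪d₂₂, d₁₁⟫) := by
    rw [cm d₁₁ d₂₂, cm d₂₁ d₁₂]; ring
  rw [hneg, sub_eq_iff_eq_add'] at e₁₂ e₂₂
  rw [sub_eq_iff_eq_add'] at e₁₁ e₂₁
  rw [sub_sub, sub_eq_iff_eq_add'] at hR₁ hR₂
  exact h.mul_eq_one_of_curvature rfl rfl rfl (by rw [hR₁]; abel) (by rw [hR₂]; abel)
    (by rw [e₁₁]; abel) (by rw [e₁₂]; abel) (by rw [e₂₁]; abel) (by rw [e₂₂]; abel)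

end NormalConfiguration

end FlatRulingAlgebra

/-! ### Ruled patches, their second derivatives and the Codazzi relation. -/

section Calculus

open Filter Topology

variable {X Y V : Type*} [NormedAddCommGroup X] [NormedSpace ℝ X]
  [NormedAddCommGroup Y] [NormedSpace ℝ Y] [FiniteDimensional ℝ Y]
  [NormedAddCommGroup V] [InnerProductSpace ℝ V] [FiniteDimensional ℝ V]

theorem two_le_smooth : minSmoothness ℝ 2 ≤ (∞ : ℕ∞ω) := by
  rw [minSmoothness_of_isRCLikeNormedField]
  exact WithTop.coe_le_coe.2 le_top

/-- A lift through a smooth family of injective linear maps is smooth. -/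
theorem contDiffAt_of_clm_apply {k : ℕ∞ω} {A : X → Y →L[ℝ] V} {s : X → Y} {u : X}
    (hA : ContDiffAt ℝ k A u) (hinj : Function.Injective (A u))
    (hs : ContDiffAt ℝ k (fun y => A y (s y)) u) : ContDiffAt ℝ k s u := by
  obtain ⟨L₀, hL₀⟩ := LinearMap.exists_leftInverse_of_injective (A u).toLinearMap
    (LinearMap.ker_eq_bot.2 hinj)
  -- With L a left inverse of `A u`, the maps L ∘ `A y` are invertible for y near u, and `s y` is (L
  -- ∘ `A y`)⁻¹ applied to L(`A y (s y)`); inversion is smooth.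
  set L : V →L[ℝ] Y := LinearMap.toContinuousLinearMap L₀ with hL
  have hLu : L.comp (A u) = (ContinuousLinearEquiv.refl ℝ Y : Y →L[ℝ] Y) := by
    ext z
    exact LinearMap.congr_fun hL₀ z
  have hLA : ContDiffAt ℝ k (fun y => L.comp (A y)) u := contDiffAt_const.clm_comp hA
  have hinv : ContDiffAt ℝ k (fun y => (L.comp (A y)).inverse) u := by
    refine ContDiffAt.comp u (g := ContinuousLinearMap.inverse) ?_ hLA
    rw [hLu]
    exact contDiffAt_map_inverse _
  have hev : ∀ᶠ y in 𝓝 u, L.comp (A y) ∈ Set.range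
      ((↑) : (Y ≃L[ℝ] Y) → Y →L[ℝ] Y) := by
    refine hLA.continuousAt.eventually_mem ?_
    rw [hLu]
    exact ContinuousLinearEquiv.nhds _
  refine ContDiffAt.congr_of_eventuallyEq (hinv.clm_apply (contDiffAt_const.clm_apply hs))
    (f := fun y => (L.comp (A y)).inverse (L (A y (s y)))) ?_
  filter_upwards [hev] with y hy
  obtain ⟨e, he⟩ := hy
  rw [show L (A y (s y)) = (L.comp (A y)) (s y) from rfl, ← he,
    ContinuousLinearMap.inverse_equiv]
  simp

variable [FiniteDimensional ℝ X]

/-- A smooth immersion `f` of an open set `U`, together with the orthogonal projections `P` to a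
smooth field of tangent planes which is parallel in its own directions, in `V`. -/
structure RuledPatch (f : X → V) (P : X → V →L[ℝ] V) (U : Set X) : Prop where
  isOpen : IsOpen U
  smooth_map : ∀ u ∈ U, ContDiffAt ℝ ∞ f u
  smooth_proj : ∀ u ∈ U, ContDiffAt ℝ ∞ P u
  injective : ∀ u ∈ U, Function.Injective (fderiv ℝ f u)
  idem : ∀ u ∈ U, ∀ z, P u (P u z) = P u z
  symm : ∀ u ∈ U, ∀ z w, inner ℝ (P u z) w = inner ℝ z (P u w)
  tangent : ∀ u ∈ U, ∀ z, ∃ s, fderiv ℝ f u s = P u z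
  parallel : ∀ u ∈ U, ∀ s, P u (fderiv ℝ f u s) = fderiv ℝ f u s → fderiv ℝ P u s = 0

/-- Vectors `s` tangent to the patch at `u` and orthogonal to the ruling. -/
def IsHorizontal (f : X → V) (P : X → V →L[ℝ] V) (u s : X) : Prop :=
  P u (fderiv ℝ f u s) = 0

namespace RuledPatch

variable {f : X → V} {P : X → V →L[ℝ] V} {U : Set X} {u : X}

theorem mem_nhds (h : RuledPatch f P U) (hu : u ∈ U) : U ∈ 𝓝 u := h.isOpen.mem_nhds hu

theorem smooth_fderiv (h : RuledPatch f P U) (hu : u ∈ U) : ContDiffAt ℝ ∞ (fderiv ℝ f) u :=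
  (h.smooth_map u hu).fderiv_right (by simp)

theorem differentiableAt_fderiv (h : RuledPatch f P U) (hu : u ∈ U) :
    DifferentiableAt ℝ (fderiv ℝ f) u :=
  (h.smooth_fderiv hu).differentiableAt (by simp)

theorem differentiableAt_proj (h : RuledPatch f P U) (hu : u ∈ U) : DifferentiableAt ℝ P u :=
  (h.smooth_proj u hu).differentiableAt (by simp)

theorem symm_fderiv (h : RuledPatch f P U) (hu : u ∈ U) (v w : X) :
    fderiv ℝ (fderiv ℝ f) u v w = fderiv ℝ (fderiv ℝ f) u w v :=
  ((h.smooth_map u hu).isSymmSndFDerivAt two_le_smooth) v w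

/-- The tangent vector field which is the lift of the projection of `z` to the ruling. -/
noncomputable def vert (f : X → V) (P : X → V →L[ℝ] V) (z : X → V) (u : X) : X :=
  Classical.epsilon fun s => fderiv ℝ f u s = P u (z u)

theorem fderiv_vert (h : RuledPatch f P U) (hu : u ∈ U) (z : X → V) :
    fderiv ℝ f u (vert f P z u) = P u (z u) :=
  Classical.epsilon_spec (h.tangent u hu (z u))

theorem contDiffAt_vert (h : RuledPatch f P U) (hu : u ∈ U) {z : X → V}
    (hz : ContDiffAt ℝ ∞ z u) : ContDiffAt ℝ ∞ (vert f P z) u := by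
  refine contDiffAt_of_clm_apply (h.smooth_fderiv hu) (h.injective u hu) ?_
  refine ContDiffAt.congr_of_eventuallyEq ((h.smooth_proj u hu).clm_apply hz) ?_
  filter_upwards [h.mem_nhds hu] with y hy
  exact h.fderiv_vert hy z

/-- The derivative of a section of the tangent bundle. -/
theorem fderiv_section (h : RuledPatch f P U) (hu : u ∈ U) {S : X → V} {k : X → X}
    (hS : ContDiffAt ℝ ∞ S u) (hk : ∀ y ∈ U, fderiv ℝ f y (k y) = S y) (v : X) :
    fderiv ℝ S u v = fderiv ℝ (fderiv ℝ f) u v (k u) + fderiv ℝ f u (fderiv ℝ k u v) := by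
  have hev : S =ᶠ[𝓝 u] fun y => fderiv ℝ f y (k y) := by
    filter_upwards [h.mem_nhds hu] with y hy using (hk y hy).symm
  have hk' : ContDiffAt ℝ ∞ k u :=
    contDiffAt_of_clm_apply (h.smooth_fderiv hu) (h.injective u hu) (hS.congr_of_eventuallyEq hev.symm)
  rw [hev.fderiv_eq, fderiv_clm_apply (h.differentiableAt_fderiv hu)
    (hk'.differentiableAt (by simp))]
  simp [add_comm]

/-- A tangent field is f' applied to some field k, and modulo tangent vectors its derivative depends
on k only through the value at `u`, which injectivity identifies with `s`. -/
theorem fderiv_section_mem (h : RuledPatch f P U) (hu : u ∈ U) {S : X → V}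
    (hS : ContDiffAt ℝ ∞ S u) (hT : ∀ y ∈ U, ∃ s, fderiv ℝ f y s = S y) {s : X}
    (hs : fderiv ℝ f u s = S u) (v : X) :
    ∃ t, fderiv ℝ S u v = fderiv ℝ (fderiv ℝ f) u v s + fderiv ℝ f u t := by
  choose! k hk using hT
  refine ⟨fderiv ℝ k u v, ?_⟩
  rw [h.fderiv_section hu hS hk, h.injective u hu (hs.trans (hk u hu).symm)]

theorem fderiv_proj_apply (h : RuledPatch f P U) (hu : u ∈ U) (z : V) (v : X) :
    fderiv ℝ (fun y => P y z) u v = fderiv ℝ P u v z := by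
  rw [fderiv_clm_apply (h.differentiableAt_proj hu) (differentiableAt_const z)]
  simp

/-- Product rule for P ∘ P = P. It implies that the derivative of `P` exchanges the ruling and its
orthogonal complement, as the next two lemmas record. -/
theorem proj_fderiv_proj (h : RuledPatch f P U) (hu : u ∈ U) (v : X) (z : V) :
    fderiv ℝ P u v (P u z) + P u (fderiv ℝ P u v z) = fderiv ℝ P u v z := by
  have hev : (fun y => P y (P y z)) =ᶠ[𝓝 u] fun y => P y z := by
    filter_upwards [h.mem_nhds hu] with y hy using h.idem y hy z
  have h1 := DFunLike.congr_fun (hev.fderiv_eq (𝕜 := ℝ)) v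
  rw [h.fderiv_proj_apply hu, fderiv_clm_apply (h.differentiableAt_proj hu)
    ((h.differentiableAt_proj hu).clm_apply (differentiableAt_const z))] at h1
  simpa [h.fderiv_proj_apply hu, add_comm] using h1

theorem proj_fderiv_proj_of_eq_zero (h : RuledPatch f P U) (hu : u ∈ U) (v : X) {z : V}
    (hz : P u z = 0) : P u (fderiv ℝ P u v z) = fderiv ℝ P u v z := by
  have := h.proj_fderiv_proj hu v z
  rwa [hz, map_zero, zero_add] at this

theorem proj_fderiv_proj_of_eq (h : RuledPatch f P U) (hu : u ∈ U) (v : X) {z : V}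
    (hz : P u z = z) : P u (fderiv ℝ P u v z) = 0 := by
  have := h.proj_fderiv_proj hu v z
  rwa [hz, add_eq_left] at this

theorem symm_fderiv_proj (h : RuledPatch f P U) (hu : u ∈ U) (v : X) (z w : V) :
    inner ℝ (fderiv ℝ P u v z) w = inner ℝ z (fderiv ℝ P u v w) := by
  have hev : (fun y => inner ℝ (P y z) w) =ᶠ[𝓝 u] fun y => inner ℝ z (P y w) := by
    filter_upwards [h.mem_nhds hu] with y hy using h.symm y hy z w
  have d : ∀ z, DifferentiableAt ℝ (fun y => P y z) u := fun z =>
    (h.differentiableAt_proj hu).clm_apply (differentiableAt_const z)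
  have h1 := DFunLike.congr_fun (hev.fderiv_eq (𝕜 := ℝ)) v
  rw [fderiv_inner_apply ℝ (d z) (differentiableAt_const w),
    fderiv_inner_apply ℝ (differentiableAt_const z) (d w)] at h1
  simpa [h.fderiv_proj_apply hu] using h1

/-- The second fundamental form in a direction tangent to the ruling. -/
theorem hessian_of_mem (h : RuledPatch f P U) (hu : u ∈ U) {s : X}
    (hs : P u (fderiv ℝ f u s) = fderiv ℝ f u s) (v : X) :
    ∃ t, fderiv ℝ (fderiv ℝ f) u v s = fderiv ℝ P u v (fderiv ℝ f u s) + fderiv ℝ f u t := by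
  -- Projecting the fixed vector f'(u)s to the nearby rulings gives a tangent field with the right
  -- value at `u`, whose derivative is that of `P`.
  obtain ⟨t, ht⟩ := h.fderiv_section_mem hu (S := fun y => P y (fderiv ℝ f u s))
    ((h.smooth_proj u hu).clm_apply contDiffAt_const) (fun y hy => h.tangent y hy _) hs.symm v
  rw [h.fderiv_proj_apply hu] at ht
  exact ⟨-t, by rw [ht, map_neg]; abel⟩

/-- The rulings are asymptotic planes. -/
theorem hessian_of_mem_of_mem (h : RuledPatch f P U) (hu : u ∈ U) {s v : X}
    (hs : P u (fderiv ℝ f u s) = fderiv ℝ f u s) (hv : P u (fderiv ℝ f u v) = fderiv ℝ f u v) :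
    ∃ t, fderiv ℝ (fderiv ℝ f) u v s = fderiv ℝ f u t := by
  obtain ⟨t, ht⟩ := h.hessian_of_mem hu hs v
  exact ⟨t, by rw [ht, h.parallel u hu v hv]; simp⟩

/-- Decomposition of tangent vectors into horizontal and vertical components. -/
theorem exists_horizontal (h : RuledPatch f P U) (hu : u ∈ U) (s : X) :
    ∃ t, fderiv ℝ f u t = P u (fderiv ℝ f u s) ∧ IsHorizontal f P u (s - t) := by
  obtain ⟨t, ht⟩ := h.tangent u hu (fderiv ℝ f u s)
  refine ⟨t, ht, ?_⟩
  rw [IsHorizontal, map_sub, map_sub, ht, h.idem u hu, sub_self]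

/-- The vector field of horizontal components of the constant vector field `c`. -/
noncomputable def horiz (f : X → V) (P : X → V →L[ℝ] V) (c : X) (u : X) : X :=
  c - vert f P (fun y => fderiv ℝ f y c) u

theorem contDiffAt_horiz (h : RuledPatch f P U) (hu : u ∈ U) (c : X) :
    ContDiffAt ℝ ∞ (horiz f P c) u :=
  contDiffAt_const.sub
    (h.contDiffAt_vert hu ((h.smooth_fderiv hu).clm_apply contDiffAt_const))

theorem isHorizontal_horiz (h : RuledPatch f P U) (hu : u ∈ U) (c : X) :
    IsHorizontal f P u (horiz f P c u) := by
  rw [IsHorizontal, horiz, map_sub, map_sub, h.fderiv_vert hu, h.idem u hu, sub_self]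

theorem horiz_eq (h : RuledPatch f P U) (hu : u ∈ U) {c : X} (hc : IsHorizontal f P u c) :
    horiz f P c u = c := by
  have : vert f P (fun y => fderiv ℝ f y c) u = 0 := by
    apply h.injective u hu
    rw [h.fderiv_vert hu, map_zero]
    exact hc
  rw [horiz, this, sub_zero]

/-- The Codazzi relation for a ruled patch whose horizontal distribution is asymptotic. -/
theorem codazzi (h : RuledPatch f P U) (hu : u ∈ U)
    (hH : ∀ y ∈ U, ∀ v w, IsHorizontal f P y v → IsHorizontal f P y w →
      ∃ t, fderiv ℝ (fderiv ℝ f) y v w = fderiv ℝ f y t)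
    {a b c : X} (ha : IsHorizontal f P u a) (hb : IsHorizontal f P u b)
    (hc : IsHorizontal f P u c) :
    ∃ t, fderiv ℝ P u a (fderiv ℝ P u b (fderiv ℝ f u c)) -
      fderiv ℝ P u b (fderiv ℝ P u a (fderiv ℝ f u c)) -
      fderiv ℝ P u c (fderiv ℝ P u a (fderiv ℝ f u b) - fderiv ℝ P u b (fderiv ℝ f u a)) =
      fderiv ℝ f u t := by
  set T : Submodule ℝ V := LinearMap.range (fderiv ℝ f u).toLinearMap with hT
  have memT : ∀ t, fderiv ℝ f u t ∈ T := fun t => ⟨t, rfl⟩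
  suffices hmem : _ ∈ T by
    obtain ⟨t, ht⟩ := hmem
    exact ⟨t, ht.symm⟩
  -- the horizontal vector fields `f'(ĉ)`
  set W : X → X → V := fun c y => fderiv ℝ f y (horiz f P c y) with hW
  have smW : ∀ c, ∀ y ∈ U, ContDiffAt ℝ ∞ (W c) y := fun c y hy =>
    (h.smooth_fderiv hy).clm_apply (h.contDiffAt_horiz hy c)
  have dW : ∀ c, ∀ y ∈ U, ∀ v, fderiv ℝ (W c) y v =
      fderiv ℝ (fderiv ℝ f) y v (horiz f P c y) +
        fderiv ℝ f y (fderiv ℝ (horiz f P c) y v) := fun c y hy v =>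
    h.fderiv_section hy (smW c y hy) (fun _ _ => rfl) v
  have PW : ∀ c, ∀ y ∈ U, P y (W c y) = 0 := fun c y hy => h.isHorizontal_horiz hy c
  have PdW : ∀ c, ∀ y ∈ U, ∀ v, P y (fderiv ℝ (W c) y v) = -fderiv ℝ P y v (W c y) := by
    intro c y hy v
    have hev : (fun z => P z (W c z)) =ᶠ[𝓝 y] fun _ => 0 := by
      filter_upwards [h.mem_nhds hy] with z hz using PW c z hz
    have h1 := DFunLike.congr_fun (hev.fderiv_eq (𝕜 := ℝ)) v
    rw [fderiv_clm_apply (h.differentiableAt_proj hy)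
      ((smW c y hy).differentiableAt (by simp))] at h1
    simp only [add_apply, ContinuousLinearMap.comp_apply,
      ContinuousLinearMap.flip_apply, fderiv_fun_const, Pi.zero_apply, zero_apply] at h1
    exact eq_neg_of_add_eq_zero_left h1
  -- the derivative of a horizontal field in a vertical direction
  have dWv : ∀ c, IsHorizontal f P u c → ∀ v, P u (fderiv ℝ f u v) = fderiv ℝ f u v →
      -- By symmetry of the second derivative, the vertical vector can be moved to the slot where
      -- `hessian_of_mem` applies.
      fderiv ℝ (W c) u v - fderiv ℝ P u c (fderiv ℝ f u v) ∈ T := by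
    intro c hc v hv
    rw [dW c u hu, h.horiz_eq hu hc, h.symm_fderiv hu]
    obtain ⟨t, ht⟩ := h.hessian_of_mem hu hv c
    rw [ht, add_sub_right_comm, add_sub_right_comm, sub_self, zero_add]
    exact T.add_mem (memT _) (memT _)
  have dWh : ∀ c, IsHorizontal f P u c → ∀ v, IsHorizontal f P u v →
      fderiv ℝ (W c) u v ∈ T := by
    intro c hc v hv
    rw [dW c u hu, h.horiz_eq hu hc]
    obtain ⟨t, ht⟩ := hH u hu v c hv hc
    rw [ht]
    exact T.add_mem (memT _) (memT _)
  have dWg : ∀ c, IsHorizontal f P u c → ∀ v,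
      fderiv ℝ (W c) u v - fderiv ℝ P u c (P u (fderiv ℝ f u v)) ∈ T := by
    intro c hc v
    obtain ⟨t, ht, hvt⟩ := h.exists_horizontal hu v
    have e1 := dWh c hc _ hvt
    have e2 := dWv c hc t (by rw [ht, h.idem u hu])
    have := T.add_mem e1 e2
    rw [map_sub, ht] at this
    convert this using 1
    abel
  -- second derivatives of a horizontal field in horizontal directions
  set S : X → X → X → V := fun b c y => fderiv ℝ (W c) y (horiz f P b y) with hS
  have smW' : ∀ c, ContDiffAt ℝ ∞ (fderiv ℝ (W c)) u := fun c =>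
    (smW c u hu).fderiv_right (by simp)
  have smS : ∀ b c, ContDiffAt ℝ ∞ (S b c) u := fun b c =>
    (smW' c).clm_apply (h.contDiffAt_horiz hu b)
  -- Horizontal planes are asymptotic on all of `U`, so the first derivatives S are again tangent
  -- fields and can be differentiated modulo T.
  have TS : ∀ b c, ∀ y ∈ U, ∃ s, fderiv ℝ f y s = S b c y := by
    intro b c y hy
    obtain ⟨t, ht⟩ := hH y hy _ _ (h.isHorizontal_horiz hy b) (h.isHorizontal_horiz hy c)
    refine ⟨t + fderiv ℝ (horiz f P c) y (horiz f P b y), ?_⟩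
    rw [hS]
    simp only
    rw [dW c y hy, ht, map_add]
  have dS : ∀ a b c, IsHorizontal f P u a → IsHorizontal f P u b → IsHorizontal f P u c →
      fderiv ℝ (S b c) u a + fderiv ℝ P u a (fderiv ℝ P u b (fderiv ℝ f u c)) ∈ T := by
    intro a b c ha hb hc
    obtain ⟨s, hs⟩ := TS b c u hu
    obtain ⟨t, ht⟩ := h.fderiv_section_mem hu (smS b c) (TS b c) hs a
    obtain ⟨r, hr, hsr⟩ := h.exists_horizontal hu s
    obtain ⟨t', ht'⟩ := hH u hu a _ ha hsr
    obtain ⟨t'', ht''⟩ := h.hessian_of_mem hu (s := r) (by rw [hr, h.idem u hu]) a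
    -- Only the vertical part of S matters modulo T; differentiating P(W) = 0 identifies it.
    have e : P u (fderiv ℝ f u s) = -fderiv ℝ P u b (fderiv ℝ f u c) := by
      rw [hs, hS]
      simp only
      rw [PdW c u hu, h.horiz_eq hu hb, hW]
      simp only
      rw [h.horiz_eq hu hc]
    have e2 : fderiv ℝ (fderiv ℝ f) u a s = fderiv ℝ f u t' + fderiv ℝ (fderiv ℝ f) u a r := by
      rw [← ht', map_sub]; abel
    rw [ht, e2, ht'', hr, e, map_neg]
    have := T.add_mem (T.add_mem (memT t') (memT t'')) (memT t)
    convert this using 1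
    abel
  have dS' : ∀ a b c, fderiv ℝ (S b c) u a = fderiv ℝ (fderiv ℝ (W c)) u a (horiz f P b u) +
      fderiv ℝ (W c) u (fderiv ℝ (horiz f P b) u a) := by
    intro a b c
    rw [hS]
    simp only
    rw [fderiv_clm_apply ((smW' c).differentiableAt (by simp))
      ((h.contDiffAt_horiz hu b).differentiableAt (by simp))]
    simp [add_comm]
  -- k is the Lie bracket at `u` of the horizontal fields extending a and b. Antisymmetrising in a
  -- and b removes the second derivative of W c and leaves its derivative along k.
  set k : X := fderiv ℝ (horiz f P b) u a - fderiv ℝ (horiz f P a) u b with hk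
  have hkS : fderiv ℝ (S b c) u a - fderiv ℝ (S a c) u b = fderiv ℝ (W c) u k := by
    have hsym : fderiv ℝ (fderiv ℝ (W c)) u a b = fderiv ℝ (fderiv ℝ (W c)) u b a :=
      ((smW c u hu).isSymmSndFDerivAt two_le_smooth) a b
    rw [dS', dS', h.horiz_eq hu ha, h.horiz_eq hu hb, hsym, hk, map_sub]
    abel
  -- By `dWg`, only the vertical part of the bracket contributes modulo T; it measures the
  -- non-integrability of the horizontal planes.
  have hPk : P u (fderiv ℝ f u k) =
      -fderiv ℝ P u a (fderiv ℝ f u b) + fderiv ℝ P u b (fderiv ℝ f u a) := by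
    have e1 := dW b u hu a
    have e2 := dW a u hu b
    rw [h.horiz_eq hu hb] at e1
    rw [h.horiz_eq hu ha, h.symm_fderiv hu] at e2
    have : fderiv ℝ f u k = fderiv ℝ (W b) u a - fderiv ℝ (W a) u b := by
      rw [e1, e2, hk, map_sub]; abel
    rw [this, map_sub, PdW b u hu, PdW a u hu, hW]
    simp only
    rw [h.horiz_eq hu ha, h.horiz_eq hu hb]
    abel
  have m1 := dS a b c ha hb hc
  have m2 := dS b a c hb ha hc
  have m3 := dWg c hc k
  rw [← hkS, hPk] at m3
  have := T.sub_mem (T.sub_mem m1 m2) m3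
  convert this using 1
  simp only [map_sub, map_add, map_neg]
  abel

end RuledPatch

end Calculus

/-! ### Transport of horizontal vectors along the leaves. -/

section Transport

open Filter Topology Set

variable {X V : Type*} [NormedAddCommGroup X] [NormedSpace ℝ X] [FiniteDimensional ℝ X]
  [NormedAddCommGroup V] [InnerProductSpace ℝ V] [FiniteDimensional ℝ V]

namespace RuledPatch

variable {f : X → V} {P : X → V →L[ℝ] V} {U : Set X}

/-- The zeros of the differential of a function which is constant along the rulings propagate
along the rulings. -/
theorem fderiv_eq_zero_of_leaf (h : RuledPatch f P U) {w : V} {γ : ℝ → X}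
    (hγU : ∀ t ∈ Icc (0 : ℝ) 1, γ t ∈ U) (hγd : ∀ t ∈ Icc (0 : ℝ) 1, DifferentiableAt ℝ γ t)
    (hγw : ∀ t ∈ Icc (0 : ℝ) 1, fderiv ℝ f (γ t) (deriv γ t) = w)
    (hPw : ∀ t ∈ Icc (0 : ℝ) 1, P (γ t) w = w)
    {η : X → ℝ} (hη : ∀ u ∈ U, ContDiffAt ℝ ∞ η u)
    (hηv : ∀ u ∈ U, ∀ s, P u (fderiv ℝ f u s) = fderiv ℝ f u s → fderiv ℝ η u s = 0)
    (h1 : fderiv ℝ η (γ 1) = 0) : fderiv ℝ η (γ 0) = 0 := by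
  set Y : X → X := vert f P (fun _ => w) with hY
  have smY : ∀ u ∈ U, ContDiffAt ℝ ∞ Y u := fun u hu => h.contDiffAt_vert hu contDiffAt_const
  have hYγ : ∀ t ∈ Icc (0 : ℝ) 1, Y (γ t) = deriv γ t := by
    intro t ht
    apply h.injective _ (hγU t ht)
    rw [hY, h.fderiv_vert (hγU t ht), hγw t ht, hPw t ht]
  have hηY : ∀ u ∈ U, fderiv ℝ η u (Y u) = 0 := by
    intro u hu
    apply hηv u hu
    rw [hY, h.fderiv_vert hu, h.idem u hu]
  -- Differentiate dη(Y) = 0 in all directions and use the symmetry of the second derivative.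
  have key : ∀ u ∈ U, fderiv ℝ (fderiv ℝ η) u (Y u) = -(fderiv ℝ η u).comp (fderiv ℝ Y u) := by
    intro u hu
    ext a
    have hev : (fun y => fderiv ℝ η y (Y y)) =ᶠ[𝓝 u] fun _ => 0 := by
      filter_upwards [h.mem_nhds hu] with y hy using hηY y hy
    have e := DFunLike.congr_fun (hev.fderiv_eq (𝕜 := ℝ)) a
    have dη : DifferentiableAt ℝ (fderiv ℝ η) u :=
      ((hη u hu).fderiv_right (m := ∞) (by simp)).differentiableAt (by simp)
    rw [fderiv_clm_apply dη ((smY u hu).differentiableAt (by simp))] at e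
    simp only [add_apply, ContinuousLinearMap.comp_apply,
      ContinuousLinearMap.flip_apply, fderiv_fun_const, Pi.zero_apply, zero_apply] at e
    rw [((hη u hu).isSymmSndFDerivAt two_le_smooth) (Y u) a]
    simp only [neg_apply, ContinuousLinearMap.comp_apply]
    linarith
  have hγc : ContinuousOn γ (Icc 0 1) := fun t ht => (hγd t ht).continuousAt.continuousWithinAt
  have cY : ContinuousOn (fun t => fderiv ℝ Y (γ t)) (Icc 0 1) := by
    intro t ht
    exact ContinuousAt.continuousWithinAt (ContinuousAt.comp (f := γ) (g := fderiv ℝ Y)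
      (((smY _ (hγU t ht)).fderiv_right (m := ∞) (by simp)).continuousAt)
      (hγd t ht).continuousAt)
  obtain ⟨K, hK⟩ := isCompact_Icc.exists_bound_of_continuousOn cY
  have dl : ∀ t ∈ Icc (0 : ℝ) 1, HasDerivAt (fun t => fderiv ℝ η (γ t))
      (-(fderiv ℝ η (γ t)).comp (fderiv ℝ Y (γ t))) t := by
    intro t ht
    have dη : DifferentiableAt ℝ (fderiv ℝ η) (γ t) :=
      ((hη _ (hγU t ht)).fderiv_right (m := ∞) (by simp)).differentiableAt (by simp)
    have := dη.hasFDerivAt.comp_hasDerivAt t (hγd t ht).hasDerivAt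
    rwa [← hYγ t ht, key _ (hγU t ht)] at this
  -- Along γ, dη solves a linear equation whose Lipschitz constant is a bound for DY on the compact
  -- segment. Its value at the right end is zero, so it agrees with the zero solution.
  have := ODE_solution_unique_of_mem_Icc_left (K := K.toNNReal) (s := fun _ => univ)
    (v := fun t (L : X →L[ℝ] ℝ) => -L.comp (fderiv ℝ Y (γ t)))
    (f := fun t => fderiv ℝ η (γ t)) (g := fun _ => 0) (a := 0) (b := 1)
    (fun t ht => by
      refine LipschitzWith.lipschitzOnWith (LipschitzWith.of_dist_le_mul fun L L' => ?_)
      rw [dist_eq_norm, dist_eq_norm, neg_sub_neg, ← ContinuousLinearMap.sub_comp, norm_sub_rev L]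
      refine (ContinuousLinearMap.opNorm_comp_le _ _).trans ?_
      rw [mul_comm]
      exact mul_le_mul_of_nonneg_right
        ((hK t (Ioc_subset_Icc_self ht)).trans (Real.le_coe_toNNReal K)) (norm_nonneg _))
    (fun t ht => (dl t ht).continuousAt.continuousWithinAt)
    (fun t ht => (dl t (Ioc_subset_Icc_self ht)).hasDerivWithinAt) (fun _ _ => mem_univ _)
    continuousOn_const (fun t _ => by simpa using hasDerivWithinAt_const _ _ _)
    (fun _ _ => mem_univ _) h1
  exact this (left_mem_Icc.2 zero_le_one)

/-- Horizontal vectors at one end of a segment contained in a ruling correspond to horizontal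
vectors at the other end. -/
theorem exists_transport (h : RuledPatch f P U) {w : V} {γ : ℝ → X}
    (hγU : ∀ t ∈ Icc (0 : ℝ) 1, γ t ∈ U) (hγd : ∀ t ∈ Icc (0 : ℝ) 1, DifferentiableAt ℝ γ t)
    (hγw : ∀ t ∈ Icc (0 : ℝ) 1, fderiv ℝ f (γ t) (deriv γ t) = w)
    (hf : f (γ 1) = f (γ 0) + w)
    (hPw : ∀ t ∈ Icc (0 : ℝ) 1, P (γ t) w = w)
    {a : X} (ha : IsHorizontal f P (γ 0) a) :
    ∃ b, IsHorizontal f P (γ 1) b ∧ fderiv ℝ P (γ 1) b = fderiv ℝ P (γ 0) a ∧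
      fderiv ℝ f (γ 1) b = fderiv ℝ f (γ 0) a + fderiv ℝ P (γ 0) a w := by
  have h0U := hγU 0 (left_mem_Icc.2 zero_le_one)
  have h1U := hγU 1 (right_mem_Icc.2 zero_le_one)
  -- ψ is the foot of the perpendicular from the origin to the affine leaf, so Ψ encodes the leaf by
  -- its direction and position and is constant along the rulings.
  set ψ : X → V := fun u => f u - P u (f u) with hψ
  set Ψ : X → (V →L[ℝ] V) × V := fun u => (P u, ψ u) with hΨ
  have smψ : ∀ u ∈ U, ContDiffAt ℝ ∞ ψ u := fun u hu =>
    (h.smooth_map u hu).sub ((h.smooth_proj u hu).clm_apply (h.smooth_map u hu))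
  have smΨ : ∀ u ∈ U, ContDiffAt ℝ ∞ Ψ u := fun u hu => (h.smooth_proj u hu).prodMk (smψ u hu)
  have dψ : ∀ u ∈ U, ∀ s, fderiv ℝ ψ u s =
      fderiv ℝ f u s - fderiv ℝ P u s (f u) - P u (fderiv ℝ f u s) := by
    intro u hu s
    have df := (h.smooth_map u hu).differentiableAt (by simp)
    rw [hψ, fderiv_fun_sub df ((h.differentiableAt_proj hu).clm_apply df),
      fderiv_clm_apply (h.differentiableAt_proj hu) df]
    simp only [sub_apply, add_apply, ContinuousLinearMap.comp_apply,
      ContinuousLinearMap.flip_apply]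
    abel
  have dΨ : ∀ u ∈ U, ∀ s, fderiv ℝ Ψ u s = (fderiv ℝ P u s, fderiv ℝ ψ u s) := by
    intro u hu s
    rw [hΨ, (h.differentiableAt_proj hu).fderiv_prodMk
      ((smψ u hu).differentiableAt (by simp))]
    rfl
  have vΨ : ∀ u ∈ U, ∀ s, P u (fderiv ℝ f u s) = fderiv ℝ f u s → fderiv ℝ Ψ u s = 0 := by
    intro u hu s hs
    rw [dΨ u hu, dψ u hu, h.parallel u hu s hs, hs]
    simp
  -- Otherwise a linear functional of Ψ would have zero differential at γ 1 but not at γ 0, contrary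
  -- to `fderiv_eq_zero_of_leaf`.
  obtain ⟨b, hb⟩ : ∃ b, fderiv ℝ Ψ (γ 1) b = fderiv ℝ Ψ (γ 0) a := by
    by_contra hne
    set R : Submodule ℝ ((V →L[ℝ] V) × V) := LinearMap.range (fderiv ℝ Ψ (γ 1)).toLinearMap
    have hnot : fderiv ℝ Ψ (γ 0) a ∉ R := fun ⟨b, hb⟩ => hne ⟨b, hb⟩
    obtain ⟨ℓ, hℓa, hℓR⟩ := Submodule.exists_le_ker_of_notMem hnot
    set L : ((V →L[ℝ] V) × V) →L[ℝ] ℝ := LinearMap.toContinuousLinearMap ℓ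
    have dL : ∀ u ∈ U, fderiv ℝ (L ∘ Ψ) u = L.comp (fderiv ℝ Ψ u) := fun u hu =>
      L.hasFDerivAt.comp u (((smΨ u hu).differentiableAt (by simp)).hasFDerivAt) |>.fderiv
    have := h.fderiv_eq_zero_of_leaf hγU hγd hγw hPw (η := L ∘ Ψ)
      (fun u hu => L.contDiff.contDiffAt.comp u (smΨ u hu))
      (fun u hu s hs => by rw [dL u hu, ContinuousLinearMap.comp_apply, vΨ u hu s hs, map_zero])
      (by
        rw [dL _ h1U]
        ext s
        exact hℓR ⟨s, rfl⟩)
    rw [dL _ h0U] at this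
    exact hℓa (DFunLike.congr_fun this a)
  obtain ⟨t, ht, hbt⟩ := h.exists_horizontal h1U b
  have hb' : fderiv ℝ Ψ (γ 1) (b - t) = fderiv ℝ Ψ (γ 0) a := by
    rw [map_sub, vΨ _ h1U t (by rw [ht, h.idem _ h1U]), sub_zero, hb]
  rw [dΨ _ h1U, dΨ _ h0U, Prod.mk.injEq, dψ _ h1U, dψ _ h0U] at hb'
  obtain ⟨e1, e2⟩ := hb'
  refine ⟨b - t, hbt, e1, ?_⟩
  -- With equal derivatives of `P`, the ψ-components differ only through f(γ 1) = f(γ 0) + w, which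
  -- yields the term DP(a) w.
  rw [show P (γ 1) (fderiv ℝ f (γ 1) (b - t)) = 0 from hbt,
    show P (γ 0) (fderiv ℝ f (γ 0) a) = 0 from ha, e1, hf, map_add, sub_zero, sub_zero] at e2
  rw [sub_eq_iff_eq_add] at e2
  rw [e2]; abel

end RuledPatch

end Transport

/-! ### From the Codazzi relation along a leaf to p q = 1. -/

section Patch

open Filter Topology Set

variable {X V : Type*} [NormedAddCommGroup X] [NormedSpace ℝ X] [FiniteDimensional ℝ X]
  [NormedAddCommGroup V] [InnerProductSpace ℝ V] [FiniteDimensional ℝ V]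

theorem exists_coords_of_finrank_eq_four (hX : Module.finrank ℝ X = 4) (v : Fin 4 → X)
    (hv : ∀ c : Fin 4 → ℝ, c 0 • v 0 + c 1 • v 1 + c 2 • v 2 + c 3 • v 3 = 0 → c = 0) (t : X) :
    ∃ c : Fin 4 → ℝ, t = c 0 • v 0 + c 1 • v 1 + c 2 • v 2 + c 3 • v 3 := by
  have hli : LinearIndependent ℝ v := by
    rw [Fintype.linearIndependent_iff]
    intro g hg i
    rw [Fin.sum_univ_four] at hg
    exact congrFun (hv g hg) i
  let b := basisOfLinearIndependentOfCardEqFinrank hli (by simp [hX])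
  refine ⟨b.repr t, ?_⟩
  have := (b.sum_repr t).symm
  rw [Fin.sum_univ_four] at this
  simpa [b] using this

theorem eq_zero_of_orthonormal_combination {ι : Type*} [Fintype ι] {v : ι → V}
    (hv : Orthonormal ℝ v) {c : ι → ℝ} (hc : ∑ i, c i • v i = 0) (i : ι) : c i = 0 :=
  Fintype.linearIndependent_iff.1 hv.linearIndependent c hc i

namespace RuledPatch

variable {f : X → V} {P : X → V →L[ℝ] V} {U : Set X}

/-- A ruled patch with the normal form `S⁵, S⁶` at one point has `p q = 1` there. -/
theorem mul_eq_one (h : RuledPatch f P U) (hX : Module.finrank ℝ X = 4)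
    (hH : ∀ y ∈ U, ∀ v w, IsHorizontal f P y v → IsHorizontal f P y w →
      ∃ t, fderiv ℝ (fderiv ℝ f) y v w = fderiv ℝ f y t)
    {u : X} (hu : u ∈ U) {e : Fin 4 → X} (he : Orthonormal ℝ fun i => fderiv ℝ f u (e i))
    (hP : ∀ z, P u z = inner ℝ (fderiv ℝ f u (e 0)) z • fderiv ℝ f u (e 0) +
      inner ℝ (fderiv ℝ f u (e 1)) z • fderiv ℝ f u (e 1))
    {δ : ℝ} (hδ : 0 < δ)
    (hleaf : ∀ t₁ t₂ : ℝ, |t₁| < δ → |t₂| < δ → ∃ γ : ℝ → X, γ 0 = u ∧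
      ∀ t ∈ Icc (0 : ℝ) 1, γ t ∈ U ∧ DifferentiableAt ℝ γ t ∧ P (γ t) = P u ∧
        f (γ t) = f u + t • (t₁ • fderiv ℝ f u (e 0) + t₂ • fderiv ℝ f u (e 1)) ∧
        fderiv ℝ f (γ t) (deriv γ t) = t₁ • fderiv ℝ f u (e 0) + t₂ • fderiv ℝ f u (e 1))
    {ν₅ ν₆ : V} (h₅ : ∀ s, inner ℝ ν₅ (fderiv ℝ f u s) = 0)
    (h₆ : ∀ s, inner ℝ ν₆ (fderiv ℝ f u s) = 0) {p q : ℝ} (hp : p ≠ 0) (hq : q ≠ 0)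
    (h₅₅ : inner ℝ ν₅ (fderiv ℝ (fderiv ℝ f) u (e 2) (e 0)) = 1)
    (h₅₆ : inner ℝ ν₅ (fderiv ℝ (fderiv ℝ f) u (e 3) (e 0)) = 0)
    (h₆₅ : inner ℝ ν₆ (fderiv ℝ (fderiv ℝ f) u (e 2) (e 0)) = 0)
    (h₆₆ : inner ℝ ν₆ (fderiv ℝ (fderiv ℝ f) u (e 3) (e 0)) = 1)
    (hIIq : ∃ t, fderiv ℝ (fderiv ℝ f) u (e 2) (e 1) =
      q • fderiv ℝ (fderiv ℝ f) u (e 3) (e 0) + fderiv ℝ f u t)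
    (hIIp : ∃ t, fderiv ℝ (fderiv ℝ f) u (e 3) (e 1) =
      p • fderiv ℝ (fderiv ℝ f) u (e 2) (e 0) + fderiv ℝ f u t) :
    p * q = 1 := by
  have on : ∀ i j, inner ℝ (fderiv ℝ f u (e i)) (fderiv ℝ f u (e j)) = if i = j then (1 : ℝ) else 0 :=
    fun i j => orthonormal_iff_ite.1 he i j
  have P0 : P u (fderiv ℝ f u (e 0)) = fderiv ℝ f u (e 0) := by rw [hP, on, on]; simp
  have P1 : P u (fderiv ℝ f u (e 1)) = fderiv ℝ f u (e 1) := by rw [hP, on, on]; simp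
  have P2 : IsHorizontal f P u (e 2) := by rw [IsHorizontal, hP, on, on]; simp
  have P3 : IsHorizontal f P u (e 3) := by rw [IsHorizontal, hP, on, on]; simp
  have indep : ∀ c : Fin 4 → ℝ, c 0 • e 0 + c 1 • e 1 + c 2 • e 2 + c 3 • e 3 = 0 → c = 0 := by
    intro c hc
    ext i
    refine eq_zero_of_orthonormal_combination he ?_ i
    rw [Fin.sum_univ_four]
    simpa using congrArg (fderiv ℝ f u) hc
  have horSpan : ∀ t, IsHorizontal f P u t → ∃ x y : ℝ,
      fderiv ℝ f u t = x • fderiv ℝ f u (e 2) + y • fderiv ℝ f u (e 3) := by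
    intro t ht
    obtain ⟨c, hc⟩ := exists_coords_of_finrank_eq_four hX e indep t
    have h0 : inner ℝ (fderiv ℝ f u (e 0)) (P u (fderiv ℝ f u t)) = 0 := by
      rw [show P u (fderiv ℝ f u t) = 0 from ht, inner_zero_right]
    have h1 : inner ℝ (fderiv ℝ f u (e 1)) (P u (fderiv ℝ f u t)) = 0 := by
      rw [show P u (fderiv ℝ f u t) = 0 from ht, inner_zero_right]
    rw [← h.symm u hu, P0, hc] at h0
    rw [← h.symm u hu, P1, hc] at h1
    simp only [map_add, map_smul, inner_add_right, real_inner_smul_right, on] at h0 h1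
    norm_num [show (0 : Fin 4) ≠ 2 by decide, show (0 : Fin 4) ≠ 3 by decide,
      show (1 : Fin 4) ≠ 2 by decide, show (1 : Fin 4) ≠ 3 by decide] at h0 h1
    refine ⟨c 2, c 3, ?_⟩
    rw [hc, h0, h1]
    simp
  -- derivatives of the ruling
  set d : Fin 4 → Fin 4 → V := fun c i => fderiv ℝ P u (e c) (fderiv ℝ f u (e i)) with hd
  have Pd : ∀ c i, P u (fderiv ℝ f u (e i)) = fderiv ℝ f u (e i) → P u (d c i) = 0 :=
    fun c i hi => h.proj_fderiv_proj_of_eq hu _ hi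
  have hess : ∀ c i, P u (fderiv ℝ f u (e i)) = fderiv ℝ f u (e i) →
      ∃ t, d c i = fderiv ℝ (fderiv ℝ f) u (e c) (e i) + fderiv ℝ f u t := by
    intro c i hi
    obtain ⟨t, ht⟩ := h.hessian_of_mem hu hi (e c)
    exact ⟨-t, by rw [ht, map_neg, hd]; abel⟩
  have DE : ∀ c z, P u z = 0 → fderiv ℝ P u (e c) z =
      inner ℝ (d c 0) z • fderiv ℝ f u (e 0) + inner ℝ (d c 1) z • fderiv ℝ f u (e 1) := by
    intro c z hz
    rw [← h.proj_fderiv_proj_of_eq_zero hu (e c) hz, hP, ← h.symm_fderiv_proj hu,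
      ← h.symm_fderiv_proj hu]
  -- In these terms the commutator of the two derivatives of `P` on vectors orthogonal to the ruling
  -- is `wedgeOp`.
  have DD : ∀ c c' z, P u z = 0 → fderiv ℝ P u (e c) (fderiv ℝ P u (e c') z) =
      inner ℝ (d c' 0) z • d c 0 + inner ℝ (d c' 1) z • d c 1 := by
    intro c c' z hz
    rw [DE c' z hz, map_add, map_smul, map_smul]
  obtain ⟨t₂₀, k₂₀⟩ := hess 2 0 P0
  obtain ⟨t₂₁, k₂₁⟩ := hess 2 1 P1
  obtain ⟨t₃₀, k₃₀⟩ := hess 3 0 P0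
  obtain ⟨t₃₁, k₃₁⟩ := hess 3 1 P1
  obtain ⟨x, y, hxy⟩ : ∃ x y : ℝ, d 2 1 = q • d 3 0 + x • fderiv ℝ f u (e 2) +
      y • fderiv ℝ f u (e 3) := by
    obtain ⟨t, ht⟩ := hIIq
    have e1 : fderiv ℝ f u (t + t₂₁ - q • t₃₀) = d 2 1 - q • d 3 0 := by
      rw [k₂₁, k₃₀, ht, map_sub, map_add, map_smul]; module
    obtain ⟨x, y, hxy⟩ := horSpan (t + t₂₁ - q • t₃₀) (by
      rw [IsHorizontal, e1, map_sub, map_smul, Pd 2 1 P1, Pd 3 0 P0]; simp)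
    refine ⟨x, y, ?_⟩
    rw [add_assoc, ← hxy, e1]; abel
  obtain ⟨x', y', hxy'⟩ : ∃ x y : ℝ, d 3 1 = p • d 2 0 + x • fderiv ℝ f u (e 2) +
      y • fderiv ℝ f u (e 3) := by
    obtain ⟨t, ht⟩ := hIIp
    have e1 : fderiv ℝ f u (t + t₃₁ - p • t₂₀) = d 3 1 - p • d 2 0 := by
      rw [k₃₁, k₂₀, ht, map_sub, map_add, map_smul]; module
    obtain ⟨x, y, hxy⟩ := horSpan (t + t₃₁ - p • t₂₀) (by
      rw [IsHorizontal, e1, map_sub, map_smul, Pd 3 1 P1, Pd 2 0 P0]; simp)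
    refine ⟨x, y, ?_⟩
    rw [add_assoc, ← hxy, e1]; abel
  have conf : NormalConfiguration (fderiv ℝ f u (e 2)) (fderiv ℝ f u (e 3)) (d 2 0) (d 2 1) (d 3 0)
      (d 3 1) ν₅ ν₆ p q x y x' y' :=
    { aa₁ := by rw [on]; simp
      aa₂ := by rw [on]; simp
      aa₁₂ := by rw [on]; simp
      ν₅a₁ := h₅ _
      ν₅a₂ := h₅ _
      ν₆a₁ := h₆ _
      ν₆a₂ := h₆ _
      ν₅d₁₁ := by rw [k₂₀, inner_add_right, h₅, h₅₅, add_zero]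
      ν₅d₂₁ := by rw [k₃₀, inner_add_right, h₅, h₅₆, add_zero]
      ν₆d₁₁ := by rw [k₂₀, inner_add_right, h₆, h₆₅, add_zero]
      ν₆d₂₁ := by rw [k₃₀, inner_add_right, h₆, h₆₆, add_zero]
      hd₁₂ := hxy
      hd₂₂ := hxy'
      hp := hp
      hq := hq }
  refine conf.mul_eq_one hδ fun t₁ t₂ ht₁ ht₂ α β hα hβ => ?_
  obtain ⟨γ, hγ0, hγ⟩ := hleaf t₁ t₂ ht₁ ht₂
  set w := t₁ • fderiv ℝ f u (e 0) + t₂ • fderiv ℝ f u (e 1) with hw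
  have hPw : P u w = w := by rw [hw, map_add, map_smul, map_smul, P0, P1]
  have hγ1 := hγ 1 (right_mem_Icc.2 zero_le_one)
  have tr : ∀ c, IsHorizontal f P u (e c) → ∃ b, IsHorizontal f P (γ 1) b ∧
      fderiv ℝ P (γ 1) b = fderiv ℝ P u (e c) ∧
      fderiv ℝ f (γ 1) b = fderiv ℝ f u (e c) + t₁ • d c 0 + t₂ • d c 1 := by
    intro c hc
    obtain ⟨b, hb1, hb2, hb3⟩ := h.exists_transport (w := w) (γ := γ) (a := e c)
      (fun t ht => (hγ t ht).1) (fun t ht => (hγ t ht).2.1) (fun t ht => (hγ t ht).2.2.2.2)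
      (by rw [hγ1.2.2.2.1, hγ0, one_smul])
      (fun t ht => by rw [(hγ t ht).2.2.1, hPw]) (by rwa [hγ0])
    rw [hγ0] at hb2 hb3
    refine ⟨b, hb1, hb2, ?_⟩
    rw [hb3, hw, map_add, map_smul, map_smul, ← add_assoc]
  obtain ⟨b₂, H₂, D₂, F₂⟩ := tr 2 P2
  obtain ⟨b₃, H₃, D₃, F₃⟩ := tr 3 P3
  rw [← hα] at F₂
  rw [← hβ] at F₃
  have Pα : P u α = 0 := by
    rw [hα, map_add, map_add, map_smul, map_smul, Pd 2 0 P0, Pd 2 1 P1,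
      show P u (fderiv ℝ f u (e 2)) = 0 from P2]; simp
  have Pβ : P u β = 0 := by
    rw [hβ, map_add, map_add, map_smul, map_smul, Pd 3 0 P0, Pd 3 1 P1,
      show P u (fderiv ℝ f u (e 3)) = 0 from P3]; simp
  -- α and β span the horizontal plane at γ 1. If c₂b₂ + c₃b₃ = 0, the transported derivatives of
  -- `P` give c₂ d₂ᵢ + c₃ d₃ᵢ = 0 for both i; subtracting these from c₂α + c₃β = 0 leaves the same
  -- relation between the original orthonormal pair.
  have hor₁ : ∀ z t, P u z = 0 → z = fderiv ℝ f (γ 1) t → ∃ s₁ s₂ : ℝ, z = s₁ • α + s₂ • β := by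
    intro z t hz ht
    obtain ⟨s₀, hs₀⟩ := h.tangent _ hγ1.1 (fderiv ℝ f u (e 0))
    obtain ⟨s₁, hs₁⟩ := h.tangent _ hγ1.1 (fderiv ℝ f u (e 1))
    rw [hγ1.2.2.1, P0] at hs₀
    rw [hγ1.2.2.1, P1] at hs₁
    have coef : ∀ c : Fin 4 → ℝ, P u (fderiv ℝ f (γ 1) (c 0 • s₀ + c 1 • s₁ + c 2 • b₂ + c 3 • b₃)) =
        0 → c 0 = 0 ∧ c 1 = 0 := by
      intro c hc
      simp only [map_add, map_smul, hs₀, hs₁, F₂, F₃, Pα, Pβ, P0, P1, smul_zero, add_zero] at hc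
      have h0 := congrArg (inner ℝ (fderiv ℝ f u (e 0))) hc
      have h1 := congrArg (inner ℝ (fderiv ℝ f u (e 1))) hc
      simp only [inner_add_right, real_inner_smul_right, on, inner_zero_right] at h0 h1
      norm_num at h0 h1
      exact ⟨h0, h1⟩
    have ind : ∀ c : Fin 4 → ℝ, c 0 • (![s₀, s₁, b₂, b₃] : Fin 4 → X) 0 +
        c 1 • (![s₀, s₁, b₂, b₃] : Fin 4 → X) 1 + c 2 • (![s₀, s₁, b₂, b₃] : Fin 4 → X) 2 +
        c 3 • (![s₀, s₁, b₂, b₃] : Fin 4 → X) 3 = 0 → c = 0 := by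
      intro c hc
      change c 0 • s₀ + c 1 • s₁ + c 2 • b₂ + c 3 • b₃ = 0 at hc
      obtain ⟨c0, c1⟩ := coef c (by rw [hc]; simp)
      rw [c0, c1, zero_smul, zero_smul, zero_add, zero_add] at hc
      have hD := congrArg (fderiv ℝ P (γ 1)) hc
      have hF := congrArg (fderiv ℝ f (γ 1)) hc
      simp only [map_add, map_smul, map_zero, D₂, D₃, F₂, F₃] at hD hF
      have hD0 := DFunLike.congr_fun hD (fderiv ℝ f u (e 0))
      have hD1 := DFunLike.congr_fun hD (fderiv ℝ f u (e 1))
      simp only [add_apply, smul_apply, zero_apply] at hD0 hD1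
      change c 2 • d 2 0 + c 3 • d 3 0 = 0 at hD0
      change c 2 • d 2 1 + c 3 • d 3 1 = 0 at hD1
      have hz : c 2 • fderiv ℝ f u (e 2) + c 3 • fderiv ℝ f u (e 3) = 0 := by
        have : c 2 • fderiv ℝ f u (e 2) + c 3 • fderiv ℝ f u (e 3) =
            (c 2 • α + c 3 • β) - t₁ • (c 2 • d 2 0 + c 3 • d 3 0) -
              t₂ • (c 2 • d 2 1 + c 3 • d 3 1) := by
          rw [hα, hβ]; module
        rw [this, hF, hD0, hD1]; simp
      obtain ⟨c2, c3⟩ := conf.indep_a hz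
      ext i
      fin_cases i <;> assumption
    obtain ⟨c, hc⟩ := exists_coords_of_finrank_eq_four hX _ ind t
    change t = c 0 • s₀ + c 1 • s₁ + c 2 • b₂ + c 3 • b₃ at hc
    obtain ⟨c0, c1⟩ := coef c (by rw [← hc, ← ht, hz])
    refine ⟨c 2, c 3, ?_⟩
    rw [ht, hc, c0, c1]
    simp [F₂, F₃]
  have cod : ∀ b z, IsHorizontal f P (γ 1) b → z = fderiv ℝ f (γ 1) b → P u z = 0 →
      ∀ c, fderiv ℝ P (γ 1) b = fderiv ℝ P u (e c) → ∃ s₁ s₂ : ℝ,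
        wedgeOp (d 2 0) (d 2 1) (d 3 0) (d 3 1) z -
          (inner ℝ (d 2 0) β - inner ℝ (d 3 0) α) • d c 0 -
          (inner ℝ (d 2 1) β - inner ℝ (d 3 1) α) • d c 1 = s₁ • α + s₂ • β := by
    intro b z hb hz Pz c hc
    obtain ⟨t, ht⟩ := h.codazzi hγ1.1 hH H₂ H₃ hb
    rw [D₂, D₃, F₂, F₃, hc, ← hz, DD 2 3 z Pz, DD 3 2 z Pz, map_sub, DD c 2 β Pβ, DD c 3 α Pα] at ht
    have heq : wedgeOp (d 2 0) (d 2 1) (d 3 0) (d 3 1) z -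
          (inner ℝ (d 2 0) β - inner ℝ (d 3 0) α) • d c 0 -
          (inner ℝ (d 2 1) β - inner ℝ (d 3 1) α) • d c 1 = fderiv ℝ f (γ 1) t := by
      rw [← ht, wedgeOp]; module
    -- All d_ci are orthogonal to the ruling, so this tangent vector is horizontal.
    refine hor₁ _ t ?_ heq
    simp only [wedgeOp, map_sub, map_add, map_smul, Pd _ 0 P0, Pd _ 1 P1, smul_zero, add_zero,
      sub_zero]
  exact ⟨cod b₂ α H₂ F₂.symm Pα 2 D₂, cod b₃ β H₃ F₃.symm Pβ 3 D₃⟩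

end RuledPatch

end Patch

/-! ### Smooth projections and the second fundamental form in charts. -/

section ChartTransfer

open Filter Topology Set

/-- Inverting the Gram matrix makes the projection an explicit rational expression in the spanning
vectors; this is the source of its smoothness in `contDiffAt_chartProj`. -/
theorem starProjection_span_pair {V : Type*} [NormedAddCommGroup V] [InnerProductSpace ℝ V]
    (v₁ v₂ : V) [(Submodule.span ℝ {v₁, v₂}).HasOrthogonalProjection]
    (h : inner ℝ v₁ v₁ * inner ℝ v₂ v₂ - inner ℝ v₁ v₂ * inner ℝ v₁ v₂ ≠ (0 : ℝ)) (z : V) :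
    (Submodule.span ℝ {v₁, v₂}).starProjection z =
      ((inner ℝ v₁ v₁ * inner ℝ v₂ v₂ - inner ℝ v₁ v₂ * inner ℝ v₁ v₂)⁻¹ *
        (inner ℝ v₂ v₂ * inner ℝ v₁ z - inner ℝ v₁ v₂ * inner ℝ v₂ z)) • v₁ +
      ((inner ℝ v₁ v₁ * inner ℝ v₂ v₂ - inner ℝ v₁ v₂ * inner ℝ v₁ v₂)⁻¹ *
        (inner ℝ v₁ v₁ * inner ℝ v₂ z - inner ℝ v₁ v₂ * inner ℝ v₁ z)) • v₂ := by
  apply Submodule.eq_starProjection_of_mem_of_inner_eq_zero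
  · exact Submodule.mem_span_pair.2 ⟨_, _, rfl⟩
  · intro w hw
    obtain ⟨x, y, rfl⟩ := Submodule.mem_span_pair.1 hw
    have e1 : inner ℝ v₂ v₁ = (inner ℝ v₁ v₂ : ℝ) := real_inner_comm _ _
    have e2 : inner ℝ z v₁ = (inner ℝ v₁ z : ℝ) := real_inner_comm _ _
    have e3 : inner ℝ z v₂ = (inner ℝ v₂ z : ℝ) := real_inner_comm _ _
    simp only [inner_sub_left, inner_add_left, inner_add_right, real_inner_smul_left,
      real_inner_smul_right, e1, e2, e3]
    linear_combination (-(x * inner ℝ v₁ z + y * inner ℝ v₂ z)) * inv_mul_cancel₀ h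

theorem gram_ne_zero_of_finrank_span_pair {V : Type*} [NormedAddCommGroup V]
    [InnerProductSpace ℝ V] {v₁ v₂ : V}
    (h : Module.finrank ℝ (Submodule.span ℝ {v₁, v₂}) = 2) :
    inner ℝ v₁ v₁ * inner ℝ v₂ v₂ - inner ℝ v₁ v₂ * inner ℝ v₁ v₂ ≠ (0 : ℝ) := by
  intro h0
  have hli : LinearIndependent ℝ ![v₁, v₂] := by
    rw [linearIndependent_iff_card_eq_finrank_span]
    rw [Set.finrank, Matrix.range_cons_cons_empty, h, Fintype.card_fin]
  rw [LinearIndependent.pair_iff] at hli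
  by_cases hv : v₁ = 0
  · have := hli 1 0 (by simp [hv])
    exact one_ne_zero this.1
  · have hz : (-(inner ℝ v₁ v₂ : ℝ)) • v₁ + (inner ℝ v₁ v₁ : ℝ) • v₂ = 0 := by
      rw [← inner_self_eq_zero (𝕜 := ℝ)]
      have e1 : inner ℝ v₂ v₁ = (inner ℝ v₁ v₂ : ℝ) := real_inner_comm _ _
      simp only [inner_add_left, inner_add_right, real_inner_smul_left, real_inner_smul_right, e1]
      linear_combination (inner ℝ v₁ v₁ : ℝ) * h0
    have := (hli _ _ hz).2
    exact hv (inner_self_eq_zero.1 this)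

variable {n : ℕ} {M : Type*} [TopologicalSpace M] [ChartedSpace (Euc 4) M]

/-- The immersion `F` in the preferred chart at `x`. -/
noncomputable def chartMap (F : M → Euc n) (x : M) : Euc 4 → Euc n :=
  F ∘ (extChartAt (𝓡 4) x).symm

/-- The orthogonal projection to the plane field `E`, in the preferred chart at `x`. -/
noncomputable def chartProj (E : M → Submodule ℝ (Euc n)) (x : M) : Euc 4 → Euc n →L[ℝ] Euc n :=
  fun u => (E ((extChartAt (𝓡 4) x).symm u)).starProjection

theorem differential_apply {F : M → Euc n} (hF : ContMDiff (𝓡 4) (𝓡 n) ∞ F) (x : M)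
    (a : TangentSpace (𝓡 4) x) :
    differential F x a = fderiv ℝ (chartMap F x) (extChartAt (𝓡 4) x x) a := by
  have hd : MDifferentiableAt (𝓡 4) (𝓡 n) F x := hF.mdifferentiableAt (by simp)
  have e : fderivWithin ℝ (writtenInExtChartAt (𝓡 4) (𝓡 n) x F) (range (𝓡 4))
      (extChartAt (𝓡 4) x x) = fderiv ℝ (chartMap F x) (extChartAt (𝓡 4) x x) := by
    rw [modelWithCornersSelf_coe, range_id, fderivWithin_univ]
    rfl
  exact (DFunLike.congr_fun hd.mfderiv a).trans (DFunLike.congr_fun e a)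

variable [IsManifold (𝓡 4) ∞ M]

theorem contDiffOn_chart {n : ℕ} {g : M → Euc n} {s : Set M}
    (hg : ContMDiffOn (𝓡 4) (𝓡 n) ∞ g s) (x : M) :
    ContDiffOn ℝ ∞ (g ∘ (extChartAt (𝓡 4) x).symm)
      ((extChartAt (𝓡 4) x).target ∩ (extChartAt (𝓡 4) x).symm ⁻¹' s) :=
  contMDiffOn_iff_contDiffOn.1
    (hg.comp' (contMDiffOn_extChartAt_symm (I := 𝓡 4) (n := ∞) x))

theorem isOpen_chart_preimage {s : Set M} (hs : IsOpen s) (x : M) :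
    IsOpen ((extChartAt (𝓡 4) x).target ∩ (extChartAt (𝓡 4) x).symm ⁻¹' s) :=
  (continuousOn_extChartAt_symm x).isOpen_inter_preimage (isOpen_extChartAt_target x) hs

theorem contDiffAt_chartMap {F : M → Euc n} (hF : ContMDiff (𝓡 4) (𝓡 n) ∞ F) (x : M)
    {u : Euc 4} (hu : u ∈ (extChartAt (𝓡 4) x).target) : ContDiffAt ℝ ∞ (chartMap F x) u := by
  refine (contDiffOn_chart (s := univ) hF.contMDiffOn x).contDiffAt ?_
  rw [preimage_univ, inter_univ]
  exact (isOpen_extChartAt_target x).mem_nhds hu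

theorem contDiffAt_chartProj {F : M → Euc n} {E : M → Submodule ℝ (Euc n)}
    (hE : IsPlaneField F E) (x : M) {u : Euc 4} (hu : u ∈ (extChartAt (𝓡 4) x).target) :
    ContDiffAt ℝ ∞ (chartProj E x) u := by
  obtain ⟨-, -, s, hs, hus, v₁, v₂, hv₁, hv₂, hspan⟩ := hE ((extChartAt (𝓡 4) x).symm u)
  set W := (extChartAt (𝓡 4) x).target ∩ (extChartAt (𝓡 4) x).symm ⁻¹' s with hW
  have hWo : IsOpen W := isOpen_chart_preimage hs x
  refine ContDiffOn.contDiffAt (s := W) ?_ (hWo.mem_nhds ⟨hu, hus⟩)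
  have s₁ := contDiffOn_chart hv₁ x
  have s₂ := contDiffOn_chart hv₂ x
  rw [← hW] at s₁ s₂
  rw [contDiffOn_clm_apply]
  intro z
  set w₁ := v₁ ∘ (extChartAt (𝓡 4) x).symm with hw₁
  set w₂ := v₂ ∘ (extChartAt (𝓡 4) x).symm with hw₂
  have hgram : ∀ y ∈ W, inner ℝ (w₁ y) (w₁ y) * inner ℝ (w₂ y) (w₂ y) -
      inner ℝ (w₁ y) (w₂ y) * inner ℝ (w₁ y) (w₂ y) ≠ (0 : ℝ) := by
    intro y hy
    apply gram_ne_zero_of_finrank_span_pair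
    have := (hE ((extChartAt (𝓡 4) x).symm y)).2.1
    rwa [hspan _ hy.2] at this
  have i₁₁ := s₁.inner ℝ s₁
  have i₁₂ := s₁.inner ℝ s₂
  have i₂₂ := s₂.inner ℝ s₂
  have i₁ := s₁.inner ℝ (contDiffOn_const (c := z))
  have i₂ := s₂.inner ℝ (contDiffOn_const (c := z))
  have D := ((i₁₁.mul i₂₂).sub (i₁₂.mul i₁₂)).inv hgram
  refine ((((D.mul ((i₂₂.mul i₁).sub (i₁₂.mul i₂))).smul s₁).add
    ((D.mul ((i₁₁.mul i₂).sub (i₁₂.mul i₁))).smul s₂))).congr fun y hy => ?_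
  have hy' : E ((extChartAt (𝓡 4) x).symm y) = Submodule.span ℝ {w₁ y, w₂ y} := hspan _ hy.2
  rw [chartProj]
  simp only [hy']
  rw [starProjection_span_pair _ _ (hgram y hy)]
  rfl

/-- The differential and the second fundamental form at a point near `x`, in the preferred chart
at `x`. -/
theorem exists_chart_transition {F : M → Euc n} (hF : IsSmoothImmersion F) (x : M) {u : Euc 4}
    (hu : u ∈ (extChartAt (𝓡 4) x).target) :
    ∃ τ : TangentSpace (𝓡 4) ((extChartAt (𝓡 4) x).symm u) ≃ₗ[ℝ] Euc 4,
      (∀ a, differential F ((extChartAt (𝓡 4) x).symm u) a = fderiv ℝ (chartMap F x) u (τ a)) ∧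
      ∀ a b, secondFundamentalForm F ((extChartAt (𝓡 4) x).symm u) a b =
        (tangentPlane F ((extChartAt (𝓡 4) x).symm u))ᗮ.starProjection
          (fderiv ℝ (fderiv ℝ (chartMap F x)) u (τ a) (τ b)) := by
  set y := (extChartAt (𝓡 4) x).symm u with hy
  have hyx : y ∈ (extChartAt (𝓡 4) x).source := (extChartAt (𝓡 4) x).map_target hu
  set z := extChartAt (𝓡 4) y y with hz
  set σ : Euc 4 → Euc 4 := extChartAt (𝓡 4) x ∘ (extChartAt (𝓡 4) y).symm with hσ
  have hσz : σ z = u := by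
    rw [hσ, Function.comp_apply, hz, extChartAt_to_inv, hy, (extChartAt (𝓡 4) x).right_inv hu]
  have hzT : z ∈ (extChartAt (𝓡 4) y).target := mem_extChartAt_target y
  set W := (extChartAt (𝓡 4) y).target ∩
    (extChartAt (𝓡 4) y).symm ⁻¹' (extChartAt (𝓡 4) x).source with hW
  have hWo : IsOpen W := isOpen_chart_preimage (isOpen_extChartAt_source x) y
  have hzW : z ∈ W := ⟨hzT, by rw [mem_preimage, hz, extChartAt_to_inv]; exact hyx⟩
  have smσ : ContDiffAt ℝ ∞ σ z := by
    have : ContMDiffOn (𝓡 4) (𝓡 4) ∞ (extChartAt (𝓡 4) x) (extChartAt (𝓡 4) x).source := by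
      rw [extChartAt_source]; exact contMDiffOn_extChartAt
    exact (contDiffOn_chart this y).contDiffAt (hWo.mem_nhds hzW)
  have hfσ : ∀ w ∈ W, chartMap F y w = chartMap F x (σ w) := by
    intro w hw
    simp only [chartMap, hσ, Function.comp_apply]
    rw [(extChartAt (𝓡 4) x).left_inv hw.2]
  have smf : ContDiffAt ℝ ∞ (chartMap F x) u := contDiffAt_chartMap hF.1 x hu
  have hd : ∀ᶠ w in 𝓝 z, fderiv ℝ (chartMap F y) w =
      (fderiv ℝ (chartMap F x) (σ w)).comp (fderiv ℝ σ w) := by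
    have hσU : ∀ᶠ w in 𝓝 z, σ w ∈ (extChartAt (𝓡 4) x).target :=
      smσ.continuousAt.eventually_mem (by
        rw [hσz]; exact (isOpen_extChartAt_target x).mem_nhds hu)
    have hσd : ∀ᶠ w in 𝓝 z, ContDiffAt ℝ 1 σ w :=
      (smσ.of_le (m := 1) (by exact WithTop.coe_le_coe.2 le_top)).eventually (by simp)
    filter_upwards [hσU, hσd, hWo.mem_nhds hzW] with w hw1 hw2 hw3
    have : chartMap F y =ᶠ[𝓝 w] chartMap F x ∘ σ := by
      filter_upwards [hWo.mem_nhds hw3] with w' hw' using hfσ w' hw'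
    rw [this.fderiv_eq]
    exact fderiv_comp w ((contDiffAt_chartMap hF.1 x hw1).differentiableAt (by simp))
      (hw2.differentiableAt (by simp))
  have hdz := hd.self_of_nhds
  rw [hσz] at hdz
  have hdiff : ∀ a : TangentSpace (𝓡 4) y, differential F y a =
      fderiv ℝ (chartMap F x) u (fderiv ℝ σ z a) := by
    intro a
    rw [differential_apply hF.1, ← hz, hdz]
    rfl
  have hinj : Function.Injective (fderiv ℝ σ z) := by
    intro a b hab
    apply hF.2 y
    exact (hdiff a).trans ((congrArg (fderiv ℝ (chartMap F x) u) hab).trans (hdiff b).symm)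
  let τ : Euc 4 ≃ₗ[ℝ] Euc 4 :=
    LinearEquiv.ofInjectiveEndo (fderiv ℝ σ z).toLinearMap hinj
  refine ⟨τ, hdiff, fun a b => ?_⟩
  have smf' : DifferentiableAt ℝ (fderiv ℝ (chartMap F x)) (σ z) := by
    rw [hσz]
    exact (smf.fderiv_right (m := ∞) (by simp)).differentiableAt (by simp)
  have smσ' : DifferentiableAt ℝ (fderiv ℝ σ) z :=
    (smσ.fderiv_right (m := ∞) (by simp)).differentiableAt (by simp)
  have dσ : DifferentiableAt ℝ σ z := smσ.differentiableAt (by simp)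
  -- Chain rule for the coordinate change σ. The second derivative of σ contributes a tangent
  -- vector, which the normal projection removes.
  have h2 : fderiv ℝ (fderiv ℝ (chartMap F y)) z a b =
      fderiv ℝ (fderiv ℝ (chartMap F x)) u (τ a) (τ b) +
        fderiv ℝ (chartMap F x) u (fderiv ℝ (fderiv ℝ σ) z a b) := by
    have hd' : fderiv ℝ (chartMap F y) =ᶠ[𝓝 z] fun w =>
      (fderiv ℝ (chartMap F x) (σ w)).comp (fderiv ℝ σ w) := hd
    have hcomp : DifferentiableAt ℝ (fun w => fderiv ℝ (chartMap F x) (σ w)) z :=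
      DifferentiableAt.comp (g := fderiv ℝ (chartMap F x)) z smf' dσ
    have hc2 : fderiv ℝ (fun w => fderiv ℝ (chartMap F x) (σ w)) z =
        (fderiv ℝ (fderiv ℝ (chartMap F x)) (σ z)).comp (fderiv ℝ σ z) :=
      fderiv_comp (g := fderiv ℝ (chartMap F x)) z smf' dσ
    rw [hd'.fderiv_eq, fderiv_clm_comp hcomp smσ', hc2, hσz]
    exact add_comm _ _
  have h3 : secondFundamentalForm F y a b =
      (tangentPlane F y)ᗮ.starProjection (fderiv ℝ (fderiv ℝ (chartMap F y)) z a b) := rfl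
  rw [h3, h2, map_add]
  have hmem : fderiv ℝ (chartMap F x) u (fderiv ℝ (fderiv ℝ σ) z a b) ∈ tangentPlane F y := by
    refine ⟨τ.symm (fderiv ℝ (fderiv ℝ σ) z a b), ?_⟩
    have := hdiff (τ.symm (fderiv ℝ (fderiv ℝ σ) z a b))
    rw [this]
    congr 1
    exact τ.apply_symm_apply _
  rw [(Submodule.starProjection_apply_eq_zero_iff _).2
    (Submodule.le_orthogonal_orthogonal _ hmem), add_zero]
  rfl

end ChartTransfer

/-! ### The ruling in charts and the asymptotic horizontal planes. -/

section RuledChart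

open Filter Topology Set

variable {n : ℕ} {M : Type*} [TopologicalSpace M] [ChartedSpace (Euc 4) M]
  [IsManifold (𝓡 4) ∞ M] {F : M → Euc n} {E : M → Submodule ℝ (Euc n)}

/-- The disc of the ruling through a point, in a chart. -/
theorem IsRuledBy.exists_chart_leaf (hR : IsRuledBy F E) (x : M) {u : Euc 4}
    (hu : u ∈ (extChartAt (𝓡 4) x).target) :
    ∃ r > 0, ∃ κ : E ((extChartAt (𝓡 4) x).symm u) → Euc 4, κ 0 = u ∧
      ∀ w ∈ Metric.ball 0 r, κ w ∈ (extChartAt (𝓡 4) x).target ∧ DifferentiableAt ℝ κ w ∧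
        chartMap F x (κ w) = chartMap F x u + w ∧ chartProj E x (κ w) = chartProj E x u := by
  obtain ⟨r, hr, c, hc0, hcs, hc⟩ := hR ((extChartAt (𝓡 4) x).symm u)
  have hy : (extChartAt (𝓡 4) x).symm u ∈ (extChartAt (𝓡 4) x).source :=
    (extChartAt (𝓡 4) x).map_target hu
  have hcont : ContinuousAt c 0 :=
    (hcs.continuousOn).continuousAt (Metric.ball_mem_nhds 0 hr)
  have hev : ∀ᶠ w in 𝓝 0, c w ∈ (extChartAt (𝓡 4) x).source :=
    hcont.eventually_mem (by
      rw [hc0]; exact (isOpen_extChartAt_source x).mem_nhds hy)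
  obtain ⟨r', hr', hball⟩ := Metric.eventually_nhds_iff_ball.1 hev
  refine ⟨min r r', lt_min hr hr', extChartAt (𝓡 4) x ∘ c, ?_, fun w hw => ?_⟩
  · rw [Function.comp_apply, hc0, (extChartAt (𝓡 4) x).right_inv hu]
  · have hw1 : w ∈ Metric.ball (0 : E ((extChartAt (𝓡 4) x).symm u)) r :=
      Metric.ball_subset_ball (min_le_left _ _) hw
    have hw2 := hball w (Metric.ball_subset_ball (min_le_right _ _) hw)
    refine ⟨(extChartAt (𝓡 4) x).map_source hw2, ?_, ?_, ?_⟩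
    · have h1 : ContMDiffAt 𝓘(ℝ, E ((extChartAt (𝓡 4) x).symm u)) (𝓡 4) ∞ c w :=
        (hcs w hw1).contMDiffAt (Metric.isOpen_ball.mem_nhds hw1)
      have h2 : ContMDiffAt (𝓡 4) (𝓡 4) ∞ (extChartAt (𝓡 4) x) (c w) :=
        contMDiffAt_extChartAt' (by rwa [extChartAt_source] at hw2)
      exact (h2.comp w h1).contDiffAt.differentiableAt (by simp)
    · simp only [chartMap, Function.comp_apply]
      rw [(extChartAt (𝓡 4) x).left_inv hw2, (hc w hw1).1]
    · have hcE : E ((extChartAt (𝓡 4) x).symm (extChartAt (𝓡 4) x (c w))) =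
          E ((extChartAt (𝓡 4) x).symm u) := by
        rw [(extChartAt (𝓡 4) x).left_inv hw2, (hc w hw1).2]
      simp only [chartProj, Function.comp_apply, hcE]

theorem injective_fderiv_chartMap (hF : IsSmoothImmersion F) (x : M) {u : Euc 4}
    (hu : u ∈ (extChartAt (𝓡 4) x).target) : Function.Injective (fderiv ℝ (chartMap F x) u) := by
  obtain ⟨τ, hτ, -⟩ := exists_chart_transition hF x hu
  intro a b hab
  have : τ.symm a = τ.symm b := by
    apply hF.2
    rw [hτ, hτ, τ.apply_symm_apply, τ.apply_symm_apply, hab]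
  exact τ.symm.injective this

theorem mem_tangentPlane_chart_iff (hF : IsSmoothImmersion F) (x : M) {u : Euc 4}
    (hu : u ∈ (extChartAt (𝓡 4) x).target) (z : Euc n) :
    z ∈ tangentPlane F ((extChartAt (𝓡 4) x).symm u) ↔ ∃ s, fderiv ℝ (chartMap F x) u s = z := by
  obtain ⟨τ, hτ, -⟩ := exists_chart_transition hF x hu
  constructor
  · rintro ⟨a, rfl⟩
    exact ⟨τ a, (hτ a).symm⟩
  · rintro ⟨s, rfl⟩
    exact ⟨τ.symm s, by rw [hτ, τ.apply_symm_apply]⟩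

/-- An immersed `4`-fold with a ruling gives a ruled patch in each chart. -/
theorem ruledPatch_chart (hF : IsSmoothImmersion F) (hE : IsPlaneField F E)
    (hR : IsRuledBy F E) (x : M) :
    RuledPatch (chartMap F x) (chartProj E x) (extChartAt (𝓡 4) x).target where
  isOpen := isOpen_extChartAt_target x
  smooth_map _ hu := contDiffAt_chartMap hF.1 x hu
  smooth_proj _ hu := contDiffAt_chartProj hE x hu
  injective _ hu := injective_fderiv_chartMap hF x hu
  idem _ _ _ := Submodule.starProjection_eq_self_iff.2 (Submodule.starProjection_apply_mem _ _)
  symm _ _ z w := Submodule.inner_starProjection_left_eq_right _ z w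
  tangent u hu z := (mem_tangentPlane_chart_iff hF x hu _).1
    ((hE _).1 (Submodule.starProjection_apply_mem _ z))
  parallel := by
    intro u hu s hs
    obtain ⟨r, hr, κ, hκ0, hκ⟩ := hR.exists_chart_leaf x hu
    have hmem : fderiv ℝ (chartMap F x) u s ∈ E ((extChartAt (𝓡 4) x).symm u) :=
      Submodule.starProjection_eq_self_iff.1 hs
    obtain ⟨-, hd, -, -⟩ := hκ 0 (Metric.mem_ball_self hr)
    have hball : Metric.ball (0 : E ((extChartAt (𝓡 4) x).symm u)) r ∈ 𝓝 0 :=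
      Metric.ball_mem_nhds 0 hr
    have df : DifferentiableAt ℝ (chartMap F x) (κ 0) := by
      rw [hκ0]; exact (contDiffAt_chartMap hF.1 x hu).differentiableAt (by simp)
    have dP : DifferentiableAt ℝ (chartProj E x) (κ 0) := by
      rw [hκ0]; exact (contDiffAt_chartProj hE x hu).differentiableAt (by simp)
    -- Differentiating at 0 shows that κ' sends f's to a vector with the same image f's, hence to s;
    -- as `P` is constant along κ, its derivative in the direction s vanishes.
    have e1 : chartMap F x ∘ κ =ᶠ[𝓝 0] fun w => chartMap F x u + (w : Euc n) := by
      filter_upwards [hball] with w hw using (hκ w hw).2.2.1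
    have e2 : chartProj E x ∘ κ =ᶠ[𝓝 0] fun _ => chartProj E x u := by
      filter_upwards [hball] with w hw using (hκ w hw).2.2.2
    have f1 := DFunLike.congr_fun (e1.fderiv_eq (𝕜 := ℝ)) ⟨_, hmem⟩
    have f2 := DFunLike.congr_fun (e2.fderiv_eq (𝕜 := ℝ)) ⟨_, hmem⟩
    rw [fderiv_comp _ df hd, hκ0, fderiv_const_add,
      show fderiv ℝ (Subtype.val : E ((extChartAt (𝓡 4) x).symm u) → Euc n) 0 =
        (E ((extChartAt (𝓡 4) x).symm u)).subtypeL from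
        (E ((extChartAt (𝓡 4) x).symm u)).subtypeL.hasFDerivAt.fderiv] at f1
    rw [fderiv_comp _ dP hd, hκ0, fderiv_fun_const] at f2
    have f1' : fderiv ℝ (chartMap F x) u (fderiv ℝ κ 0 ⟨_, hmem⟩) = fderiv ℝ (chartMap F x) u s := f1
    have f2' : fderiv ℝ (chartProj E x) u (fderiv ℝ κ 0 ⟨_, hmem⟩) = 0 := f2
    rwa [injective_fderiv_chartMap hF x hu f1'] at f2'

theorem exists_leaf_curve (hF : IsSmoothImmersion F) (hR : IsRuledBy F E) (x : M) {u : Euc 4}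
    (hu : u ∈ (extChartAt (𝓡 4) x).target) :
    ∃ r > 0, ∀ w ∈ E ((extChartAt (𝓡 4) x).symm u), ‖w‖ < r → ∃ γ : ℝ → Euc 4, γ 0 = u ∧
      ∀ t ∈ Icc (0 : ℝ) 1, γ t ∈ (extChartAt (𝓡 4) x).target ∧ DifferentiableAt ℝ γ t ∧
        chartProj E x (γ t) = chartProj E x u ∧ chartMap F x (γ t) = chartMap F x u + t • w ∧
        fderiv ℝ (chartMap F x) (γ t) (deriv γ t) = w := by
  obtain ⟨r, hr, κ, hκ0, hκ⟩ := hR.exists_chart_leaf x hu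
  refine ⟨r, hr, fun w hw hwr => ?_⟩
  set w' : E ((extChartAt (𝓡 4) x).symm u) := ⟨w, hw⟩ with hw'
  refine ⟨fun t => κ (t • w'), (congrArg κ (zero_smul ℝ w')).trans hκ0, fun t ht => ?_⟩
  have hmem : t • w' ∈ Metric.ball (0 : E ((extChartAt (𝓡 4) x).symm u)) r := by
    rw [mem_ball_zero_iff, norm_smul, Real.norm_eq_abs, abs_of_nonneg ht.1]
    exact (mul_le_of_le_one_left (norm_nonneg _) ht.2).trans_lt hwr
  obtain ⟨h1, h2, h3, h4⟩ := hκ _ hmem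
  have dsm : DifferentiableAt ℝ (fun t : ℝ => t • w') t := by fun_prop
  have dγ : DifferentiableAt ℝ (fun t : ℝ => κ (t • w')) t :=
    DifferentiableAt.comp (g := κ) t h2 dsm
  refine ⟨h1, dγ, h4, by rw [h3]; rfl, ?_⟩
  have df : DifferentiableAt ℝ (chartMap F x) (κ (t • w')) :=
    (contDiffAt_chartMap hF.1 x h1).differentiableAt (by simp)
  have hc := (df.hasFDerivAt.comp_hasDerivAt t dγ.hasDerivAt)
  have hev : (fun t : ℝ => chartMap F x u + t • w) =ᶠ[𝓝 t]
      chartMap F x ∘ fun t : ℝ => κ (t • w') := by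
    have : ∀ᶠ s : ℝ in 𝓝 t, s • w' ∈ Metric.ball (0 : E ((extChartAt (𝓡 4) x).symm u)) r :=
      dsm.continuousAt.eventually_mem (Metric.isOpen_ball.mem_nhds hmem)
    filter_upwards [this] with s hs
    exact ((hκ _ hs).2.2.1).symm
  have hc' := hc.congr_of_eventuallyEq hev
  have hl : HasDerivAt (fun t : ℝ => chartMap F x u + t • w) w t := by
    simpa using ((hasDerivAt_id t).smul_const w).const_add (chartMap F x u)
  exact hc'.unique hl

theorem mem_matricesII {x : M} {e : Fin 4 → TangentSpace (𝓡 4) x} {ν : Euc n}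
    (hν : ν ∈ (tangentPlane F x)ᗮ) :
    (Matrix.of fun i j => inner ℝ ν (secondFundamentalForm F x (e i) (e j))) ∈ matricesII F x e :=
  ⟨_, ⟨ν, hν, rfl⟩, rfl⟩

/-- At a point of Type B, the plane orthogonal to the ruling is asymptotic. -/
theorem hessian_of_isHorizontal (hF : IsSmoothImmersion F) (hE : IsPlaneField F E)
    (hR : IsRuledBy F E) (hB : ∀ x, IsTypeBWithEigenspace F E x) (x : M) {u : Euc 4}
    (hu : u ∈ (extChartAt (𝓡 4) x).target) (v w : Euc 4)
    (hv : IsHorizontal (chartMap F x) (chartProj E x) u v)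
    (hw : IsHorizontal (chartMap F x) (chartProj E x) u w) :
    ∃ t, fderiv ℝ (fderiv ℝ (chartMap F x)) u v w = fderiv ℝ (chartMap F x) u t := by
  have hpatch := ruledPatch_chart hF hE hR x
  set y := (extChartAt (𝓡 4) x).symm u with hy
  obtain ⟨τ, hτ, hII⟩ : ∃ τ : TangentSpace (𝓡 4) y ≃ₗ[ℝ] Euc 4,
      (∀ a, differential F y a = fderiv ℝ (chartMap F x) u (τ a)) ∧
      ∀ a b, secondFundamentalForm F y a b = (tangentPlane F y)ᗮ.starProjection
          (fderiv ℝ (fderiv ℝ (chartMap F x)) u (τ a) (τ b)) := exists_chart_transition hF x hu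
  have hT : ∀ z, z ∈ tangentPlane F y ↔ ∃ s, fderiv ℝ (chartMap F x) u s = z :=
    mem_tangentPlane_chart_iff hF x hu
  obtain ⟨e, he, hQ, R, hRe, μ, hEμ⟩ := hB y
  have hErank := (hE y).2.1
  have hPmem : ∀ z ∈ E y, chartProj E x u z = z := fun z hz =>
    Submodule.starProjection_eq_self_iff.2 hz
  set g : Fin 4 → Euc 4 := fun i => τ (e i) with hg
  have hfg : ∀ i, fderiv ℝ (chartMap F x) u (g i) = differential F y (e i) := fun i => (hτ _).symm
  have og : Orthonormal ℝ fun i => fderiv ℝ (chartMap F x) u (g i) := by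
    simp only [hfg]; exact he
  have on : ∀ i j, inner ℝ (fderiv ℝ (chartMap F x) u (g i)) (fderiv ℝ (chartMap F x) u (g j)) =
    if i = j then (1 : ℝ) else 0 := fun i j => orthonormal_iff_ite.1 og i j
  have indep : ∀ c : Fin 4 → ℝ, c 0 • g 0 + c 1 • g 1 + c 2 • g 2 + c 3 • g 3 = 0 → c = 0 := by
    intro c hc
    ext i
    refine eq_zero_of_orthonormal_combination og ?_ i
    rw [Fin.sum_univ_four]
    simpa using congrArg (fderiv ℝ (chartMap F x) u) hc
  have coords := exists_coords_of_finrank_eq_four (X := Euc 4) (by simp) g indep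
  have hess : ∀ ν ∈ (tangentPlane F y)ᗮ, ∀ a b,
      inner ℝ ν (secondFundamentalForm F y a b) =
        inner ℝ ν (fderiv ℝ (fderiv ℝ (chartMap F x)) u (τ a) (τ b)) := by
    intro ν hν a b
    rw [hII, ← Submodule.inner_starProjection_left_eq_right,
      Submodule.starProjection_eq_self_iff.2 hν]
  have hEE : ∀ i, differential F y (e i) ∈ E y → ∀ ν ∈ (tangentPlane F y)ᗮ,
      inner ℝ ν (secondFundamentalForm F y (e i) (e i)) = (0 : ℝ) := by
    intro i hi ν hν
    have hs : chartProj E x u (fderiv ℝ (chartMap F x) u (g i)) =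
        fderiv ℝ (chartMap F x) u (g i) := by
      rw [hfg]; exact hPmem _ hi
    obtain ⟨t, ht⟩ := hpatch.hessian_of_mem_of_mem hu hs hs
    rw [hess ν hν]
    change inner ℝ ν (fderiv ℝ (fderiv ℝ (chartMap F x)) u (g i) (g i)) = 0
    rw [ht]
    exact (Submodule.mem_orthogonal' _ _).1 hν _ ((hT _).2 ⟨t, rfl⟩)
  have hcoef : ∀ (v : Euc 4) (c : Fin 4 → ℝ), IsHorizontal (chartMap F x) (chartProj E x) u v →
      v = c 0 • g 0 + c 1 • g 1 + c 2 • g 2 + c 3 • g 3 → ∀ i, differential F y (e i) ∈ E y →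
      c i = 0 := by
    intro v c hv hc i hi
    have h0 : inner ℝ (differential F y (e i))
        (chartProj E x u (fderiv ℝ (chartMap F x) u v)) = (0 : ℝ) := by
      rw [show chartProj E x u (fderiv ℝ (chartMap F x) u v) = 0 from hv, inner_zero_right]
    rw [← hpatch.symm u hu, hPmem _ hi, ← hfg, hc] at h0
    simp only [map_add, map_smul, inner_add_right, real_inner_smul_right, on] at h0
    fin_cases i <;> simpa using h0
  -- For any other μ the eigenspace of R is zero, while the ruling has dimension 2.
  have hμ : μ = 1 ∨ μ = -1 := by
    by_contra! hne
    have hbot : Module.End.eigenspace R μ = ⊥ := by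
      rw [eq_bot_iff]
      intro a ha
      rw [Module.End.mem_eigenspace_iff] at ha
      obtain ⟨c, hc⟩ := coords (τ a)
      have hc' : a = c 0 • e 0 + c 1 • e 1 + c 2 • e 2 + c 3 • e 3 := by
        apply τ.injective
        simpa [hg] using hc
      rw [hc'] at ha
      simp only [map_add, map_smul, hRe] at ha
      have h0 := congrArg τ ha
      simp only [map_add, map_smul] at h0
      have hz := indep ![c 0 * (1 - μ), c 1 * (1 - μ), c 2 * (-1 - μ), c 3 * (-1 - μ)] (by
        simp only [Matrix.cons_val_zero, Matrix.cons_val_one, Matrix.cons_val, hg]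
        simp only [Matrix.cons_val_zero, Matrix.cons_val_one, Matrix.cons_val] at h0
        rw [← sub_eq_zero] at h0
        rw [← h0]
        module)
      have n1 : (1 : ℝ) - μ ≠ 0 := fun h => hne.1 (by linarith)
      have n2 : (-1 : ℝ) - μ ≠ 0 := fun h => hne.2 (by linarith)
      have z0 : c 0 = 0 := by simpa [n1] using congrFun hz 0
      have z1 : c 1 = 0 := by simpa [n1] using congrFun hz 1
      have z2 : c 2 = 0 := by simpa [n2] using congrFun hz 2
      have z3 : c 3 = 0 := by simpa [n2] using congrFun hz 3
      rw [hc', z0, z1, z2, z3]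
      simp
    rw [hEμ, hbot, Submodule.map_bot, finrank_bot] at hErank
    exact two_ne_zero hErank.symm
  have hmemE : ∀ i, (![1, 1, -1, -1] : Fin 4 → ℝ) i = μ → differential F y (e i) ∈ E y := by
    intro i hi
    rw [hEμ]
    refine Submodule.mem_map_of_mem ?_
    rw [Module.End.mem_eigenspace_iff, hRe, hi]
  obtain ⟨c, hc⟩ := coords v
  obtain ⟨d, hd⟩ := coords w
  -- The diagonal blocks of a Type B matrix are m and -m times the identity. The one belonging to
  -- the ruling vanishes, so m = 0 and the other one vanishes too; horizontal vectors involve only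
  -- that other block.
  have hcd : ∀ i j, ∀ ν ∈ (tangentPlane F y)ᗮ, c i * d j *
      inner ℝ ν (secondFundamentalForm F y (e i) (e j)) = 0 := by
    intro i j ν hν
    obtain ⟨m, b₁, b₂, b₃, b₄, hS⟩ := hQ _ (mem_matricesII hν)
    have hent : ∀ i j, inner ℝ ν (secondFundamentalForm F y (e i) (e j)) = _ := fun i j =>
      congrFun (congrFun hS i) j
    rcases hμ with rfl | rfl
    · have m0 : m = 0 := by
        have := hEE 0 (hmemE 0 rfl) ν hν
        rw [hent] at this
        simpa using this
      have c0 := hcoef v c hv hc 0 (hmemE 0 rfl)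
      have c1 := hcoef v c hv hc 1 (hmemE 1 rfl)
      have d0 := hcoef w d hw hd 0 (hmemE 0 rfl)
      have d1 := hcoef w d hw hd 1 (hmemE 1 rfl)
      rw [hent]
      fin_cases i <;> fin_cases j <;> simp [c0, c1, d0, d1, m0]
    · have m0 : m = 0 := by
        have := hEE 2 (hmemE 2 rfl) ν hν
        rw [hent] at this
        simpa using this
      have c2 := hcoef v c hv hc 2 (hmemE 2 rfl)
      have c3 := hcoef v c hv hc 3 (hmemE 3 rfl)
      have d2 := hcoef w d hw hd 2 (hmemE 2 rfl)
      have d3 := hcoef w d hw hd 3 (hmemE 3 rfl)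
      rw [hent]
      fin_cases i <;> fin_cases j <;> simp [c2, c3, d2, d3, m0]
  have hmem : fderiv ℝ (fderiv ℝ (chartMap F x)) u v w ∈ tangentPlane F y := by
    rw [← Submodule.orthogonal_orthogonal (tangentPlane F y), Submodule.mem_orthogonal]
    intro ν hν
    have hcd' : ∀ i j, c i * d j *
        inner ℝ ν (fderiv ℝ (fderiv ℝ (chartMap F x)) u (g i) (g j)) = 0 := by
      intro i j
      rw [← hcd i j ν hν, hess ν hν]
    rw [hc, hd]
    simp only [map_add, map_smul, add_apply, smul_apply,
      inner_add_right, real_inner_smul_right, mul_add, ← mul_assoc]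
    simp only [mul_comm (d _), hcd', add_zero]
  obtain ⟨t, ht⟩ := (hT _).1 hmem
  exact ⟨t, ht.symm⟩

end RuledChart

/-! ### Normal form of planes of 2 × 2 matrices under pairs of rotations. -/

section BlockNormalForm

/-- The polar form of the determinant of `2 × 2` matrices. -/
def detPolar (A B : Matrix (Fin 2) (Fin 2) ℝ) : ℝ :=
  A 0 0 * B 1 1 + A 1 1 * B 0 0 - A 0 1 * B 1 0 - A 1 0 * B 0 1

/-- The Frobenius inner product of `2 × 2` matrices. -/
def frobInner (A B : Matrix (Fin 2) (Fin 2) ℝ) : ℝ :=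
  A 0 0 * B 0 0 + A 0 1 * B 0 1 + A 1 0 * B 1 0 + A 1 1 * B 1 1

/-- The matrix of the rotation by the angle `a`. -/
noncomputable def rot (a : ℝ) : Matrix (Fin 2) (Fin 2) ℝ :=
  !![Real.cos a, Real.sin a; -Real.sin a, Real.cos a]

/-- Change of orthonormal bases, by rotations, in a space of `2 × 2` matrices. -/
noncomputable def rotMap (a b : ℝ) : Matrix (Fin 2) (Fin 2) ℝ →ₗ[ℝ] Matrix (Fin 2) (Fin 2) ℝ :=
  LinearMap.mulLeft ℝ (rot a) ∘ₗ LinearMap.mulRight ℝ (rot b).transpose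

theorem rotMap_apply (a b : ℝ) (A : Matrix (Fin 2) (Fin 2) ℝ) :
    rotMap a b A = rot a * (A * (rot b).transpose) := rfl

/-- A space of matrices on which the rank of `det` is its dimension contains no radical. -/
theorem eq_zero_of_detPolar_eq_zero {𝓑 : Submodule ℝ (Matrix (Fin 2) (Fin 2) ℝ)}
    (h2 : Module.finrank ℝ 𝓑 = 2) (hdet : detRank 𝓑 = 2) {A : Matrix (Fin 2) (Fin 2) ℝ}
    (hA : A ∈ 𝓑) (h : ∀ B ∈ 𝓑, detPolar A B = 0) : A = 0 := by
  set L := QuadraticMap.polarBilin (detForm.comp 𝓑.subtype) with hL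
  have hker : LinearMap.ker L = ⊥ := by
    have := LinearMap.finrank_range_add_finrank_ker L
    rw [h2, show Module.finrank ℝ (LinearMap.range L) = 2 from hdet] at this
    exact Submodule.finrank_eq_zero.1 (by omega)
  have hmem : (⟨A, hA⟩ : 𝓑) ∈ LinearMap.ker L := by
    rw [LinearMap.mem_ker]
    ext B
    have := h B B.2
    rw [hL, QuadraticMap.polarBilin_apply_apply, QuadraticMap.polar]
    simp only [QuadraticMap.comp_apply, Submodule.subtype_apply, detForm_apply,
      Matrix.det_fin_two, Submodule.coe_add, Matrix.add_apply, LinearMap.zero_apply]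
    rw [← this, detPolar]
    ring
  rw [hker, Submodule.mem_bot] at hmem
  exact congrArg Subtype.val hmem

/-- The values at 0 and π are opposite, so the intermediate value theorem applies. -/
theorem exists_cos_sin_eq_zero (x y : ℝ) : ∃ θ : ℝ, Real.cos θ * x + Real.sin θ * y = 0 := by
  have hc : Continuous fun θ : ℝ => Real.cos θ * x + Real.sin θ * y := by fun_prop
  rcases le_total x 0 with hx | hx
  · exact mem_range_of_exists_le_of_exists_ge hc ⟨0, by simpa⟩ ⟨Real.pi, by simpa⟩
  · exact mem_range_of_exists_le_of_exists_ge hc ⟨Real.pi, by simpa⟩ ⟨0, by simpa⟩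

/-- Two orthogonal vectors of the plane can be rotated to the coordinate axes. -/
theorem exists_rotation_to_axes {x₁ y₁ x₂ y₂ : ℝ} (h : x₁ * x₂ + y₁ * y₂ = 0) :
    ∃ s : ℝ, Real.sin s * x₁ + Real.cos s * y₁ = 0 ∧ Real.cos s * x₂ - Real.sin s * y₂ = 0 := by
  by_cases h1 : x₁ = 0 ∧ y₁ = 0
  · obtain ⟨s, hs⟩ := exists_cos_sin_eq_zero x₂ (-y₂)
    exact ⟨s, by simp [h1.1, h1.2], by linarith⟩
  · obtain ⟨s, hs⟩ := exists_cos_sin_eq_zero y₁ x₁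
    refine ⟨s, by linarith, ?_⟩
    have hcs := Real.sin_sq_add_cos_sq s
    set r := Real.cos s * x₁ - Real.sin s * y₁ with hr
    have ex : x₁ = r * Real.cos s := by
      rw [hr]; linear_combination (-x₁) * hcs + Real.sin s * hs
    have ey : y₁ = -(r * Real.sin s) := by
      rw [hr]; linear_combination (-y₁) * hcs + Real.cos s * hs
    have hr0 : r ≠ 0 := by
      intro h0
      rw [h0] at ex ey
      exact h1 ⟨by simpa using ex, by simpa using ey⟩
    have : r * (Real.cos s * x₂ - Real.sin s * y₂) = 0 := by
      rw [ex, ey] at h; linarith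
    simpa [hr0] using this

theorem frobInner_self_pos {A : Matrix (Fin 2) (Fin 2) ℝ} (hA : A ≠ 0) : 0 < frobInner A A := by
  by_contra hle
  apply hA
  rw [frobInner] at hle
  have h00 := mul_self_nonneg (A 0 0)
  have h01 := mul_self_nonneg (A 0 1)
  have h10 := mul_self_nonneg (A 1 0)
  have h11 := mul_self_nonneg (A 1 1)
  ext i j
  fin_cases i <;> fin_cases j <;> exact mul_self_eq_zero.1 (by simp only [Fin.zero_eta, Fin.mk_one, Fin.isValue]; linarith)

/-- A plane of matrices has a Frobenius-orthonormal basis. -/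
theorem exists_frob_orthonormal {𝓑 : Submodule ℝ (Matrix (Fin 2) (Fin 2) ℝ)}
    (h2 : Module.finrank ℝ 𝓑 = 2) : ∃ A ∈ 𝓑, ∃ B ∈ 𝓑, frobInner A A = 1 ∧ frobInner B B = 1 ∧
      frobInner A B = 0 := by
  let b := Module.finBasisOfFinrankEq ℝ 𝓑 h2
  have hli : LinearIndependent ℝ fun i => (b i : Matrix (Fin 2) (Fin 2) ℝ) :=
    b.linearIndependent.map' 𝓑.subtype (Submodule.ker_subtype 𝓑)
  set A : Matrix (Fin 2) (Fin 2) ℝ := (b 0).1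
  set B : Matrix (Fin 2) (Fin 2) ℝ := (b 1).1
  have hA : A ≠ 0 := hli.ne_zero 0
  have gA := frobInner_self_pos hA
  set C := B - (frobInner A B / frobInner A A) • A with hC
  have hC0 : C ≠ 0 := by
    intro h0
    have h := Fintype.linearIndependent_iff.1 hli ![-(frobInner A B / frobInner A A), 1] (by
      rw [Fin.sum_univ_two, ← h0, hC]
      simp only [Matrix.cons_val_zero, Matrix.cons_val_one]
      module) 1
    simp at h
  have gC := frobInner_self_pos hC0
  have sA : frobInner A A = √(frobInner A A) * √(frobInner A A) := (Real.mul_self_sqrt gA.le).symm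
  have sC : frobInner C C = √(frobInner C C) * √(frobInner C C) := (Real.mul_self_sqrt gC.le).symm
  have pA : √(frobInner A A) ≠ 0 := (Real.sqrt_pos.2 gA).ne'
  have pC : √(frobInner C C) ≠ 0 := (Real.sqrt_pos.2 gC).ne'
  have smul₂ : ∀ (x y : ℝ) (P Q : Matrix (Fin 2) (Fin 2) ℝ),
      frobInner (x • P) (y • Q) = x * y * frobInner P Q := by
    intro x y P Q
    simp only [frobInner, Matrix.smul_apply, smul_eq_mul]; ring
  have hAC : frobInner A C = 0 := by
    have : frobInner A C = frobInner A B - frobInner A B / frobInner A A * frobInner A A := by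
      rw [hC]
      generalize frobInner A B / frobInner A A = k
      simp only [frobInner, Matrix.sub_apply, Matrix.smul_apply, smul_eq_mul]; ring
    rw [this, div_mul_cancel₀ _ gA.ne', sub_self]
  refine ⟨(√(frobInner A A))⁻¹ • A, 𝓑.smul_mem _ (b 0).2, (√(frobInner C C))⁻¹ • C,
    𝓑.smul_mem _ (𝓑.sub_mem (b 1).2 (𝓑.smul_mem _ (b 0).2)), ?_, ?_, ?_⟩
  · rw [smul₂]; nth_rw 3 [sA]; field_simp
  · rw [smul₂]; nth_rw 3 [sC]; field_simp
  · rw [smul₂, hAC, mul_zero]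

/-- A plane of matrices has a Frobenius-orthonormal basis which is orthogonal for `det`. -/
theorem exists_frob_orthonormal_det_orthogonal {𝓑 : Submodule ℝ (Matrix (Fin 2) (Fin 2) ℝ)}
    (h2 : Module.finrank ℝ 𝓑 = 2) : ∃ A ∈ 𝓑, ∃ B ∈ 𝓑, frobInner A A = 1 ∧ frobInner B B = 1 ∧
      frobInner A B = 0 ∧ detPolar A B = 0 := by
  obtain ⟨A, hA, B, hB, hAA, hBB, hAB⟩ := exists_frob_orthonormal h2
  -- Rotating A, B by θ/2 changes their polar product to half of this expression: a 2 × 2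
  -- simultaneous diagonalisation of det and the Frobenius form.
  obtain ⟨θ, hθ⟩ := exists_cos_sin_eq_zero (2 * detPolar A B) (detPolar B B - detPolar A A)
  have hcs := Real.sin_sq_add_cos_sq (θ / 2)
  have hc : Real.cos θ = Real.cos (θ / 2) ^ 2 - Real.sin (θ / 2) ^ 2 := by
    rw [show θ = 2 * (θ / 2) by ring, Real.cos_two_mul']; ring_nf
  have hs : Real.sin θ = 2 * Real.sin (θ / 2) * Real.cos (θ / 2) := by
    rw [← Real.sin_two_mul]; ring_nf
  rw [hc, hs] at hθ
  set c := Real.cos (θ / 2)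
  set s := Real.sin (θ / 2)
  refine ⟨c • A + s • B, 𝓑.add_mem (𝓑.smul_mem _ hA) (𝓑.smul_mem _ hB), (-s) • A + c • B,
    𝓑.add_mem (𝓑.smul_mem _ hA) (𝓑.smul_mem _ hB), ?_, ?_, ?_, ?_⟩
  · have : frobInner (c • A + s • B) (c • A + s • B) =
        c ^ 2 * frobInner A A + s ^ 2 * frobInner B B + 2 * (c * s) * frobInner A B := by
      simp only [frobInner, Matrix.add_apply, Matrix.smul_apply, smul_eq_mul]; ring
    rw [this, hAA, hBB, hAB]; linarith
  · have : frobInner ((-s) • A + c • B) ((-s) • A + c • B) =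
        s ^ 2 * frobInner A A + c ^ 2 * frobInner B B - 2 * (c * s) * frobInner A B := by
      simp only [frobInner, Matrix.add_apply, Matrix.smul_apply, smul_eq_mul]; ring
    rw [this, hAA, hBB, hAB]; linarith
  · have : frobInner (c • A + s • B) ((-s) • A + c • B) =
        c * s * (frobInner B B - frobInner A A) + (c ^ 2 - s ^ 2) * frobInner A B := by
      simp only [frobInner, Matrix.add_apply, Matrix.smul_apply, smul_eq_mul]; ring
    rw [this, hAA, hBB, hAB]; ring
  · have : detPolar (c • A + s • B) ((-s) • A + c • B) =
        c * s * (detPolar B B - detPolar A A) + (c ^ 2 - s ^ 2) * detPolar A B := by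
      simp only [detPolar, Matrix.add_apply, Matrix.smul_apply, smul_eq_mul]; ring
    rw [this]; linarith

theorem detPolar_rotMap (a b : ℝ) (A : Matrix (Fin 2) (Fin 2) ℝ) :
    detPolar (rotMap a b A) (rotMap a b A) = detPolar A A := by
  have h : ∀ A : Matrix (Fin 2) (Fin 2) ℝ, detPolar A A = 2 * A.det := fun A => by
    rw [detPolar, Matrix.det_fin_two]; ring
  have hr : ∀ a : ℝ, (rot a).det = 1 := fun a => by
    rw [rot, Matrix.det_fin_two_of]; nlinarith [Real.sin_sq_add_cos_sq a]
  rw [h, h, rotMap_apply, Matrix.det_mul, Matrix.det_mul, Matrix.det_transpose, hr, hr]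
  ring

/-- Normal form of planes of `2 × 2` matrices on which `det` is nondegenerate. -/
theorem exists_rotMap_eq_span {𝓑 : Submodule ℝ (Matrix (Fin 2) (Fin 2) ℝ)}
    (h2 : Module.finrank ℝ 𝓑 = 2) (hdet : detRank 𝓑 = 2) :
    ∃ a b p q : ℝ, 𝓑.map (rotMap a b) = Submodule.span ℝ {!![1, 0; 0, p], !![0, 1; q, 0]} := by
  obtain ⟨A, hA, B, hB, hAA, hBB, hAB, hdAB⟩ := exists_frob_orthonormal_det_orthogonal h2
  have hli : LinearIndependent ℝ ![A, B] := by
    rw [LinearIndependent.pair_iff]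
    intro s t hst
    have e1 : frobInner A (s • A + t • B) = s := by
      have : frobInner A (s • A + t • B) = s * frobInner A A + t * frobInner A B := by
        simp only [frobInner, Matrix.add_apply, Matrix.smul_apply, smul_eq_mul]; ring
      rw [this, hAA, hAB]; ring
    have e2 : frobInner B (s • A + t • B) = t := by
      have : frobInner B (s • A + t • B) = s * frobInner A B + t * frobInner B B := by
        simp only [frobInner, Matrix.add_apply, Matrix.smul_apply, smul_eq_mul]; ring
      rw [this, hBB, hAB]; ring
    rw [hst] at e1 e2
    simp only [frobInner, Matrix.zero_apply, mul_zero, add_zero] at e1 e2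
    exact ⟨e1.symm, e2.symm⟩
  have hspan : 𝓑 = Submodule.span ℝ {A, B} := by
    symm
    apply Submodule.eq_of_le_of_finrank_eq
    · rw [Submodule.span_le]
      rintro X (rfl | rfl) <;> assumption
    · have := finrank_span_eq_card hli
      rw [Matrix.range_cons_cons_empty] at this
      rw [this, h2, Fintype.card_fin]
  -- The Frobenius product plus or minus the polar form of det is the inner product of the conformal
  -- or anticonformal parts. So both parts of A are orthogonal to those of B.
  have hz : (A 0 0 + A 1 1) * (B 0 0 + B 1 1) + (A 0 1 - A 1 0) * (B 0 1 - B 1 0) = 0 := by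
    rw [frobInner] at hAB; rw [detPolar] at hdAB; linear_combination hAB + hdAB
  have hw : (A 0 0 - A 1 1) * (B 0 0 - B 1 1) + (A 0 1 + A 1 0) * (B 0 1 + B 1 0) = 0 := by
    rw [frobInner] at hAB; rw [detPolar] at hdAB; linear_combination hAB - hdAB
  obtain ⟨s, hs₁, hs₂⟩ := exists_rotation_to_axes hz
  obtain ⟨t, ht₁, ht₂⟩ := exists_rotation_to_axes hw
  -- Left and right rotations by a and b turn the conformal part by a - b and the anticonformal part
  -- by -(a + b), so the two angles can be prescribed independently.
  obtain ⟨a, b, hsab, htab⟩ : ∃ a b : ℝ, s = a - b ∧ t = -(a + b) :=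
    ⟨(s - t) / 2, -(s + t) / 2, by ring, by ring⟩
  rw [hsab, Real.sin_sub, Real.cos_sub] at hs₁ hs₂
  rw [htab, Real.sin_neg, Real.cos_neg, Real.sin_add, Real.cos_add] at ht₁ ht₂
  have entries : ∀ X : Matrix (Fin 2) (Fin 2) ℝ, rotMap a b X =
      !![Real.cos a * (X 0 0 * Real.cos b + X 0 1 * Real.sin b) +
          Real.sin a * (X 1 0 * Real.cos b + X 1 1 * Real.sin b),
        Real.cos a * (-(X 0 0 * Real.sin b) + X 0 1 * Real.cos b) +
          Real.sin a * (-(X 1 0 * Real.sin b) + X 1 1 * Real.cos b);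
        -(Real.sin a * (X 0 0 * Real.cos b + X 0 1 * Real.sin b)) +
          Real.cos a * (X 1 0 * Real.cos b + X 1 1 * Real.sin b),
        -(Real.sin a * (-(X 0 0 * Real.sin b) + X 0 1 * Real.cos b)) +
          Real.cos a * (-(X 1 0 * Real.sin b) + X 1 1 * Real.cos b)] := by
    intro X
    rw [rotMap_apply]
    ext i j
    fin_cases i <;> fin_cases j <;>
      simp [rot, Matrix.mul_apply, Fin.sum_univ_two]
  obtain ⟨α, δ, hA'⟩ : ∃ α δ : ℝ, rotMap a b A = !![α, 0; 0, δ] := by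
    refine ⟨rotMap a b A 0 0, rotMap a b A 1 1, ?_⟩
    rw [entries]
    ext i j
    fin_cases i <;> fin_cases j <;> simp only [Fin.zero_eta, Fin.mk_one, Fin.isValue,
      Matrix.of_apply, Matrix.cons_val', Matrix.cons_val_fin_one, Matrix.cons_val_zero,
      Matrix.cons_val_one]
    · linear_combination (hs₁ + ht₁) / 2
    · linear_combination (ht₁ - hs₁) / 2
  obtain ⟨β, γ, hB'⟩ : ∃ β γ : ℝ, rotMap a b B = !![0, β; γ, 0] := by
    refine ⟨rotMap a b B 0 1, rotMap a b B 1 0, ?_⟩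
    rw [entries]
    ext i j
    fin_cases i <;> fin_cases j <;> simp only [Fin.zero_eta, Fin.mk_one, Fin.isValue,
      Matrix.of_apply, Matrix.cons_val', Matrix.cons_val_fin_one, Matrix.cons_val_zero,
      Matrix.cons_val_one]
    · linear_combination (hs₂ + ht₂) / 2
    · linear_combination (hs₂ - ht₂) / 2
  have polar_comb : ∀ (X Y Z : Matrix (Fin 2) (Fin 2) ℝ) (x y : ℝ),
      detPolar X (x • Y + y • Z) = x * detPolar X Y + y * detPolar X Z := by
    intro X Y Z x y
    simp only [detPolar, Matrix.add_apply, Matrix.smul_apply, smul_eq_mul]; ring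
  have polar_comm : detPolar B A = 0 := by
    rw [← hdAB]; simp only [detPolar]; ring
  -- A is det-orthogonal to B, so a vanishing value would put A in the radical. Rotations preserve
  -- det, hence αδ ≠ 0 and, likewise for B, βγ ≠ 0, which allows division by α and β.
  have hAne : detPolar A A ≠ 0 := by
    intro h0
    refine hli.ne_zero 0 (eq_zero_of_detPolar_eq_zero h2 hdet hA fun X hX => ?_)
    rw [hspan] at hX
    obtain ⟨x, y, rfl⟩ := Submodule.mem_span_pair.1 hX
    change detPolar A _ = 0
    rw [polar_comb, h0, hdAB]; ring
  have hBne : detPolar B B ≠ 0 := by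
    intro h0
    refine hli.ne_zero 1 (eq_zero_of_detPolar_eq_zero h2 hdet hB fun X hX => ?_)
    rw [hspan] at hX
    obtain ⟨x, y, rfl⟩ := Submodule.mem_span_pair.1 hX
    change detPolar B _ = 0
    rw [polar_comb, h0, polar_comm]; ring
  rw [← detPolar_rotMap a b, hA'] at hAne
  rw [← detPolar_rotMap a b, hB'] at hBne
  have hα : α ≠ 0 := by rintro rfl; simp [detPolar] at hAne
  have hβ : β ≠ 0 := by rintro rfl; simp [detPolar] at hBne
  refine ⟨a, b, δ / α, γ / β, ?_⟩
  rw [hspan, Submodule.map_span, Set.image_pair, hA', hB']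
  have e1 : (!![α, 0; 0, δ] : Matrix (Fin 2) (Fin 2) ℝ) = α • !![1, 0; 0, δ / α] := by
    simp [Matrix.smul_of, mul_div_cancel₀ _ hα]
  have e2 : (!![0, β; γ, 0] : Matrix (Fin 2) (Fin 2) ℝ) = β • !![0, 1; γ / β, 0] := by
    simp [Matrix.smul_of, mul_div_cancel₀ _ hβ]
  rw [e1, e2, Submodule.span_insert, Submodule.span_insert,
    Submodule.span_singleton_smul_eq hα.isUnit, Submodule.span_singleton_smul_eq hβ.isUnit]

end BlockNormalForm

/-! ### Adapted frames and the space of second fundamental forms. -/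

section NormalFrames

open Filter Topology Set

variable {n : ℕ} {M : Type*} [TopologicalSpace M] [ChartedSpace (Euc 4) M]
  {F : M → Euc n} {E : M → Submodule ℝ (Euc n)} {x : M}

theorem inner_secondFundamentalForm {ν : Euc n} (hν : ν ∈ (tangentPlane F x)ᗮ)
    (a b : TangentSpace (𝓡 4) x) : inner ℝ ν (secondFundamentalForm F x a b) =
      inner ℝ ν (fderiv ℝ (fderiv ℝ (chartMap F x)) (extChartAt (𝓡 4) x x) a b) := by
  change inner ℝ ν ((tangentPlane F x)ᗮ.starProjection _) = _
  rw [← Submodule.inner_starProjection_left_eq_right, Submodule.starProjection_eq_self_iff.2 hν]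
  rfl

theorem exists_of_mem_spaceII {φ : LinearMap.BilinForm ℝ (TangentSpace (𝓡 4) x)}
    (hφ : φ ∈ spaceII F x) : ∃ ν ∈ (tangentPlane F x)ᗮ,
      ∀ a b, φ a b = inner ℝ ν (secondFundamentalForm F x a b) := by
  obtain ⟨ν, hν, rfl⟩ := hφ
  exact ⟨ν, hν, fun _ _ => rfl⟩

variable [IsManifold (𝓡 4) ∞ M]

theorem chartProj_base (E : M → Submodule ℝ (Euc n)) (x : M) :
    chartProj E x (extChartAt (𝓡 4) x x) = (E x).starProjection :=
  congrArg (fun y => (E y).starProjection) (extChartAt_to_inv x)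

theorem apply_eq_zero_of_hessian (hF : IsSmoothImmersion F)
    {φ : LinearMap.BilinForm ℝ (TangentSpace (𝓡 4) x)} (hφ : φ ∈ spaceII F x)
    {a b : TangentSpace (𝓡 4) x}
    (h : ∃ t, fderiv ℝ (fderiv ℝ (chartMap F x)) (extChartAt (𝓡 4) x x) a b =
      fderiv ℝ (chartMap F x) (extChartAt (𝓡 4) x x) t) : φ a b = 0 := by
  obtain ⟨ν, hν, hφν⟩ := exists_of_mem_spaceII hφ
  obtain ⟨t, ht⟩ := h
  rw [hφν, inner_secondFundamentalForm hν]
  refine (congrArg (inner ℝ ν) ht).trans ?_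
  exact (Submodule.mem_orthogonal' _ _).1 hν _ ⟨t, differential_apply hF.1 x t⟩

/-- The planes of the ruling are asymptotic. -/
theorem apply_eq_zero_of_mem (hF : IsSmoothImmersion F) (hE : IsPlaneField F E)
    (hR : IsRuledBy F E) {φ : LinearMap.BilinForm ℝ (TangentSpace (𝓡 4) x)}
    (hφ : φ ∈ spaceII F x) {a b : TangentSpace (𝓡 4) x} (ha : differential F x a ∈ E x)
    (hb : differential F x b ∈ E x) : φ a b = 0 := by
  have key : ∀ c : TangentSpace (𝓡 4) x, differential F x c ∈ E x →
      chartProj E x (extChartAt (𝓡 4) x x) (fderiv ℝ (chartMap F x) (extChartAt (𝓡 4) x x) c) =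
        fderiv ℝ (chartMap F x) (extChartAt (𝓡 4) x x) c := fun c hc => by
    rw [chartProj_base, ← differential_apply hF.1]
    exact Submodule.starProjection_eq_self_iff.2 hc
  exact apply_eq_zero_of_hessian hF hφ
    ((ruledPatch_chart hF hE hR x).hessian_of_mem_of_mem (mem_extChartAt_target x)
      (key b hb) (key a ha))

/-- At points of Type B, the planes orthogonal to the ruling are asymptotic. -/
theorem apply_eq_zero_of_orthogonal (hF : IsSmoothImmersion F) (hE : IsPlaneField F E)
    (hR : IsRuledBy F E) (hB : ∀ x, IsTypeBWithEigenspace F E x)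
    {φ : LinearMap.BilinForm ℝ (TangentSpace (𝓡 4) x)} (hφ : φ ∈ spaceII F x)
    {a b : TangentSpace (𝓡 4) x} (ha : differential F x a ∈ (E x)ᗮ)
    (hb : differential F x b ∈ (E x)ᗮ) : φ a b = 0 := by
  have key : ∀ c : TangentSpace (𝓡 4) x, differential F x c ∈ (E x)ᗮ →
      IsHorizontal (chartMap F x) (chartProj E x) (extChartAt (𝓡 4) x x) c := fun c hc => by
    change chartProj E x _ (fderiv ℝ (chartMap F x) _ c) = 0
    rw [chartProj_base, ← differential_apply hF.1]
    exact (Submodule.starProjection_apply_eq_zero_iff _).2 hc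
  exact apply_eq_zero_of_hessian hF hφ
    (hessian_of_isHorizontal hF hE hR hB x (mem_extChartAt_target x) a b (key a ha) (key b hb))

theorem apply_comm (hF : IsSmoothImmersion F) (hE : IsPlaneField F E)
    (hR : IsRuledBy F E) {φ : LinearMap.BilinForm ℝ (TangentSpace (𝓡 4) x)}
    (hφ : φ ∈ spaceII F x) (a b : TangentSpace (𝓡 4) x) : φ a b = φ b a := by
  obtain ⟨ν, hν, hφν⟩ := exists_of_mem_spaceII hφ
  rw [hφν, hφν, inner_secondFundamentalForm hν, inner_secondFundamentalForm hν]
  exact congrArg (inner ℝ ν)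
    ((ruledPatch_chart hF hE hR x).symm_fderiv (mem_extChartAt_target x) a b)

/-- Bounded above by δ, as an image of |II|, and below by the rank of det on it. -/
theorem finrank_blockSpace {e : Fin 4 → TangentSpace (𝓡 4) x} (hδ : normalRank F x = 2)
    (hdet : detRank (blockSpace F x e) = 2) : Module.finrank ℝ (blockSpace F x e) = 2 := by
  have : Module.Finite ℝ (spaceII F x) := Module.Finite.map _ _
  apply le_antisymm
  · exact (Submodule.finrank_map_le _ (spaceII F x)).trans_eq hδ
  · have h := LinearMap.finrank_range_le
      (QuadraticMap.polarBilin (detForm.comp (blockSpace F x e).subtype))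
    rwa [show Module.finrank ℝ _ = 2 from hdet] at h

namespace IsAdaptedFrame

variable {e e' : Fin 4 → TangentSpace (𝓡 4) x}

theorem inner_eq (he : IsAdaptedFrame F E x e) (i j : Fin 4) :
    inner ℝ (differential F x (e i)) (differential F x (e j)) = if i = j then (1 : ℝ) else 0 :=
  orthonormal_iff_ite.1 he.1 i j

theorem mem_zero (he : IsAdaptedFrame F E x e) : differential F x (e 0) ∈ E x := by
  rw [he.2]; exact Submodule.subset_span (by simp)

theorem mem_one (he : IsAdaptedFrame F E x e) : differential F x (e 1) ∈ E x := by
  rw [he.2]; exact Submodule.subset_span (by simp)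

theorem mem_orthogonal_iff (he : IsAdaptedFrame F E x e) {z : Euc n} :
    z ∈ (E x)ᗮ ↔ inner ℝ (differential F x (e 0)) z = (0 : ℝ) ∧
      inner ℝ (differential F x (e 1)) z = (0 : ℝ) := by
  rw [Submodule.mem_orthogonal]
  refine ⟨fun h => ⟨h _ he.mem_zero, h _ he.mem_one⟩, fun h y hy => ?_⟩
  rw [he.2] at hy
  obtain ⟨a, b, rfl⟩ := Submodule.mem_span_pair.1 hy
  rw [inner_add_left, real_inner_smul_left, real_inner_smul_left, h.1, h.2]; ring

theorem mem_two (he : IsAdaptedFrame F E x e) : differential F x (e 2) ∈ (E x)ᗮ :=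
  he.mem_orthogonal_iff.2 ⟨by simp [he.inner_eq], by simp [he.inner_eq]⟩

theorem mem_three (he : IsAdaptedFrame F E x e) : differential F x (e 3) ∈ (E x)ᗮ :=
  he.mem_orthogonal_iff.2 ⟨by simp [he.inner_eq], by simp [he.inner_eq]⟩

theorem exists_of_mem (he : IsAdaptedFrame F E x e) (hF : IsSmoothImmersion F)
    {z : TangentSpace (𝓡 4) x} (hz : differential F x z ∈ E x) :
    ∃ a b : ℝ, z = a • e 0 + b • e 1 := by
  rw [he.2] at hz
  obtain ⟨a, b, hab⟩ := Submodule.mem_span_pair.1 hz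
  exact ⟨a, b, hF.2 x (by rw [← hab, map_add, map_smul, map_smul])⟩

theorem exists_of_mem_orthogonal (he : IsAdaptedFrame F E x e)
    {z : TangentSpace (𝓡 4) x} (hz : differential F x z ∈ (E x)ᗮ) :
    ∃ a b : ℝ, z = a • e 2 + b • e 3 := by
  have hD : ∀ c : Fin 4 → ℝ, differential F x (c 0 • e 0 + c 1 • e 1 + c 2 • e 2 + c 3 • e 3) =
      c 0 • differential F x (e 0) + c 1 • differential F x (e 1) +
      c 2 • differential F x (e 2) + c 3 • differential F x (e 3) := fun c => by
    simp only [map_add, map_smul]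
  have hli : ∀ c : Fin 4 → ℝ, c 0 • e 0 + c 1 • e 1 + c 2 • e 2 + c 3 • e 3 = 0 → c = 0 := by
    intro c hc
    ext i
    refine eq_zero_of_orthonormal_combination he.1 ?_ i
    rw [Fin.sum_univ_four, ← hD, hc, map_zero]
  obtain ⟨c, hc⟩ : ∃ c : Fin 4 → ℝ, z = c 0 • e 0 + c 1 • e 1 + c 2 • e 2 + c 3 • e 3 :=
    exists_coords_of_finrank_eq_four (X := Euc 4) (by simp) e hli z
  have h := he.mem_orthogonal_iff.1 hz
  rw [hc, hD] at h
  simp only [inner_add_right, real_inner_smul_right, he.inner_eq] at h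
  have h0 : c 0 = 0 := by simpa using h.1
  have h1 : c 1 = 0 := by simpa using h.2
  rw [h0, h1, zero_smul, zero_smul, zero_add, zero_add] at hc
  exact ⟨c 2, c 3, hc⟩

/-- A form of `|II|` in the radical of the polar form of the determinant of the blocks vanishes. -/
theorem eq_zero_of_radical (he : IsAdaptedFrame F E x e) (he' : IsAdaptedFrame F E x e')
    (hF : IsSmoothImmersion F) (hδ : normalRank F x = 2) (hdet : detRank (blockSpace F x e') = 2)
    {φ : LinearMap.BilinForm ℝ (TangentSpace (𝓡 4) x)} (hφ : φ ∈ spaceII F x)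
    (h : ∀ ψ ∈ spaceII F x, φ (e 0) (e 2) * ψ (e 1) (e 3) + φ (e 1) (e 3) * ψ (e 0) (e 2) -
      φ (e 0) (e 3) * ψ (e 1) (e 2) - φ (e 1) (e 2) * ψ (e 0) (e 3) = 0) :
    φ (e 0) (e 2) = 0 ∧ φ (e 0) (e 3) = 0 := by
  obtain ⟨a₀, b₀, h0⟩ := he.exists_of_mem hF he'.mem_zero
  obtain ⟨a₁, b₁, h1⟩ := he.exists_of_mem hF he'.mem_one
  obtain ⟨a₂, b₂, h2⟩ := he.exists_of_mem_orthogonal he'.mem_two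
  obtain ⟨a₃, b₃, h3⟩ := he.exists_of_mem_orthogonal he'.mem_three
  have hz := eq_zero_of_detPolar_eq_zero (finrank_blockSpace hδ hdet) hdet
    (A := LinearMap.toMatrix₂Aux ℝ ![e' 0, e' 1] ![e' 2, e' 3] φ) ⟨φ, hφ, rfl⟩ (by
      rintro _ ⟨ψ, hψ, rfl⟩
      change φ (e' 0) (e' 2) * ψ (e' 1) (e' 3) + φ (e' 1) (e' 3) * ψ (e' 0) (e' 2) -
        φ (e' 0) (e' 3) * ψ (e' 1) (e' 2) - φ (e' 1) (e' 2) * ψ (e' 0) (e' 3) = 0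
      have := h ψ hψ
      rw [h0, h1, h2, h3]
      simp only [map_add, map_smul, LinearMap.add_apply, LinearMap.smul_apply, smul_eq_mul]
      -- A change of adapted frame multiplies the polar form of det by the determinants of the two 2
      -- × 2 changes of basis, so the radical does not depend on the frame.
      linear_combination (a₀ * b₁ - a₁ * b₀) * (a₂ * b₃ - a₃ * b₂) * this)
  have z02 : φ (e' 0) (e' 2) = 0 := congrFun (congrFun hz 0) 0
  have z03 : φ (e' 0) (e' 3) = 0 := congrFun (congrFun hz 0) 1
  have z12 : φ (e' 1) (e' 2) = 0 := congrFun (congrFun hz 1) 0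
  have z13 : φ (e' 1) (e' 3) = 0 := congrFun (congrFun hz 1) 1
  obtain ⟨c₀, d₀, k0⟩ := he'.exists_of_mem hF he.mem_zero
  obtain ⟨c₂, d₂, k2⟩ := he'.exists_of_mem_orthogonal he.mem_two
  obtain ⟨c₃, d₃, k3⟩ := he'.exists_of_mem_orthogonal he.mem_three
  rw [k0, k2, k3]
  simp [z02, z03, z12, z13]

end IsAdaptedFrame

end NormalFrames

/-- The symmetric `4 × 4` matrix with a given upper right block and vanishing diagonal blocks. -/
def offDiag : Matrix (Fin 2) (Fin 2) ℝ →ₗ[ℝ] Matrix (Fin 4) (Fin 4) ℝ where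
  toFun B := !![0, 0, B 0 0, B 0 1; 0, 0, B 1 0, B 1 1; B 0 0, B 1 0, 0, 0; B 0 1, B 1 1, 0, 0]
  map_add' A B := by ext i j; fin_cases i <;> fin_cases j <;> simp
  map_smul' c A := by ext i j; fin_cases i <;> fin_cases j <;> simp

theorem orthonormal_rotate {V : Type*} [NormedAddCommGroup V] [InnerProductSpace ℝ V] (a b : ℝ)
    {v : Fin 4 → V} (hv : Orthonormal ℝ v) :
    Orthonormal ℝ ![Real.cos a • v 0 + Real.sin a • v 1, -Real.sin a • v 0 + Real.cos a • v 1,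
      Real.cos b • v 2 + Real.sin b • v 3, -Real.sin b • v 2 + Real.cos b • v 3] := by
  have ha := Real.sin_sq_add_cos_sq a
  have hb := Real.sin_sq_add_cos_sq b
  have hin := orthonormal_iff_ite.1 hv
  rw [orthonormal_iff_ite]
  intro i j
  fin_cases i <;> fin_cases j <;>
    simp only [Fin.zero_eta, Fin.mk_one, Fin.reduceFinMk, Matrix.cons_val, inner_add_left,
      inner_add_right, real_inner_smul_left, real_inner_smul_right, hin, Fin.isValue,
      Fin.reduceEq, if_true, if_false] <;> linarith

/-! ### Existence of the normal form and the relation between its parameters. -/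

section NormalForm

open Filter Topology Set

variable {n : ℕ} {M : Type*} [TopologicalSpace M] [ChartedSpace (Euc 4) M]
  [IsManifold (𝓡 4) ∞ M] {F : M → Euc n} {E : M → Submodule ℝ (Euc n)} {x : M}
  {e : Fin 4 → TangentSpace (𝓡 4) x} {p q : ℝ}

theorem IsAdaptedFrame.matricesII_eq_map (he : IsAdaptedFrame F E x e) (hF : IsSmoothImmersion F)
    (hE : IsPlaneField F E) (hR : IsRuledBy F E) (hB : ∀ x, IsTypeBWithEigenspace F E x) :
    matricesII F x e = (blockSpace F x e).map offDiag := by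
  have key : ∀ φ ∈ spaceII F x, LinearMap.toMatrix₂Aux ℝ e e φ =
      offDiag (LinearMap.toMatrix₂Aux ℝ ![e 0, e 1] ![e 2, e 3] φ) := by
    intro φ hφ
    have v : ∀ a b, differential F x a ∈ E x → differential F x b ∈ E x → φ a b = 0 :=
      fun a b => apply_eq_zero_of_mem hF hE hR hφ
    have w : ∀ a b, differential F x a ∈ (E x)ᗮ → differential F x b ∈ (E x)ᗮ → φ a b = 0 :=
      fun a b => apply_eq_zero_of_orthogonal hF hE hR hB hφ
    have h0 := he.mem_zero
    have h1 := he.mem_one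
    have h2 := he.mem_two
    have h3 := he.mem_three
    ext i j
    fin_cases i <;> fin_cases j <;>
      first
      | rfl
      | exact v _ _ (by assumption) (by assumption)
      | exact w _ _ (by assumption) (by assumption)
      | exact apply_comm hF hE hR hφ _ _
  ext S
  constructor
  · rintro ⟨φ, hφ, rfl⟩
    exact ⟨_, ⟨φ, hφ, rfl⟩, (key φ hφ).symm⟩
  · rintro ⟨_, ⟨φ, hφ, rfl⟩, rfl⟩
    exact ⟨φ, hφ, key φ hφ⟩

/-- The frame obtained from `e` by rotations in the planes of `e₁, e₂` and of `e₃, e₄`. -/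
noncomputable def rotFrame (a b : ℝ) (e : Fin 4 → TangentSpace (𝓡 4) x) :
    Fin 4 → TangentSpace (𝓡 4) x :=
  ![Real.cos a • e 0 + Real.sin a • e 1, -Real.sin a • e 0 + Real.cos a • e 1,
    Real.cos b • e 2 + Real.sin b • e 3, -Real.sin b • e 2 + Real.cos b • e 3]

theorem IsAdaptedFrame.rotFrame (he : IsAdaptedFrame F E x e) (a b : ℝ) :
    IsAdaptedFrame F E x (rotFrame a b e) := by
  have ha := Real.sin_sq_add_cos_sq a
  constructor
  · have h := orthonormal_rotate a b he.1
    refine (congrArg (Orthonormal ℝ) (funext fun i => ?_)).mpr h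
    fin_cases i <;> simp only [Austere.rotFrame, Fin.zero_eta, Fin.mk_one, Fin.reduceFinMk,
      Matrix.cons_val, map_add, map_smul]
  · rw [he.2]
    apply le_antisymm
    · rw [Submodule.span_le]
      rintro z (rfl | rfl)
      · refine Submodule.mem_span_pair.2 ⟨Real.cos a, -Real.sin a, ?_⟩
        simp only [Austere.rotFrame, Matrix.cons_val_zero, Matrix.cons_val_one, map_add, map_smul]
        refine Eq.trans ?_ (congrArg (· • differential F x (e 0)) ha) |>.trans (one_smul ℝ _)
        module
      · refine Submodule.mem_span_pair.2 ⟨Real.sin a, Real.cos a, ?_⟩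
        simp only [Austere.rotFrame, Matrix.cons_val_zero, Matrix.cons_val_one, map_add, map_smul]
        refine Eq.trans ?_ (congrArg (· • differential F x (e 1)) ha) |>.trans (one_smul ℝ _)
        module
    · rw [Submodule.span_le]
      rintro z (rfl | rfl)
      · exact Submodule.mem_span_pair.2 ⟨Real.cos a, Real.sin a, by simp [Austere.rotFrame]⟩
      · exact Submodule.mem_span_pair.2 ⟨-Real.sin a, Real.cos a, by simp [Austere.rotFrame]⟩

theorem blockSpace_rotFrame (F : M → Euc n) (e : Fin 4 → TangentSpace (𝓡 4) x) (a b : ℝ) :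
    blockSpace F x (rotFrame a b e) = (blockSpace F x e).map (rotMap a b) := by
  rw [blockSpace, blockSpace, ← Submodule.map_comp]
  congr 1
  ext φ i j
  rw [LinearMap.comp_apply, rotMap_apply]
  fin_cases i <;> fin_cases j <;>
    simp [rotFrame, rot, Matrix.mul_apply, Fin.sum_univ_two] <;> ring

/-- The normal form at a point. -/
theorem exists_isNormalFrame (hF : IsSmoothImmersion F) (hE : IsPlaneField F E)
    (hR : IsRuledBy F E) (hB : ∀ x, IsTypeBWithEigenspace F E x) (hδ : normalRank F x = 2)
    (hdet : HasDetRankTwo F E x) :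
    ∃ (e : Fin 4 → TangentSpace (𝓡 4) x) (p q : ℝ), IsNormalFrame F E x e p q := by
  obtain ⟨e, he, hd⟩ := hdet
  obtain ⟨a, b, p, q, h⟩ := exists_rotMap_eq_span (finrank_blockSpace hδ hd) hd
  refine ⟨rotFrame a b e, p, q, he.rotFrame a b, ?_⟩
  rw [(he.rotFrame a b).matricesII_eq_map hF hE hR hB, blockSpace_rotFrame, h,
    Submodule.map_span, Set.image_pair]
  have e5 : offDiag !![1, 0; 0, p] = S5 p := by
    ext i j; fin_cases i <;> fin_cases j <;> rfl
  have e6 : offDiag !![0, 1; q, 0] = S6 q := by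
    ext i j; fin_cases i <;> fin_cases j <;> rfl
  rw [e5, e6]

namespace IsNormalFrame

theorem apply_eq (h : IsNormalFrame F E x e p q)
    {φ : LinearMap.BilinForm ℝ (TangentSpace (𝓡 4) x)} (hφ : φ ∈ spaceII F x) :
    φ (e 1) (e 3) = p * φ (e 0) (e 2) ∧ φ (e 1) (e 2) = q * φ (e 0) (e 3) := by
  have hm : LinearMap.toMatrix₂Aux ℝ e e φ ∈ matricesII F x e := ⟨φ, hφ, rfl⟩
  rw [h.2] at hm
  obtain ⟨s, t, hst⟩ := Submodule.mem_span_pair.1 hm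
  have hent : ∀ i j, (s • S5 p + t • S6 q) i j = φ (e i) (e j) := fun i j =>
    congrFun (congrFun hst i) j
  rw [← hent, ← hent, ← hent, ← hent]
  simp [S5, S6, mul_comm]

theorem exists_S5 (h : IsNormalFrame F E x e p q) :
    ∃ φ ∈ spaceII F x, φ (e 0) (e 2) = 1 ∧ φ (e 0) (e 3) = 0 := by
  have hm : S5 p ∈ matricesII F x e := by rw [h.2]; exact Submodule.subset_span (by simp)
  obtain ⟨φ, hφ, hS⟩ := hm
  exact ⟨φ, hφ, congrFun (congrFun hS 0) 2, congrFun (congrFun hS 0) 3⟩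

theorem exists_S6 (h : IsNormalFrame F E x e p q) :
    ∃ φ ∈ spaceII F x, φ (e 0) (e 2) = 0 ∧ φ (e 0) (e 3) = 1 := by
  have hm : S6 q ∈ matricesII F x e := by rw [h.2]; exact Submodule.subset_span (by simp)
  obtain ⟨φ, hφ, hS⟩ := hm
  exact ⟨φ, hφ, congrFun (congrFun hS 0) 2, congrFun (congrFun hS 0) 3⟩

/-- On the span of S⁵ and S⁶ the block determinant is p s² - q t², so p = 0 would place S⁵ in its
radical, and q = 0 would place S⁶ there. -/
theorem ne_zero (h : IsNormalFrame F E x e p q) (hF : IsSmoothImmersion F)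
    (hδ : normalRank F x = 2) (hdet : HasDetRankTwo F E x) : p ≠ 0 ∧ q ≠ 0 := by
  obtain ⟨e', he', hd⟩ := hdet
  constructor
  · rintro rfl
    obtain ⟨φ, hφ, h02, h03⟩ := h.exists_S5
    have := (h.1.eq_zero_of_radical he' hF hδ hd hφ fun ψ hψ => by
      rw [(h.apply_eq hφ).1, (h.apply_eq hφ).2, (h.apply_eq hψ).1, h03]; ring).1
    exact one_ne_zero (h02.symm.trans this)
  · rintro rfl
    obtain ⟨φ, hφ, h02, h03⟩ := h.exists_S6
    have := (h.1.eq_zero_of_radical he' hF hδ hd hφ fun ψ hψ => by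
      rw [(h.apply_eq hφ).1, (h.apply_eq hφ).2, (h.apply_eq hψ).2, h02]; ring).2
    exact one_ne_zero (h03.symm.trans this)

/-- Proportional values of the second fundamental form, in terms of second derivatives. -/
theorem exists_hessian_eq (hF : IsSmoothImmersion F) {r : ℝ} {a b c d : TangentSpace (𝓡 4) x}
    (h : ∀ φ ∈ spaceII F x, φ a b = r * φ c d) :
    ∃ t, fderiv ℝ (fderiv ℝ (chartMap F x)) (extChartAt (𝓡 4) x x) a b =
      r • fderiv ℝ (fderiv ℝ (chartMap F x)) (extChartAt (𝓡 4) x x) c d +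
        fderiv ℝ (chartMap F x) (extChartAt (𝓡 4) x x) t := by
  have hmem : (fderiv ℝ (fderiv ℝ (chartMap F x)) (extChartAt (𝓡 4) x x) a b -
      r • fderiv ℝ (fderiv ℝ (chartMap F x)) (extChartAt (𝓡 4) x x) c d : Euc n) ∈
        tangentPlane F x := by
    rw [← Submodule.orthogonal_orthogonal (tangentPlane F x), Submodule.mem_orthogonal]
    intro ν hν
    have := h (contractII F x ν) ⟨ν, hν, rfl⟩
    change inner ℝ ν (secondFundamentalForm F x a b) =
      r * inner ℝ ν (secondFundamentalForm F x c d) at this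
    rw [inner_secondFundamentalForm hν, inner_secondFundamentalForm hν] at this
    rw [inner_sub_right, real_inner_smul_right, sub_eq_zero]
    exact this
  obtain ⟨t, ht⟩ := hmem
  refine ⟨t, ?_⟩
  rw [← sub_eq_iff_eq_add', ← ht]
  exact differential_apply hF.1 x t

/-- The parameters of a normal form are inverse to each other. -/
theorem mul_eq_one (h : IsNormalFrame F E x e p q) (hF : IsSmoothImmersion F)
    (hE : IsPlaneField F E) (hR : IsRuledBy F E) (hB : ∀ x, IsTypeBWithEigenspace F E x)
    (hδ : normalRank F x = 2) (hdet : HasDetRankTwo F E x) : p * q = 1 := by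
  obtain ⟨hp, hq⟩ := h.ne_zero hF hδ hdet
  have hpatch := ruledPatch_chart hF hE hR x
  have hu := mem_extChartAt_target (I := 𝓡 4) x
  have hD : ∀ a : TangentSpace (𝓡 4) x,
      fderiv ℝ (chartMap F x) (extChartAt (𝓡 4) x x) a = differential F x a := fun a =>
    (differential_apply hF.1 x a).symm
  have n0 : ‖differential F x (e 0)‖ = 1 := h.1.1.1 0
  have n1 : ‖differential F x (e 1)‖ = 1 := h.1.1.1 1
  obtain ⟨φ₅, hφ₅, h₅₂, h₅₃⟩ := h.exists_S5
  obtain ⟨φ₆, hφ₆, h₆₂, h₆₃⟩ := h.exists_S6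
  rw [apply_comm hF hE hR hφ₅] at h₅₂ h₅₃
  rw [apply_comm hF hE hR hφ₆] at h₆₂ h₆₃
  obtain ⟨ν₅, hν₅, hI₅⟩ := exists_of_mem_spaceII hφ₅
  obtain ⟨ν₆, hν₆, hI₆⟩ := exists_of_mem_spaceII hφ₆
  rw [hI₅, inner_secondFundamentalForm hν₅] at h₅₂ h₅₃
  rw [hI₆, inner_secondFundamentalForm hν₆] at h₆₂ h₆₃
  have hnorm : ∀ ν ∈ (tangentPlane F x)ᗮ, ∀ s : Euc 4,
      inner ℝ ν (fderiv ℝ (chartMap F x) (extChartAt (𝓡 4) x x) s) = (0 : ℝ) := fun ν hν s =>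
    (Submodule.mem_orthogonal' _ _).1 hν _ ⟨s, (hD s).symm⟩
  obtain ⟨r, hr, hleaf⟩ := exists_leaf_curve hF hR x hu
  rw [extChartAt_to_inv] at hleaf
  have hon : Orthonormal ℝ fun i =>
      fderiv ℝ (chartMap F x) (extChartAt (𝓡 4) x x) (e i) := by
    rw [funext fun i => hD (e i)]; exact h.1.1
  -- Half the leaf radius suffices: |t₁|, |t₂| < r/2 keeps the displacement shorter than r.
  refine hpatch.mul_eq_one (X := Euc 4) (by simp) (fun y hy => hessian_of_isHorizontal hF hE hR hB x hy)
    hu (e := e) hon ?_ (half_pos hr) ?_ (hnorm ν₅ hν₅) (hnorm ν₆ hν₆) hp hq h₅₂ h₅₃ h₆₂ h₆₃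
    ?_ ?_
  · intro z
    rw [chartProj_base, hD, hD]
    have hgram : inner ℝ (differential F x (e 0)) (differential F x (e 0)) *
        inner ℝ (differential F x (e 1)) (differential F x (e 1)) -
        inner ℝ (differential F x (e 0)) (differential F x (e 1)) *
        inner ℝ (differential F x (e 0)) (differential F x (e 1)) = (1 : ℝ) := by
      simp [h.1.inner_eq, n0, n1]
    have hpr := starProjection_span_pair _ _ (by rw [hgram]; exact one_ne_zero) z
    rw [hgram] at hpr
    have hEx : (E x).starProjection z = (Submodule.span ℝ
        {differential F x (e 0), differential F x (e 1)}).starProjection z := by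
      simp only [← h.1.2]
    rw [hEx, hpr]
    simp [h.1.inner_eq, n0, n1]
  · intro t₁ t₂ h₁ h₂
    simp only [hD]
    refine hleaf _ ((E x).add_mem ((E x).smul_mem _ h.1.mem_zero)
      ((E x).smul_mem _ h.1.mem_one)) ?_
    refine (norm_add_le _ _).trans_lt ?_
    rw [norm_smul, norm_smul, n0, n1, Real.norm_eq_abs, Real.norm_eq_abs]
    linarith
  · exact exists_hessian_eq hF fun φ hφ => by
      rw [apply_comm hF hE hR hφ, apply_comm hF hE hR hφ (e 3), (h.apply_eq hφ).2]
  · exact exists_hessian_eq hF fun φ hφ => by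
      rw [apply_comm hF hE hR hφ, apply_comm hF hE hR hφ (e 2), (h.apply_eq hφ).1]

end IsNormalFrame

end NormalForm

end Austere

theorem mainTheorem8 {n : ℕ} {M : Type*} [TopologicalSpace M]
    [ChartedSpace (EuclideanSpace ℝ (Fin 4)) M] [IsManifold (𝓡 4) ∞ M]
    (F : M → EuclideanSpace ℝ (Fin n)) (hF : Austere.IsSmoothImmersion F)
    (hA : Austere.IsAustere F)
    (E : M → Submodule ℝ (EuclideanSpace ℝ (Fin n)))
    (hE : Austere.IsPlaneField F E) (hruled : Austere.IsRuledBy F E)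
    (hB : ∀ x, Austere.IsTypeBWithEigenspace F E x)
    (hδ : ∀ x, Austere.normalRank F x = 2)
    (hdet : ∀ x, Austere.HasDetRankTwo F E x) :
    ∀ x : M,
      (∃ (e : Fin 4 → TangentSpace (𝓡 4) x) (p q : ℝ), Austere.IsNormalFrame F E x e p q) ∧
      ∀ (e : Fin 4 → TangentSpace (𝓡 4) x) (p q : ℝ),
        Austere.IsNormalFrame F E x e p q → p * q = 1 :=
  fun x => ⟨Austere.exists_isNormalFrame hF hE hruled hB (hδ x) (hdet x),
    fun _ _ _ h => h.mul_eq_one hF hE hruled hB (hδ x) (hdet x)⟩
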